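/- **Setting.** Let $a<b$, $n_x,n_w,n_y,n_1,n_2,n_3\in\mathbb N$, $n_z=n_1+n_2+n_3$. Write $\mathbf z_p=\mathrm{col}(\mathbf z_1,\mathbf z_2,\mathbf z_3)\in L_2^{n_1}[a,b]\times W^{1,n_2}[a,b]\times W^{2,n_3}[a,b]$, subscript $s$ for $\partial_s$, $\mathbf z_d=\mathrm{col}(\mathbf z_{2s},\mathbf z_{3s})$ and $z_b=\mathrm{col}(\mathbf z_2(a),\mathbf z_2(b),\mathbf z_3(a),\mathbf z_3(b),\mathbf z_{3s}(a),\mathbf z_{3s}(b))$. Consider $$\dot x=Ax+\mathcal E\mathbf z_p+B_{wo}w,\qquad \dot{\mathbf z}_p=A_0\mathbf z_p+A_1\mathbf z_d+A_2\mathbf z_{3ss}+E x+B_{wp}w,\qquad y=Cx+\mathcal C\mathbf z_p+D_ww,$$ $$Bz_b=B_1x+B_2w,\qquad x(0)=0,\quad \mathbf z_p(0)=0,$$ $$\mathcal E\mathbf z_p=E_1z_b+\int_a^b(E_a\mathbf z_p+E_b\mathbf z_d)\,ds,\qquad \mathcal C\mathbf z_p=C_1z_b+\int_a^b(C_a\mathbf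 z_p+C_b\mathbf z_d)\,ds,$$ with real matrices $A,B_{wo},C,D_w,E_1,C_1,B,B_1,B_2$ and matrix-valued polynomials in $s\in[a,b]$: $A_0,A_1,A_2,E,B_{wp},E_a,E_b,C_a,C_b$. Here $B$ has $n_2+2n_3$ rows. A trajectory with input $w$ and output $y$ is a strong solution: $t\mapsto(x(t),\mathbf z_p(t))\in\mathbb R^{n_x}\times L_2^{n_z}[a,b]$ is locally absolutely continuous on $[0,\infty)$ (the integral of a locally Bochner integrable derivative), vanishes at $t=0$, and for a.e. $t$ lies in $\mathbb R^{n_x}\times L_2^{n_1}\times W^{1,n_2}\times W^{2,n_3}$ and satisfies the boundary condition, the state equations and the output equation. **PQRS data.** Write $\begin{bmatrix}P,Q_1,Q_2\\S,R_1,R_2\end{bmatrix}$ for a matrix $P$ and matrix-valued functions $Q_1,Q_2,S$ on $[a,b]$, $R_1,R_2$ on $[a,b]^2$; it represents the operator $(x,\mathbf z)\mapsto\big(Px+\int_a^bQ_1\mathbf z,\ Q_2(s)x+S(s)\mathbf z(s)+\int_a^sR_1(s,\theta)\mathbf z(\theta)d\theta+\int_s^bR_2(s,\theta)\mathbf z(\theta)d\theta\big)$.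 Sums and scalar multiples are entrywise. The adjoint $\begin{bmatrix}P,Q_1,Q_2\\S,R_1,R_2\end{bmatrix}^*$ has entries $P^\top,\ Q_2(s)^\top,\ Q_1(s)^\top;\ S(s)^\top,\ R_2(\eta,s)^\top,\ R_1(\eta,s)^\top$. The composition $\begin{bmatrix}\mathsf A,\mathsf B_1,\mathsf B_2\\\mathsf D,\mathsf C_1,\mathsf C_2\end{bmatrix}\times\begin{bmatrix}P,Q_1,Q_2\\S,R_1,R_2\end{bmatrix}=\begin{bmatrix}\hat P,\hat Q_1,\hat Q_2\\\hat S,\hat R_1,\hat R_2\end{bmatrix}$ has $\hat P=\mathsf AP+\int_a^b\mathsf B_1Q_2$, $\hat S=\mathsf DS$, $$\hat Q_1(s)=\mathsf AQ_1(s)+\mathsf B_1(s)S(s)+\int_s^b\mathsf B_1(\eta)R_1(\eta,s)d\eta+\int_a^s\mathsf B_1(\eta)R_2(\eta,s)d\eta,$$ $$\hat Q_2(s)=\mathsf B_2(s)P+\mathsf D(s)Q_2(s)+\int_a^s\mathsf C_1(s,\eta)Q_2(\eta)d\eta+\int_s^b\mathsf C_2(s,\eta)Q_2(\eta)d\eta,$$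 $$\hat R_1(s,\eta)=\mathsf B_2(s)Q_1(\eta)+\mathsf D(s)R_1(s,\eta)+\mathsf C_1(s,\eta)S(\eta)+\int_a^\eta\mathsf C_1(s,\theta)R_2(\theta,\eta)d\theta+\int_\eta^s\mathsf C_1(s,\theta)R_1(\theta,\eta)d\theta+\int_s^b\mathsf C_2(s,\theta)R_1(\theta,\eta)d\theta,$$ $$\hat R_2(s,\eta)=\mathsf B_2(s)Q_1(\eta)+\mathsf D(s)R_2(s,\eta)+\mathsf C_2(s,\eta)S(\eta)+\int_a^s\mathsf C_1(s,\theta)R_2(\theta,\eta)d\theta+\int_s^\eta\mathsf C_2(s,\theta)R_2(\theta,\eta)d\theta+\int_\eta^b\mathsf C_2(s,\theta)R_1(\theta,\eta)d\theta.$$ **The set $\Phi_d$** ($d\ge0$). For data on $\mathbb R^m\times L_2^n[a,b]$, let $Z_d(s)=\mathrm{col}(1,s,\dots,s^d)\otimes I_n$. Then $\Phi_d$ is the set of data that on $[a,b]$ equal a sum of two data, one with $g(s)=1$ and one with $g(s)=(s-a)(b-s)$, each of the following form for some symmetric block matrix $T=(T_{ij})_{i,j=1}^4\succeq0$, $Z_1=Z_d$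 and some matrix-valued polynomial $Z_2(s,\theta)$ with $n$ columns (any number of rows): $P=T_{11}\int_a^bg$, $Q_1=Q$, $Q_2=Q^\top$, $S(s)=g(s)Z_1(s)^\top T_{22}Z_1(s)$, where $$Q(\eta)=g(\eta)T_{12}Z_1(\eta)+\int_\eta^bg(s)T_{13}Z_2(s,\eta)ds+\int_a^\eta g(s)T_{14}Z_2(s,\eta)ds,$$ $$R_1(s,\eta)=g(s)Z_1(s)^\top T_{23}Z_2(s,\eta)+g(\eta)Z_2(\eta,s)^\top T_{42}Z_1(\eta)+\int_s^bg\,Z_2(\theta,s)^\top T_{33}Z_2(\theta,\eta)d\theta+\int_\eta^sg\,Z_2(\theta,s)^\top T_{43}Z_2(\theta,\eta)d\theta+\int_a^\eta g\,Z_2(\theta,s)^\top T_{44}Z_2(\theta,\eta)d\theta,$$ $$R_2(s,\eta)=g(s)Z_1(s)^\top T_{24}Z_2(s,\eta)+g(\eta)Z_2(\eta,s)^\top T_{32}Z_1(\eta)+\int_\eta^bg\,Z_2(\theta,s)^\top T_{33}Z_2(\theta,\eta)d\theta+\int_s^\eta g\,Z_2(\theta,s)^\top T_{34}Z_2(\theta,\eta)d\theta+\int_a^sg\,Z_2(\theta,s)^\top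 T_{44}Z_2(\theta,\eta)d\theta,$$ with $g=g(\theta)$ inside the last three integrals of $R_1$ and $R_2$. **System data.** Blocks are taken with respect to $\mathrm{col}(\mathbf z_1,\mathbf z_{2s},\mathbf z_{3ss})$ and $w_r=\mathrm{col}(w,x)$. Let $$T=\begin{bmatrix}I&0&0\\I&0&0\\0&I&0\\0&I&(b-a)I\\0&0&I\\0&0&I\end{bmatrix},\quad Q_b(\theta)=\begin{bmatrix}0&0&0\\0&I&0\\0&0&0\\0&0&(b-\theta)I\\0&0&0\\0&0&I\end{bmatrix},\quad K(s)=\begin{bmatrix}0&0&0\\I&0&0\\0&I&(s-a)I\end{bmatrix},\quad V=\begin{bmatrix}0&0&0\\0&0&I\end{bmatrix},$$ and assume that $BT$ is invertible (so that $B$ has row rank $n_2+2n_3$). Put $H_0=K(BT)^{-1}[B_2\ B_1]$, $H_1=V(BT)^{-1}[B_2\ B_1]$, $G_0=\mathrm{diag}(I,0,0)$, $G_2(s,\theta)=-K(s)(BT)^{-1}BQ_b(\theta)$, $G_1(s,\theta)=\mathrm{diag}(0,I,(s-\theta)I)+G_2(s,\theta)$, $G_3=\begin{bmatrix}0&I&0\\0&0&0\end{bmatrix}$,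 $G_5(s,\theta)=-V(BT)^{-1}BQ_b(\theta)$, $G_4(s,\theta)=\begin{bmatrix}0&0&0\\0&0&I\end{bmatrix}+G_5(s,\theta)$, $T_1=T(BT)^{-1}[B_2\ B_1]$, $T_2=Q_b-T(BT)^{-1}BQ_b$, $I_0=[I\ 0]$, $I_1=[0\ I]$ (so $w=I_0w_r$, $x=I_1w_r$), and $$\hat{\mathbf A}=\begin{bmatrix}0,E_a,0\\A_0,0,0\end{bmatrix}\times\begin{bmatrix}0,0,H_0\\G_0,G_1,G_2\end{bmatrix}+\begin{bmatrix}0,E_b,0\\A_1,0,0\end{bmatrix}\times\begin{bmatrix}0,0,H_1\\G_3,G_4,G_5\end{bmatrix}+\begin{bmatrix}E_1,0,0\\0,0,0\end{bmatrix}\times\begin{bmatrix}T_1,T_2,0\\0,0,0\end{bmatrix}+\begin{bmatrix}[0\ A],0,[0\ E]\\ [0\ 0\ A_2],0,0\end{bmatrix},$$ $$\hat{\mathbf C}=\begin{bmatrix}0,C_a,0\\0,0,0\end{bmatrix}\times\begin{bmatrix}0,0,H_0\\G_0,G_1,G_2\end{bmatrix}+\begin{bmatrix}0,C_b,0\\0,0,0\end{bmatrix}\times\begin{bmatrix}0,0,H_1\\G_3,G_4,G_5\end{bmatrix}+\begin{bmatrix}C_1,0,0\\0,0,0\end{bmatrix}\times\begin{bmatrix}T_1,T_2,0\\0,0,0\end{bmatrix}+\begin{bmatrix}[0\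 C],0,0\\0,0,0\end{bmatrix},$$ $$\hat{\mathbf B}=\begin{bmatrix}[B_{wo}\ 0],0,[B_{wp}\ 0]\\0,0,0\end{bmatrix},\qquad \hat D_0=[D_w\ 0],\qquad \hat{\mathbf D}=\begin{bmatrix}\hat D_0,0,0\\0,0,0\end{bmatrix}.$$ **Theorem.** Let $\epsilon>0$, $\gamma>0$, integers $d_1,d_2\ge0$, $P\in\mathbb S^{n_x}$, and matrix-valued polynomials $Q:\mathbb R\to\mathbb R^{n_x\times n_z}$, $S:\mathbb R\to\mathbb S^{n_z}$, $R_1,R_2:\mathbb R\times\mathbb R\to\mathbb R^{n_z\times n_z}$ satisfy $$\begin{bmatrix}P-\epsilon I,Q,Q^\top\\S-\epsilon I,R_1,R_2\end{bmatrix}\in\Phi_{d_1}\qquad\text{and}\qquad -J-J^*\in\Phi_{d_2},$$ where $$J=\mathbf K\times(\hat{\mathbf A}+\hat{\mathbf B})+\tfrac12\Big(\hat{\mathbf C}^*\times\hat{\mathbf C}+\begin{bmatrix}\hat D_0^\top\hat D_0-\gamma^2I_0^\top I_0,0,0\\0,0,0\end{bmatrix}\Big)+\hat{\mathbf C}^*\times\hat{\mathbf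 D},\qquad \mathbf K=\begin{bmatrix}I_1,0,H_0\\G_0,G_1,G_2\end{bmatrix}^*\times\begin{bmatrix}P,Q,Q^\top\\S,R_1,R_2\end{bmatrix}.$$ Then for every $w\in L_2^{n_w}[0,\infty)$ and $y\in L_2^{n_y}[0,\infty)$ that are the input and output of a trajectory of the system, $\|y\|_{L_2}\le\gamma\|w\|_{L_2}$. -/

import Mathlib

open MeasureTheory Set
open scoped Matrix Polynomial

noncomputable section

namespace CoupledODEPDE

/-! ### Matrix-valued polynomials and entrywise integrals -/

section Matrices

variable {m n : Type}

/-- The value at `s` of a matrix-valued polynomial. -/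
def ev (M : Matrix m n ℝ[X]) (s : ℝ) : Matrix m n ℝ :=
  M.map (fun p => p.eval s)

/-- The value at `(s, θ)` of a matrix-valued polynomial in two variables. -/
def ev₂ (M : Matrix m n (MvPolynomial (Fin 2) ℝ)) (s θ : ℝ) : Matrix m n ℝ :=
  M.map (fun p => MvPolynomial.eval ![s, θ] p)

/-- The entrywise integral `∫ θ in a..b, F θ` of a matrix-valued function. -/
def matInt (a b : ℝ) (F : ℝ → Matrix m n ℝ) : Matrix m n ℝ :=
  Matrix.of fun i j => ∫ θ in a..b, F θ i j

end Matrices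

/-! ### PQRS data -/

/-- The data `[P, Q₁, Q₂; S, R₁, R₂]` of the operator `ℝ^m × L₂^q[a,b] → ℝ^n × L₂^r[a,b]`,
`(x, z) ↦ (P x + ∫ₐᵇ Q₁ z, Q₂(s) x + S(s) z(s) + ∫ₐˢ R₁(s,θ) z(θ) dθ + ∫ₛᵇ R₂(s,θ) z(θ) dθ)`. -/
structure PQRS (m q n r : Type) where
  P : Matrix n m ℝ
  Q₁ : ℝ → Matrix n q ℝ
  Q₂ : ℝ → Matrix r m ℝ
  S : ℝ → Matrix r q ℝ
  R₁ : ℝ → ℝ → Matrix r q ℝ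
  R₂ : ℝ → ℝ → Matrix r q ℝ

namespace PQRS

variable {m q n r k l : Type}

instance : Add (PQRS m q n r) :=
  ⟨fun X Y => ⟨X.P + Y.P, X.Q₁ + Y.Q₁, X.Q₂ + Y.Q₂, X.S + Y.S, X.R₁ + Y.R₁, X.R₂ + Y.R₂⟩⟩

instance : Neg (PQRS m q n r) :=
  ⟨fun X => ⟨-X.P, -X.Q₁, -X.Q₂, -X.S, -X.R₁, -X.R₂⟩⟩

instance : Sub (PQRS m q n r) :=
  ⟨fun X Y => ⟨X.P - Y.P, X.Q₁ - Y.Q₁, X.Q₂ - Y.Q₂, X.S - Y.S, X.R₁ - Y.R₁, X.R₂ - Y.R₂⟩⟩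

instance : SMul ℝ (PQRS m q n r) :=
  ⟨fun c X => ⟨c • X.P, c • X.Q₁, c • X.Q₂, c • X.S, c • X.R₁, c • X.R₂⟩⟩

/-- The data of the adjoint operator. -/
def adj (X : PQRS m q n r) : PQRS n r m q where
  P := X.Pᵀ
  Q₁ s := (X.Q₂ s)ᵀ
  Q₂ s := (X.Q₁ s)ᵀ
  S s := (X.S s)ᵀ
  R₁ s η := (X.R₂ η s)ᵀ
  R₂ s η := (X.R₁ η s)ᵀ

/-- The data `X × Y` of the composition (first `Y`, then `X`) of two operators over `[a, b]`. -/
def comp [Fintype n] [Fintype r] (a b : ℝ) (X : PQRS n r k l) (Y : PQRS m q n r) :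
    PQRS m q k l where
  P := X.P * Y.P + matInt a b (fun s => X.Q₁ s * Y.Q₂ s)
  Q₁ s := X.P * Y.Q₁ s + X.Q₁ s * Y.S s + matInt s b (fun η => X.Q₁ η * Y.R₁ η s)
    + matInt a s (fun η => X.Q₁ η * Y.R₂ η s)
  Q₂ s := X.Q₂ s * Y.P + X.S s * Y.Q₂ s + matInt a s (fun η => X.R₁ s η * Y.Q₂ η)
    + matInt s b (fun η => X.R₂ s η * Y.Q₂ η)
  S s := X.S s * Y.S s
  R₁ s η := X.Q₂ s * Y.Q₁ η + X.S s * Y.R₁ s η + X.R₁ s η * Y.S η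
    + matInt a η (fun θ => X.R₁ s θ * Y.R₂ θ η)
    + matInt η s (fun θ => X.R₁ s θ * Y.R₁ θ η)
    + matInt s b (fun θ => X.R₂ s θ * Y.R₁ θ η)
  R₂ s η := X.Q₂ s * Y.Q₁ η + X.S s * Y.R₂ s η + X.R₂ s η * Y.S η
    + matInt a s (fun θ => X.R₁ s θ * Y.R₂ θ η)
    + matInt s η (fun θ => X.R₂ s θ * Y.R₂ θ η)
    + matInt η b (fun θ => X.R₂ s θ * Y.R₁ θ η)

/-- Two data are the same over `[a, b]`. -/
def AgreeOn (a b : ℝ) (X Y : PQRS m q n r) : Prop :=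
  X.P = Y.P ∧
    (∀ s ∈ Icc a b, X.Q₁ s = Y.Q₁ s ∧ X.Q₂ s = Y.Q₂ s ∧ X.S s = Y.S s) ∧
    ∀ s ∈ Icc a b, ∀ η ∈ Icc a b, X.R₁ s η = Y.R₁ s η ∧ X.R₂ s η = Y.R₂ s η

end PQRS

/-! ### The cones `Φ_d` -/

section Cone

variable {m n k₁ k₂ : Type}

/-- The PQRS data of the quadratic form
`∫ₐᵇ g(s) v(s)ᵀ T v(s) ds`, with
`v(s) = (x, Z₁(s) z(s), ∫ₐˢ Z₂(s,θ) z(θ) dθ, ∫ₛᵇ Z₂(s,θ) z(θ) dθ)`. -/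
def gramData [Fintype k₁] [Fintype k₂] (a b : ℝ) (g : ℝ → ℝ)
    (Z₁ : ℝ → Matrix k₁ n ℝ) (Z₂ : ℝ → ℝ → Matrix k₂ n ℝ)
    (T : Matrix (m ⊕ k₁ ⊕ k₂ ⊕ k₂) (m ⊕ k₁ ⊕ k₂ ⊕ k₂) ℝ) : PQRS m n m n :=
  let i₁ : m → m ⊕ k₁ ⊕ k₂ ⊕ k₂ := Sum.inl
  let i₂ : k₁ → m ⊕ k₁ ⊕ k₂ ⊕ k₂ := fun i => Sum.inr (Sum.inl i)
  let i₃ : k₂ → m ⊕ k₁ ⊕ k₂ ⊕ k₂ := fun i => Sum.inr (Sum.inr (Sum.inl i))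
  let i₄ : k₂ → m ⊕ k₁ ⊕ k₂ ⊕ k₂ := fun i => Sum.inr (Sum.inr (Sum.inr i))
  let Q : ℝ → Matrix m n ℝ := fun η =>
    g η • (T.submatrix i₁ i₂ * Z₁ η)
      + matInt η b (fun s => g s • (T.submatrix i₁ i₃ * Z₂ s η))
      + matInt a η (fun s => g s • (T.submatrix i₁ i₄ * Z₂ s η))
  { P := (∫ s in a..b, g s) • T.submatrix i₁ i₁
    Q₁ := Q
    Q₂ := fun η => (Q η)ᵀ
    S := fun s => g s • ((Z₁ s)ᵀ * T.submatrix i₂ i₂ * Z₁ s)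
    R₁ := fun s η =>
      g s • ((Z₁ s)ᵀ * T.submatrix i₂ i₃ * Z₂ s η)
        + g η • ((Z₂ η s)ᵀ * T.submatrix i₄ i₂ * Z₁ η)
        + matInt s b (fun θ => g θ • ((Z₂ θ s)ᵀ * T.submatrix i₃ i₃ * Z₂ θ η))
        + matInt η s (fun θ => g θ • ((Z₂ θ s)ᵀ * T.submatrix i₄ i₃ * Z₂ θ η))
        + matInt a η (fun θ => g θ • ((Z₂ θ s)ᵀ * T.submatrix i₄ i₄ * Z₂ θ η))
    R₂ := fun s η =>
      g s • ((Z₁ s)ᵀ * T.submatrix i₂ i₄ * Z₂ s η)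
        + g η • ((Z₂ η s)ᵀ * T.submatrix i₃ i₂ * Z₁ η)
        + matInt η b (fun θ => g θ • ((Z₂ θ s)ᵀ * T.submatrix i₃ i₃ * Z₂ θ η))
        + matInt s η (fun θ => g θ • ((Z₂ θ s)ᵀ * T.submatrix i₃ i₄ * Z₂ θ η))
        + matInt a s (fun θ => g θ • ((Z₂ θ s)ᵀ * T.submatrix i₄ i₄ * Z₂ θ η)) }

/-- `Z_d(s)`: the column of the monomials `1, s, …, s^d`, tensored with the identity matrix. -/
def monomials (n : Type) [DecidableEq n] (d : ℕ) (s : ℝ) : Matrix (Fin (d + 1) × n) n ℝ :=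
  Matrix.of fun p j => if p.2 = j then s ^ (p.1 : ℕ) else 0

/-- The data given by a positive semidefinite matrix `T` with weight `g`, `Z₁ = Z_d`, and a
matrix-valued polynomial `Z₂`. -/
def IsGram [Fintype n] [DecidableEq n] (a b : ℝ) (g : ℝ → ℝ) (d : ℕ)
    (X : PQRS m n m n) : Prop :=
  ∃ (e : ℕ) (Z₂ : Matrix (Fin e) n (MvPolynomial (Fin 2) ℝ))
    (T : Matrix (m ⊕ (Fin (d + 1) × n) ⊕ Fin e ⊕ Fin e)
      (m ⊕ (Fin (d + 1) × n) ⊕ Fin e ⊕ Fin e) ℝ),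
    T.PosSemidef ∧ X = gramData a b g (monomials n d) (ev₂ Z₂) T

/-- The cone `Φ_d` over `[a, b]`: sums of two data, one with weight `g(s) = 1` and one with
weight `g(s) = (s - a)(b - s)`. -/
def Phi [Fintype n] [DecidableEq n] (a b : ℝ) (d : ℕ) : Set (PQRS m n m n) :=
  {X | ∃ Y Y' : PQRS m n m n, IsGram a b (fun _ => 1) d Y ∧
    IsGram a b (fun s => (s - a) * (b - s)) d Y' ∧ X.AgreeOn a b (Y + Y')}

end Cone

/-! ### Index types and block matrices -/

/-- Components of `col(z₁, z₂, z₃)`. -/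
abbrev IxZ (n₁ n₂ n₃ : ℕ) : Type := Fin n₁ ⊕ Fin n₂ ⊕ Fin n₃

/-- Components of `col(z₂ₛ, z₃ₛ)`. -/
abbrev IxD (n₂ n₃ : ℕ) : Type := Fin n₂ ⊕ Fin n₃

/-- Components of `col(z₂(a), z₃(a), z₃ₛ(a))`; also the `n₂ + 2 n₃` rows of `B`. -/
abbrev IxC (n₂ n₃ : ℕ) : Type := Fin n₂ ⊕ Fin n₃ ⊕ Fin n₃

/-- Components of `z_b = col(z₂(a), z₂(b), z₃(a), z₃(b), z₃ₛ(a), z₃ₛ(b))`. -/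
abbrev IxB (n₂ n₃ : ℕ) : Type := Fin n₂ ⊕ Fin n₂ ⊕ Fin n₃ ⊕ Fin n₃ ⊕ Fin n₃ ⊕ Fin n₃

/-- Components of `w_r = col(w, x)`. -/
abbrev IxW (nw nx : ℕ) : Type := Fin nw ⊕ Fin nx

section Blocks

variable {m₁ m₂ m₃ m₄ m₅ m₆ n n₁ n₂ n₃ : Type}

/-- The block row `[X Y Z]`. -/
def row₃ (X : Matrix n n₁ ℝ) (Y : Matrix n n₂ ℝ) (Z : Matrix n n₃ ℝ) :
    Matrix n (n₁ ⊕ n₂ ⊕ n₃) ℝ :=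
  Matrix.fromCols X (Matrix.fromCols Y Z)

/-- The block column of three matrices. -/
def col₃ (X : Matrix m₁ n ℝ) (Y : Matrix m₂ n ℝ) (Z : Matrix m₃ n ℝ) :
    Matrix (m₁ ⊕ m₂ ⊕ m₃) n ℝ :=
  Matrix.fromRows X (Matrix.fromRows Y Z)

/-- The block column of six matrices. -/
def col₆ (X₁ : Matrix m₁ n ℝ) (X₂ : Matrix m₂ n ℝ) (X₃ : Matrix m₃ n ℝ)
    (X₄ : Matrix m₄ n ℝ) (X₅ : Matrix m₅ n ℝ) (X₆ : Matrix m₆ n ℝ) :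
    Matrix (m₁ ⊕ m₂ ⊕ m₃ ⊕ m₄ ⊕ m₅ ⊕ m₆) n ℝ :=
  Matrix.fromRows X₁ (Matrix.fromRows X₂ (Matrix.fromRows X₃
    (Matrix.fromRows X₄ (Matrix.fromRows X₅ X₆))))

end Blocks

/-! ### The coupled ODE-PDE system -/

/-- The coefficients of
* `ẋ = A x + ℰ z_p + B_wo w`,
* `ż_p = A₀ z_p + A₁ col(z₂ₛ, z₃ₛ) + A₂ z₃ₛₛ + E x + B_wp w`,
* `y = C x + 𝒞 z_p + D_w w`,
* `B z_b = B₁ x + B₂ w`,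

with `ℰ z_p = E₁ z_b + ∫ₐᵇ (E_a z_p + E_b col(z₂ₛ, z₃ₛ))` and likewise for `𝒞`. -/
structure System (nx nw ny n₁ n₂ n₃ : ℕ) where
  A : Matrix (Fin nx) (Fin nx) ℝ
  Bwo : Matrix (Fin nx) (Fin nw) ℝ
  C : Matrix (Fin ny) (Fin nx) ℝ
  Dw : Matrix (Fin ny) (Fin nw) ℝ
  A₀ : Matrix (IxZ n₁ n₂ n₃) (IxZ n₁ n₂ n₃) ℝ[X]
  A₁ : Matrix (IxZ n₁ n₂ n₃) (IxD n₂ n₃) ℝ[X]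
  A₂ : Matrix (IxZ n₁ n₂ n₃) (Fin n₃) ℝ[X]
  E : Matrix (IxZ n₁ n₂ n₃) (Fin nx) ℝ[X]
  Bwp : Matrix (IxZ n₁ n₂ n₃) (Fin nw) ℝ[X]
  E₁ : Matrix (Fin nx) (IxB n₂ n₃) ℝ
  Ea : Matrix (Fin nx) (IxZ n₁ n₂ n₃) ℝ[X]
  Eb : Matrix (Fin nx) (IxD n₂ n₃) ℝ[X]
  C₁ : Matrix (Fin ny) (IxB n₂ n₃) ℝ
  Ca : Matrix (Fin ny) (IxZ n₁ n₂ n₃) ℝ[X]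
  Cb : Matrix (Fin ny) (IxD n₂ n₃) ℝ[X]
  B : Matrix (IxC n₂ n₃) (IxB n₂ n₃) ℝ
  B₁ : Matrix (IxC n₂ n₃) (Fin nx) ℝ
  B₂ : Matrix (IxC n₂ n₃) (Fin nw) ℝ

/-- An element `(z₁, z₂, z₃)` of `L₂^{n₁} × W^{1,n₂} × W^{2,n₃}` on `[a, b]`: `z₂`, `z₃`, `z₃ₛ` are
the absolutely continuous representatives, recorded together with their derivatives. (The norm
used on `Fin n → ℝ` is immaterial for membership in `L₂`.) -/
structure SobolevState (a b : ℝ) (n₁ n₂ n₃ : ℕ) where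
  z₁ : ℝ → Fin n₁ → ℝ
  z₂ : ℝ → Fin n₂ → ℝ
  z₂s : ℝ → Fin n₂ → ℝ
  z₃ : ℝ → Fin n₃ → ℝ
  z₃s : ℝ → Fin n₃ → ℝ
  z₃ss : ℝ → Fin n₃ → ℝ
  memLp_z₁ : MemLp z₁ 2 (volume.restrict (Icc a b))
  memLp_z₂s : MemLp z₂s 2 (volume.restrict (Icc a b))
  memLp_z₃ss : MemLp z₃ss 2 (volume.restrict (Icc a b))
  z₂_eq : ∀ s ∈ Icc a b, z₂ s = z₂ a + ∫ θ in a..s, z₂s θ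
  z₃_eq : ∀ s ∈ Icc a b, z₃ s = z₃ a + ∫ θ in a..s, z₃s θ
  z₃s_eq : ∀ s ∈ Icc a b, z₃s s = z₃s a + ∫ θ in a..s, z₃ss θ

namespace SobolevState

variable {a b : ℝ} {n₁ n₂ n₃ : ℕ} (ζ : SobolevState a b n₁ n₂ n₃)

/-- `z_p(s) = col(z₁(s), z₂(s), z₃(s))`. -/
def zp (s : ℝ) : IxZ n₁ n₂ n₃ → ℝ :=
  Sum.elim (ζ.z₁ s) (Sum.elim (ζ.z₂ s) (ζ.z₃ s))

/-- `col(z₂ₛ(s), z₃ₛ(s))`. -/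
def zd (s : ℝ) : IxD n₂ n₃ → ℝ :=
  Sum.elim (ζ.z₂s s) (ζ.z₃s s)

/-- The boundary values `z_b`. -/
def zb : IxB n₂ n₃ → ℝ :=
  Sum.elim (ζ.z₂ a) (Sum.elim (ζ.z₂ b) (Sum.elim (ζ.z₃ a) (Sum.elim (ζ.z₃ b)
    (Sum.elim (ζ.z₃s a) (ζ.z₃s b)))))

end SobolevState

/-- The state space `L₂^{n_z}[a, b]` of the distributed state. -/
abbrev L2Z (a b : ℝ) (n₁ n₂ n₃ : ℕ) : Type :=
  Lp (EuclideanSpace ℝ (IxZ n₁ n₂ n₃)) 2 (volume.restrict (Icc a b))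

namespace System

variable {nx nw ny n₁ n₂ n₃ : ℕ} (sys : System nx nw ny n₁ n₂ n₃)

/-- First component of `𝒜̄ (x, z_p)`: `A x + ℰ z_p`. -/
def opA₁ {a b : ℝ} (x : Fin nx → ℝ) (ζ : SobolevState a b n₁ n₂ n₃) : Fin nx → ℝ :=
  sys.A *ᵥ x + (sys.E₁ *ᵥ ζ.zb
    + ∫ s in a..b, (ev sys.Ea s *ᵥ ζ.zp s + ev sys.Eb s *ᵥ ζ.zd s))

/-- Second component of `𝒜̄ (x, z_p)`: `E(s) x + (𝒜 z_p)(s)`. -/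
def opA₂ {a b : ℝ} (x : Fin nx → ℝ) (ζ : SobolevState a b n₁ n₂ n₃) (s : ℝ) :
    IxZ n₁ n₂ n₃ → ℝ :=
  ev sys.E s *ᵥ x
    + (ev sys.A₀ s *ᵥ ζ.zp s + ev sys.A₁ s *ᵥ ζ.zd s + ev sys.A₂ s *ᵥ ζ.z₃ss s)

/-- `𝒞̄ (x, z_p) = C x + 𝒞 z_p`. -/
def opC {a b : ℝ} (x : Fin nx → ℝ) (ζ : SobolevState a b n₁ n₂ n₃) : Fin ny → ℝ :=
  sys.C *ᵥ x + (sys.C₁ *ᵥ ζ.zb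
    + ∫ s in a..b, (ev sys.Ca s *ᵥ ζ.zp s + ev sys.Cb s *ᵥ ζ.zd s))

/-- `(x, z)` is a (strong) solution on `[0, ∞)`, with zero initial state, input `w` and output `y`:
`t ↦ (x(t), z(t)) ∈ ℝ^{nx} × L₂^{n_z}` is locally absolutely continuous with time derivative
`(x', z')`, starts at `0`, and for almost every `t` it lies in the domain (Sobolev regularity and
boundary conditions) and satisfies the state and output equations. -/
def IsTrajectory (a b : ℝ) (w : ℝ → EuclideanSpace ℝ (Fin nw))
    (y : ℝ → EuclideanSpace ℝ (Fin ny)) (x : ℝ → EuclideanSpace ℝ (Fin nx))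
    (z : ℝ → L2Z a b n₁ n₂ n₃) : Prop :=
  ∃ (x' : ℝ → EuclideanSpace ℝ (Fin nx)) (z' : ℝ → L2Z a b n₁ n₂ n₃),
    (∀ τ : ℝ, 0 ≤ τ → IntegrableOn x' (Icc 0 τ) ∧ IntegrableOn z' (Icc 0 τ) ∧
      x τ = (∫ t in (0 : ℝ)..τ, x' t) ∧ z τ = ∫ t in (0 : ℝ)..τ, z' t) ∧
    ∀ᵐ t ∂(volume.restrict (Ici (0 : ℝ))), ∃ ζ : SobolevState a b n₁ n₂ n₃,
      (∀ᵐ s ∂(volume.restrict (Icc a b)), (z t s).ofLp = ζ.zp s) ∧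
      sys.B *ᵥ ζ.zb = sys.B₁ *ᵥ (x t).ofLp + sys.B₂ *ᵥ (w t).ofLp ∧
      (x' t).ofLp = sys.opA₁ (x t).ofLp ζ + sys.Bwo *ᵥ (w t).ofLp ∧
      (∀ᵐ s ∂(volume.restrict (Icc a b)),
        (z' t s).ofLp = sys.opA₂ (x t).ofLp ζ s + ev sys.Bwp s *ᵥ (w t).ofLp) ∧
      (y t).ofLp = sys.opC (x t).ofLp ζ + sys.Dw *ᵥ (w t).ofLp

/-! ### Representation in the fundamental state `z_f = col(z₁, z₂ₛ, z₃ₛₛ)` -/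

/-- `T`: the boundary values are `z_b = T col(z₂(a), z₃(a), z₃ₛ(a)) + ∫ₐᵇ Q(θ) z_f(θ) dθ`. -/
def matT (a b : ℝ) (n₂ n₃ : ℕ) : Matrix (IxB n₂ n₃) (IxC n₂ n₃) ℝ :=
  col₆ (row₃ 1 0 0) (row₃ 1 0 0) (row₃ 0 1 0) (row₃ 0 1 ((b - a) • 1)) (row₃ 0 0 1) (row₃ 0 0 1)

/-- The matrix function `Q(s, θ)`, which does not depend on `s`. -/
def matQ (b : ℝ) (n₁ n₂ n₃ : ℕ) (θ : ℝ) : Matrix (IxB n₂ n₃) (IxZ n₁ n₂ n₃) ℝ :=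
  col₆ (row₃ 0 0 0) (row₃ 0 1 0) (row₃ 0 0 0) (row₃ 0 0 ((b - θ) • 1)) (row₃ 0 0 0) (row₃ 0 0 1)

def matK (a : ℝ) (n₁ n₂ n₃ : ℕ) (s : ℝ) : Matrix (IxZ n₁ n₂ n₃) (IxC n₂ n₃) ℝ :=
  col₃ (row₃ 0 0 0) (row₃ 1 0 0) (row₃ 0 1 ((s - a) • 1))

def matV (n₂ n₃ : ℕ) : Matrix (IxD n₂ n₃) (IxC n₂ n₃) ℝ :=
  Matrix.fromRows (row₃ 0 0 0) (row₃ 0 0 1)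

/-- `(B T)⁻¹ [B₂ B₁]`. -/
def bcW (a b : ℝ) : Matrix (IxC n₂ n₃) (IxW nw nx) ℝ :=
  (sys.B * matT a b n₂ n₃)⁻¹ * Matrix.fromCols sys.B₂ sys.B₁

/-- `(B T)⁻¹ B Q(θ)`. -/
def bcQ (a b θ : ℝ) : Matrix (IxC n₂ n₃) (IxZ n₁ n₂ n₃) ℝ :=
  (sys.B * matT a b n₂ n₃)⁻¹ * sys.B * matQ b n₁ n₂ n₃ θ

def H₀ (a b s : ℝ) : Matrix (IxZ n₁ n₂ n₃) (IxW nw nx) ℝ := matK a n₁ n₂ n₃ s * sys.bcW a b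

def H₁ (a b : ℝ) (_s : ℝ) : Matrix (IxD n₂ n₃) (IxW nw nx) ℝ := matV n₂ n₃ * sys.bcW a b

def G₀ (n₁ n₂ n₃ : ℕ) (_s : ℝ) : Matrix (IxZ n₁ n₂ n₃) (IxZ n₁ n₂ n₃) ℝ :=
  col₃ (row₃ 1 0 0) (row₃ 0 0 0) (row₃ 0 0 0)

def G₂ (a b s θ : ℝ) : Matrix (IxZ n₁ n₂ n₃) (IxZ n₁ n₂ n₃) ℝ :=
  -(matK a n₁ n₂ n₃ s * sys.bcQ a b θ)

def G₁ (a b s θ : ℝ) : Matrix (IxZ n₁ n₂ n₃) (IxZ n₁ n₂ n₃) ℝ :=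
  col₃ (row₃ 0 0 0) (row₃ 0 1 0) (row₃ 0 0 ((s - θ) • 1)) + sys.G₂ a b s θ

def G₃ (n₁ n₂ n₃ : ℕ) (_s : ℝ) : Matrix (IxD n₂ n₃) (IxZ n₁ n₂ n₃) ℝ :=
  Matrix.fromRows (row₃ 0 1 0) (row₃ 0 0 0)

def G₅ (a b : ℝ) (_s θ : ℝ) : Matrix (IxD n₂ n₃) (IxZ n₁ n₂ n₃) ℝ :=
  -(matV n₂ n₃ * sys.bcQ a b θ)

def G₄ (a b s θ : ℝ) : Matrix (IxD n₂ n₃) (IxZ n₁ n₂ n₃) ℝ :=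
  Matrix.fromRows (row₃ 0 0 0) (row₃ 0 0 1) + sys.G₅ a b s θ

/-- `z_p` in terms of `(w_r, z_f)`. -/
def stateData (a b : ℝ) : PQRS (IxW nw nx) (IxZ n₁ n₂ n₃) (Fin 0) (IxZ n₁ n₂ n₃) :=
  ⟨0, 0, sys.H₀ a b, G₀ n₁ n₂ n₃, sys.G₁ a b, sys.G₂ a b⟩

/-- `col(z₂ₛ, z₃ₛ)` in terms of `(w_r, z_f)`. -/
def derivData (a b : ℝ) : PQRS (IxW nw nx) (IxZ n₁ n₂ n₃) (Fin 0) (IxD n₂ n₃) :=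
  ⟨0, 0, sys.H₁ a b, G₃ n₁ n₂ n₃, sys.G₄ a b, sys.G₅ a b⟩

/-- `z_b = T₁ w_r + ∫ₐᵇ T₂(θ) z_f(θ) dθ` in terms of `(w_r, z_f)`, where `T₁ = T (B T)⁻¹ [B₂ B₁]`
and `T₂ = Q - T (B T)⁻¹ B Q`. -/
def boundaryData (a b : ℝ) : PQRS (IxW nw nx) (IxZ n₁ n₂ n₃) (IxB n₂ n₃) (Fin 0) :=
  ⟨matT a b n₂ n₃ * sys.bcW a b,
    fun θ => matQ b n₁ n₂ n₃ θ - matT a b n₂ n₃ * sys.bcQ a b θ, 0, 0, 0, 0⟩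

/-- `I₀ = [I 0]`, so that `w = I₀ w_r`. -/
def I₀ (nw nx : ℕ) : Matrix (Fin nw) (IxW nw nx) ℝ := Matrix.fromCols 1 0

/-- `I₁ = [0 I]`, so that `x = I₁ w_r`. -/
def I₁ (nw nx : ℕ) : Matrix (Fin nx) (IxW nw nx) ℝ := Matrix.fromCols 0 1

/-- `(x, z_p)` in terms of `(w_r, z_f)`. -/
def data0 (a b : ℝ) : PQRS (IxW nw nx) (IxZ n₁ n₂ n₃) (Fin nx) (IxZ n₁ n₂ n₃) :=
  ⟨I₁ nw nx, 0, sys.H₀ a b, G₀ n₁ n₂ n₃, sys.G₁ a b, sys.G₂ a b⟩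

/-- `[Â₀, Â₁, Â₂; Â₃, Â₄, Â₅]`. -/
def dataA (a b : ℝ) : PQRS (IxW nw nx) (IxZ n₁ n₂ n₃) (Fin nx) (IxZ n₁ n₂ n₃) :=
  PQRS.comp a b ⟨0, ev sys.Ea, 0, ev sys.A₀, 0, 0⟩ (sys.stateData a b)
    + PQRS.comp a b ⟨0, ev sys.Eb, 0, ev sys.A₁, 0, 0⟩ (sys.derivData a b)
    + PQRS.comp a b ⟨sys.E₁, 0, 0, 0, 0, 0⟩ (sys.boundaryData a b)
    + ⟨Matrix.fromCols 0 sys.A, 0, fun s => Matrix.fromCols 0 (ev sys.E s),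
        fun s => row₃ 0 0 (ev sys.A₂ s), 0, 0⟩

/-- `[B̂₀, 0, B̂₂; 0, 0, 0]`. -/
def dataB : PQRS (IxW nw nx) (IxZ n₁ n₂ n₃) (Fin nx) (IxZ n₁ n₂ n₃) :=
  ⟨Matrix.fromCols sys.Bwo 0, 0, fun s => Matrix.fromCols (ev sys.Bwp s) 0, 0, 0, 0⟩

/-- `[Ĉ₀, Ĉ₁, 0; 0, 0, 0]`. -/
def dataC (a b : ℝ) : PQRS (IxW nw nx) (IxZ n₁ n₂ n₃) (Fin ny) (Fin 0) :=
  PQRS.comp a b ⟨0, ev sys.Ca, 0, 0, 0, 0⟩ (sys.stateData a b)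
    + PQRS.comp a b ⟨0, ev sys.Cb, 0, 0, 0, 0⟩ (sys.derivData a b)
    + PQRS.comp a b ⟨sys.C₁, 0, 0, 0, 0, 0⟩ (sys.boundaryData a b)
    + ⟨Matrix.fromCols 0 sys.C, 0, 0, 0, 0, 0⟩

/-- `D̂₀ = [D_w 0]`. -/
def D₀ : Matrix (Fin ny) (IxW nw nx) ℝ := Matrix.fromCols sys.Dw 0

/-- `[D̂₀, 0, 0; 0, 0, 0]`. -/
def dataD : PQRS (IxW nw nx) (IxZ n₁ n₂ n₃) (Fin ny) (Fin 0) :=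
  ⟨sys.D₀, 0, 0, 0, 0, 0⟩

/-- `J = K × (Â + B̂) + ½ (Ĉ* × Ĉ + [D̂₀ᵀ D̂₀ - γ² I₀ᵀ I₀, 0, 0; 0, 0, 0]) + Ĉ* × D̂`, where
`K = [I₁, 0, H₀; G₀, G₁, G₂]* × X`. -/
def dataJ (a b γ : ℝ) (X : PQRS (Fin nx) (IxZ n₁ n₂ n₃) (Fin nx) (IxZ n₁ n₂ n₃)) :
    PQRS (IxW nw nx) (IxZ n₁ n₂ n₃) (IxW nw nx) (IxZ n₁ n₂ n₃) :=
  PQRS.comp a b (PQRS.comp a b (sys.data0 a b).adj X) (sys.dataA a b + sys.dataB)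
    + (1 / 2 : ℝ) • (PQRS.comp a b (sys.dataC a b).adj (sys.dataC a b)
      + ⟨sys.D₀ᵀ * sys.D₀ - γ ^ 2 • ((I₀ nw nx)ᵀ * I₀ nw nx), 0, 0, 0, 0, 0⟩)
    + PQRS.comp a b (sys.dataC a b).adj sys.dataD

end System

end CoupledODEPDE

end

open CoupledODEPDE

/-!
The proof is a Lyapunov argument for the storage function `V(t) = ⟨v(t), X v(t)⟩`, where
`v = (x, z_p)` and `X` is the bounded operator on `ℝ^{nx} × L₂` given by the data
`[P, Q, Qᵀ; S, R₁, R₂]`.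

*Calculus of data.* All data involved are continuous. For such data the entrywise composition and
adjoint formulas represent composition and adjoint of operators (`PQRS.form_comp`,
`PQRS.form_adj`): writing both kernels `R₁`, `R₂` as the single kernel `PQRS.ker`, this is Fubini's
theorem.

*Positivity.* A Gram datum factors as `L* (g T) L` (`gramData_eq_comp`), so that every element of
`Φ_d` has a symmetric and nonnegative quadratic form (`Phi.form_symm_nonneg`).

*The fundamental state.* Invertibility of `B T` allows the boundary values, `z_p` and
`col(z₂ₛ, z₃ₛ)` to be recovered from `ω = (w, x)` and `z_f = col(z₁, z₂ₛ, z₃ₛₛ)`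
(`System.stateData_opF`, `System.derivData_opF`, `System.boundaryData_opV`). Hence the quadratic
form of `J` at `(ω, z_f)` is half of `V' + |y|² - γ² |w|²` (`System.dataJ_form`), and
`-J - J* ∈ Φ_{d₂}` yields the dissipation inequality `V' ≤ γ² |w|² - |y|²` (`System.dissipation`).

*Integration in time.* Since `X` is bounded and symmetric and `v` is a primitive, `V` is the
primitive of `2 ⟨v, X v'⟩` (`inner_primitive_eq_integral`). As `V(0) = 0` and `V(τ) ≥ 0`,
integrating over `[0, τ]` gives `∫ |y|² ≤ γ² ∫ |w|²`
(`System.IsTrajectory.integral_norm_sq_le`); the claim follows as `τ → ∞`.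
-/

namespace CoupledODEPDE

open scoped ENNReal

set_option linter.unusedSectionVars false

/-! ### Bounded matrix-valued functions -/

section BoundedMatrices

variable {α : Type} [MeasurableSpace α] {μ : Measure α} {n r q : Type}

/-- All entries of a matrix-valued function are essentially bounded. -/
def EssBdd (μ : Measure α) (F : α → Matrix r q ℝ) : Prop :=
  ∀ i j, MemLp (fun s => F s i j) ∞ μ

lemma EssBdd.transpose {F : α → Matrix r q ℝ} (hF : EssBdd μ F) :
    EssBdd μ (fun s => (F s)ᵀ) := fun i j => hF j i

lemma EssBdd.mul [Fintype n] {F : α → Matrix r n ℝ} {G : α → Matrix n q ℝ}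
    (hF : EssBdd μ F) (hG : EssBdd μ G) : EssBdd μ (fun s => F s * G s) := by
  intro i j
  simp only [Matrix.mul_apply]
  exact memLp_finsetSum _ fun k _ => (hG k j).mul (p := ∞) (q := ∞) (hF i k)

lemma EssBdd.mulVec [Fintype r] [Fintype q] {F : α → Matrix r q ℝ} (hF : EssBdd μ F)
    {p : ℝ≥0∞} {z : α → q → ℝ} (hz : MemLp z p μ) : MemLp (fun s => F s *ᵥ z s) p μ := by
  refine memLp_pi_iff.2 fun i => ?_
  simp only [Matrix.mulVec, dotProduct]
  refine memLp_finsetSum _ fun j _ => ?_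
  have : MemLp (fun s => z s j) p μ := memLp_pi_iff.1 hz j
  exact this.mul (p := ∞) (q := p) (hF i j)

lemma EssBdd.integrable_mulVec [Fintype r] [Fintype q] {F : α → Matrix r q ℝ} (hF : EssBdd μ F)
    {z : α → q → ℝ} (hz : Integrable z μ) : Integrable (fun s => F s *ᵥ z s) μ :=
  memLp_one_iff_integrable.1 (hF.mulVec (memLp_one_iff_integrable.2 hz))

lemma EssBdd.memLp_mulVec_const [Fintype r] [Fintype q] [IsFiniteMeasure μ]
    {F : α → Matrix r q ℝ} (hF : EssBdd μ F) (p : ℝ≥0∞) (x : q → ℝ) :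
    MemLp (fun s => F s *ᵥ x) p μ :=
  hF.mulVec (memLp_const x)

lemma _root_.MeasureTheory.MemLp.integrable_dotProduct [Fintype q] {f z : α → q → ℝ}
    (hf : MemLp f 2 μ) (hz : MemLp z 2 μ) : Integrable (fun s => f s ⬝ᵥ z s) μ := by
  simp only [dotProduct]
  refine integrable_finsetSum _ fun j _ => ?_
  exact (memLp_pi_iff.1 hf j).integrable_mul (memLp_pi_iff.1 hz j)

lemma mulVec_integral [Fintype r] [Fintype q] (M : Matrix r q ℝ) {f : α → q → ℝ}
    (hf : Integrable f μ) :
    M *ᵥ ∫ s, f s ∂μ = ∫ s, M *ᵥ f s ∂μ :=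
  ((Matrix.mulVecLin M).toContinuousLinearMap.integral_comp_comm hf).symm

lemma dotProduct_integral [Fintype q] (u : q → ℝ) {f : α → q → ℝ} (hf : Integrable f μ) :
    u ⬝ᵥ ∫ s, f s ∂μ = ∫ s, u ⬝ᵥ f s ∂μ :=
  ((dotProductBilin ℝ ℝ u).toContinuousLinearMap.integral_comp_comm hf).symm

/-- The entrywise integral of a matrix-valued function against a measure. -/
noncomputable def setMatInt (μ : Measure α) (F : α → Matrix r q ℝ) : Matrix r q ℝ :=
  Matrix.of fun i j => ∫ s, F s i j ∂μ

lemma setMatInt_mulVec [Fintype r] [Fintype q] {F : α → Matrix r q ℝ}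
    (hF : ∀ i j, Integrable (fun s => F s i j) μ) (x : q → ℝ) :
    setMatInt μ F *ᵥ x = ∫ s, F s *ᵥ x ∂μ := by
  have h : ∀ i, Integrable (fun s => (F s *ᵥ x) i) μ := fun i => by
    simp only [Matrix.mulVec, dotProduct]
    exact integrable_finsetSum _ fun j _ => (hF i j).mul_const _
  ext i
  rw [eval_integral h]
  simp only [Matrix.mulVec, dotProduct]
  rw [integral_finsetSum _ fun j _ => (hF i j).mul_const _]
  simp [setMatInt, integral_mul_const]

/-- Fubini's theorem for a product of matrix kernels applied to an integrable function. -/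
lemma integral_mulVec_integral_mulVec [Fintype n] [Fintype r] [Fintype q]
    [IsFiniteMeasure μ] {U : α → Matrix r q ℝ} {k : α → α → Matrix q n ℝ} {z : α → n → ℝ}
    (hU : EssBdd μ U)
    (hk : EssBdd (μ.prod μ) fun p => k p.1 p.2) (hk₁ : ∀ᵐ θ ∂μ, EssBdd μ (k θ))
    (hk₂ : ∀ᵐ η ∂μ, EssBdd μ fun θ => k θ η) (hz : Integrable z μ) :
    ∫ θ, U θ *ᵥ ∫ η, k θ η *ᵥ z η ∂μ ∂μ
      = ∫ η, setMatInt μ (fun θ => U θ * k θ η) *ᵥ z η ∂μ := by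
  have hU' : EssBdd (μ.prod μ) fun p => U p.1 := fun i j => (hU i j).comp_fst μ
  have hint : Integrable (fun p : α × α => U p.1 *ᵥ (k p.1 p.2 *ᵥ z p.2)) (μ.prod μ) :=
    hU'.integrable_mulVec (hk.integrable_mulVec (hz.comp_snd μ))
  calc ∫ θ, U θ *ᵥ ∫ η, k θ η *ᵥ z η ∂μ ∂μ
      = ∫ θ, ∫ η, U θ *ᵥ (k θ η *ᵥ z η) ∂μ ∂μ := by
        refine integral_congr_ae ?_
        filter_upwards [hk₁] with θ hθ
        exact mulVec_integral _ (hθ.integrable_mulVec hz)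
    _ = ∫ η, ∫ θ, U θ *ᵥ (k θ η *ᵥ z η) ∂μ ∂μ := integral_integral_swap hint
    _ = _ := by
        refine integral_congr_ae ?_
        filter_upwards [hk₂] with η hη
        rw [setMatInt_mulVec fun i j => ((hU.mul hη) i j).integrable le_top]
        simp only [Matrix.mulVec_mulVec]

/-- Fubini's theorem for the bilinear form of a matrix kernel. -/
lemma integral_dotProduct_integral_mulVec [Fintype n] [Fintype q] [IsFiniteMeasure μ]
    {k : α → α → Matrix q n ℝ} {f : α → q → ℝ} {z : α → n → ℝ}
    (hk : EssBdd (μ.prod μ) fun p => k p.1 p.2)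
    (hk₁ : ∀ᵐ θ ∂μ, EssBdd μ (k θ)) (hk₂ : ∀ᵐ η ∂μ, EssBdd μ fun θ => k θ η)
    (hf : Integrable f μ) (hz : Integrable z μ) :
    ∫ θ, f θ ⬝ᵥ ∫ η, k θ η *ᵥ z η ∂μ ∂μ
      = ∫ η, (∫ θ, (k θ η)ᵀ *ᵥ f θ ∂μ) ⬝ᵥ z η ∂μ := by
  have hint : Integrable (fun p : α × α => f p.1 ⬝ᵥ (k p.1 p.2 *ᵥ z p.2)) (μ.prod μ) := by
    simp only [dotProduct, Matrix.mulVec, Finset.mul_sum]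
    refine integrable_finsetSum _ fun i _ => integrable_finsetSum _ fun j _ => ?_
    have h := (((integrable_pi_iff.1 hf i).mul_prod (integrable_pi_iff.1 hz j)))
    refine ((memLp_one_iff_integrable.2 h).mul (p := ∞) (q := 1) (r := 1)
      (hk i j) |>.integrable le_rfl).congr (Filter.Eventually.of_forall fun p => ?_)
    simp only [Pi.mul_apply]
    ring
  calc ∫ θ, f θ ⬝ᵥ ∫ η, k θ η *ᵥ z η ∂μ ∂μ
      = ∫ θ, ∫ η, f θ ⬝ᵥ (k θ η *ᵥ z η) ∂μ ∂μ := by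
        refine integral_congr_ae ?_
        filter_upwards [hk₁] with θ hθ
        exact dotProduct_integral _ (hθ.integrable_mulVec hz)
    _ = ∫ η, ∫ θ, f θ ⬝ᵥ (k θ η *ᵥ z η) ∂μ ∂μ := integral_integral_swap hint
    _ = _ := by
        refine integral_congr_ae ?_
        filter_upwards [hk₂] with η hη
        rw [dotProduct_comm _ (z η), dotProduct_integral _ (hη.transpose.integrable_mulVec hf)]
        refine integral_congr_ae (Filter.Eventually.of_forall fun θ => ?_)
        change f θ ⬝ᵥ k θ η *ᵥ z η = z η ⬝ᵥ (k θ η)ᵀ *ᵥ f θ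
        rw [Matrix.mulVec_transpose, dotProduct_comm (z η), ← Matrix.dotProduct_mulVec]

end BoundedMatrices

/-! ### Continuous data -/

section Continuity

variable {r q : Type} {T : Type} [TopologicalSpace T]

lemma continuous_ev (M : Matrix r q ℝ[X]) : Continuous (ev M) :=
  continuous_matrix fun i j => (M i j).continuous

lemma continuous_ev₂ (M : Matrix r q (MvPolynomial (Fin 2) ℝ)) :
    Continuous fun p : ℝ × ℝ => ev₂ M p.1 p.2 :=
  continuous_matrix fun i j => (MvPolynomial.continuous_eval (M i j)).comp
    (continuous_pi fun k => by fin_cases k <;> simp <;> fun_prop)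

lemma continuous_matInt {F : T → ℝ → Matrix r q ℝ} {α β : T → ℝ}
    (hF : Continuous fun p : T × ℝ => F p.1 p.2) (hα : Continuous α) (hβ : Continuous β) :
    Continuous fun t => matInt (α t) (β t) (F t) := by
  refine continuous_matrix fun i j => ?_
  have hij : Continuous fun p : T × ℝ => F p.1 p.2 i j := hF.matrix_elem i j
  have h : ∀ t, ∫ θ in α t..β t, F t θ i j
      = (∫ θ in (0 : ℝ)..β t, F t θ i j) - ∫ θ in (0 : ℝ)..α t, F t θ i j := fun t => by
    have ht : Continuous fun θ => F t θ i j := hij.comp (by fun_prop : Continuous fun θ => (t, θ))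
    rw [intervalIntegral.integral_interval_sub_left] <;> exact ht.intervalIntegrable _ _
  simp only [matInt, Matrix.of_apply, h]
  exact (intervalIntegral.continuous_parametric_intervalIntegral_of_continuous
      (f := fun t θ => F t θ i j) hij hβ).sub
    (intervalIntegral.continuous_parametric_intervalIntegral_of_continuous
      (f := fun t θ => F t θ i j) hij hα)

lemma essBdd_of_continuous {F : ℝ → Matrix r q ℝ} (hF : Continuous F) (a b : ℝ) :
    EssBdd (volume.restrict (Icc a b)) F := fun i j => by
  obtain ⟨C, hC⟩ := (isCompact_Icc (a := a) (b := b)).exists_bound_of_continuousOn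
    (hF.matrix_elem i j).continuousOn
  exact memLp_top_of_bound (hF.matrix_elem i j).aestronglyMeasurable C
    ((ae_restrict_iff' measurableSet_Icc).2 (Filter.Eventually.of_forall hC))

end Continuity

/-- An integral over `[a, b]` of a function that is given by a different continuous formula on
each of the pieces `(a, c)`, `(c, d)`, `(d, b)`. -/
lemma setIntegral_Icc_eq_add_add {a b c d : ℝ} (hac : a ≤ c) (hcd : c ≤ d) (hdb : d ≤ b)
    {f f₁ f₂ f₃ : ℝ → ℝ} (h₁ : Continuous f₁) (h₂ : Continuous f₂) (h₃ : Continuous f₃)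
    (e₁ : ∀ θ, θ < c → f θ = f₁ θ) (e₂ : ∀ θ, c < θ → θ < d → f θ = f₂ θ)
    (e₃ : ∀ θ, d < θ → f θ = f₃ θ) :
    ∫ θ in Icc a b, f θ
      = (∫ θ in a..c, f₁ θ) + (∫ θ in c..d, f₂ θ) + ∫ θ in d..b, f₃ θ := by
  have E₁ : EqOn f₁ f (uIoo a c) := fun θ h => by
    rw [uIoo_of_le hac] at h; exact (e₁ θ h.2).symm
  have E₂ : EqOn f₂ f (uIoo c d) := fun θ h => by
    rw [uIoo_of_le hcd] at h; exact (e₂ θ h.1 h.2).symm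
  have E₃ : EqOn f₃ f (uIoo d b) := fun θ h => by
    rw [uIoo_of_le hdb] at h; exact (e₃ θ h.1).symm
  have i₁ := (h₁.intervalIntegrable (μ := volume) a c).congr_uIoo E₁
  have i₂ := (h₂.intervalIntegrable (μ := volume) c d).congr_uIoo E₂
  have i₃ := (h₃.intervalIntegrable (μ := volume) d b).congr_uIoo E₃
  rw [intervalIntegral.integral_congr_uIoo E₁, intervalIntegral.integral_congr_uIoo E₂,
    intervalIntegral.integral_congr_uIoo E₃, intervalIntegral.integral_add_adjacent_intervals i₁ i₂,
    intervalIntegral.integral_add_adjacent_intervals (i₁.trans i₂) i₃, integral_Icc_eq_integral_Ioc,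
    intervalIntegral.integral_of_le (hac.trans (hcd.trans hdb))]

lemma setMatInt_Icc_eq_add_add {r q : Type} {a b c d : ℝ} (hac : a ≤ c) (hcd : c ≤ d)
    (hdb : d ≤ b) {F F₁ F₂ F₃ : ℝ → Matrix r q ℝ} (h₁ : Continuous F₁) (h₂ : Continuous F₂)
    (h₃ : Continuous F₃) (e₁ : ∀ θ, θ < c → F θ = F₁ θ) (e₂ : ∀ θ, c < θ → θ < d → F θ = F₂ θ)
    (e₃ : ∀ θ, d < θ → F θ = F₃ θ) :
    setMatInt (volume.restrict (Icc a b)) F = matInt a c F₁ + matInt c d F₂ + matInt d b F₃ := by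
  ext i j
  simp only [setMatInt, matInt, Matrix.add_apply, Matrix.of_apply]
  exact setIntegral_Icc_eq_add_add hac hcd hdb (h₁.matrix_elem i j) (h₂.matrix_elem i j)
    (h₃.matrix_elem i j) (fun θ h => by rw [e₁ θ h]) (fun θ h h' => by rw [e₂ θ h h'])
    (fun θ h => by rw [e₃ θ h])

lemma matInt_self {r q : Type} (c : ℝ) (F : ℝ → Matrix r q ℝ) : matInt c c F = 0 := by
  ext i j; simp [matInt]

/-- The case of two pieces, `(a, c)` and `(c, b)`. -/
lemma setMatInt_Icc_eq_add {r q : Type} {a b c : ℝ} (hac : a ≤ c)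
    (hcb : c ≤ b) {F F₁ F₂ : ℝ → Matrix r q ℝ} (h₁ : Continuous F₁)
    (h₂ : Continuous F₂) (e₁ : ∀ θ, θ < c → F θ = F₁ θ) (e₂ : ∀ θ, c < θ → F θ = F₂ θ) :
    setMatInt (volume.restrict (Icc a b)) F = matInt a c F₁ + matInt c b F₂ := by
  rw [setMatInt_Icc_eq_add_add hac le_rfl hcb h₁ h₁ h₂ e₁ (fun θ h h' => absurd (h.trans h')
    (lt_irrefl _)) e₂, matInt_self, add_zero]

lemma setMatInt_Icc {r q : Type} {a b : ℝ} (hab : a ≤ b) (F : ℝ → Matrix r q ℝ) :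
    setMatInt (volume.restrict (Icc a b)) F = matInt a b F := by
  ext i j
  simp [setMatInt, matInt, intervalIntegral.integral_of_le hab, integral_Icc_eq_integral_Ioc]

namespace PQRS

variable {m q n r k l : Type}

/-- All the matrix-valued functions of the data are continuous. -/
structure Cont (X : PQRS m q n r) : Prop where
  Q₁ : Continuous X.Q₁
  Q₂ : Continuous X.Q₂
  S : Continuous X.S
  R₁ : Continuous fun p : ℝ × ℝ => X.R₁ p.1 p.2
  R₂ : Continuous fun p : ℝ × ℝ => X.R₂ p.1 p.2

namespace Cont

variable {X Y : PQRS m q n r}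

lemma R₁_comp (hX : X.Cont) {T : Type} [TopologicalSpace T] {f g : T → ℝ} (hf : Continuous f)
    (hg : Continuous g) : Continuous fun t => X.R₁ (f t) (g t) := hX.R₁.comp (hf.prodMk hg)

lemma R₂_comp (hX : X.Cont) {T : Type} [TopologicalSpace T] {f g : T → ℝ} (hf : Continuous f)
    (hg : Continuous g) : Continuous fun t => X.R₂ (f t) (g t) := hX.R₂.comp (hf.prodMk hg)

lemma add (hX : X.Cont) (hY : Y.Cont) : (X + Y).Cont :=
  ⟨hX.Q₁.add hY.Q₁, hX.Q₂.add hY.Q₂, hX.S.add hY.S, hX.R₁.add hY.R₁, hX.R₂.add hY.R₂⟩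

lemma smul (c : ℝ) (hX : X.Cont) : (c • X).Cont :=
  ⟨hX.Q₁.const_smul c, hX.Q₂.const_smul c, hX.S.const_smul c, hX.R₁.const_smul c,
    hX.R₂.const_smul c⟩

lemma adj (hX : X.Cont) : X.adj.Cont :=
  ⟨hX.Q₂.matrix_transpose, hX.Q₁.matrix_transpose, hX.S.matrix_transpose,
    (hX.R₂_comp continuous_snd continuous_fst).matrix_transpose,
    (hX.R₁_comp continuous_snd continuous_fst).matrix_transpose⟩

lemma comp [Fintype n] [Fintype r] (a b : ℝ) {X : PQRS n r k l} (hX : X.Cont) (hY : Y.Cont) :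
    (PQRS.comp a b X Y).Cont where
  Q₁ := by
    refine (((continuous_const.matrix_mul hY.Q₁).add (hX.Q₁.matrix_mul hY.S)).add
      (continuous_matInt ?_ continuous_id continuous_const)).add
      (continuous_matInt ?_ continuous_const continuous_id)
    · exact (hX.Q₁.comp continuous_snd).matrix_mul (hY.R₁_comp continuous_snd continuous_fst)
    · exact (hX.Q₁.comp continuous_snd).matrix_mul (hY.R₂_comp continuous_snd continuous_fst)
  Q₂ := by
    refine (((hX.Q₂.matrix_mul continuous_const).add (hX.S.matrix_mul hY.Q₂)).add
      (continuous_matInt ?_ continuous_const continuous_id)).add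
      (continuous_matInt ?_ continuous_id continuous_const)
    · exact hX.R₁.matrix_mul (hY.Q₂.comp continuous_snd)
    · exact hX.R₂.matrix_mul (hY.Q₂.comp continuous_snd)
  S := hX.S.matrix_mul hY.S
  R₁ := by
    have h₁ : Continuous fun p : (ℝ × ℝ) × ℝ => p.1.1 := by fun_prop
    have h₂ : Continuous fun p : (ℝ × ℝ) × ℝ => p.1.2 := by fun_prop
    refine (((((((hX.Q₂.comp continuous_fst).matrix_mul (hY.Q₁.comp continuous_snd)).add
      ((hX.S.comp continuous_fst).matrix_mul hY.R₁)).add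
      (hX.R₁.matrix_mul (hY.S.comp continuous_snd))).add
      (continuous_matInt ?_ continuous_const continuous_snd)).add
      (continuous_matInt ?_ continuous_snd continuous_fst)).add
      (continuous_matInt ?_ continuous_fst continuous_const))
    · exact (hX.R₁_comp h₁ continuous_snd).matrix_mul (hY.R₂_comp continuous_snd h₂)
    · exact (hX.R₁_comp h₁ continuous_snd).matrix_mul (hY.R₁_comp continuous_snd h₂)
    · exact (hX.R₂_comp h₁ continuous_snd).matrix_mul (hY.R₁_comp continuous_snd h₂)
  R₂ := by
    have h₁ : Continuous fun p : (ℝ × ℝ) × ℝ => p.1.1 := by fun_prop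
    have h₂ : Continuous fun p : (ℝ × ℝ) × ℝ => p.1.2 := by fun_prop
    refine (((((((hX.Q₂.comp continuous_fst).matrix_mul (hY.Q₁.comp continuous_snd)).add
      ((hX.S.comp continuous_fst).matrix_mul hY.R₂)).add
      (hX.R₂.matrix_mul (hY.S.comp continuous_snd))).add
      (continuous_matInt ?_ continuous_const continuous_fst)).add
      (continuous_matInt ?_ continuous_fst continuous_snd)).add
      (continuous_matInt ?_ continuous_snd continuous_const))
    · exact (hX.R₁_comp h₁ continuous_snd).matrix_mul (hY.R₂_comp continuous_snd h₂)
    · exact (hX.R₂_comp h₁ continuous_snd).matrix_mul (hY.R₂_comp continuous_snd h₂)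
    · exact (hX.R₂_comp h₁ continuous_snd).matrix_mul (hY.R₁_comp continuous_snd h₂)

end Cont

/-! ### The kernel of the integral part -/

/-- The kernel that is `R₁` below the diagonal and `R₂` elsewhere. -/
noncomputable def ker (X : PQRS m q n r) (s θ : ℝ) : Matrix r q ℝ :=
  if θ < s then X.R₁ s θ else X.R₂ s θ

lemma ker_of_lt (X : PQRS m q n r) {s θ : ℝ} (h : θ < s) : X.ker s θ = X.R₁ s θ := if_pos h

lemma ker_of_le (X : PQRS m q n r) {s θ : ℝ} (h : s ≤ θ) : X.ker s θ = X.R₂ s θ :=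
  if_neg h.not_gt

lemma exists_ker_bound [Fintype q] [Fintype r] {X : PQRS m q n r} (hX : X.Cont) (a b : ℝ) :
    ∃ C, ∀ s ∈ Icc a b, ∀ θ ∈ Icc a b, ∀ i j, |X.ker s θ i j| ≤ C := by
  have hK : IsCompact (Icc a b ×ˢ Icc a b) := isCompact_Icc.prod isCompact_Icc
  have c₁ : Continuous fun p : ℝ × ℝ => (fun i j => X.R₁ p.1 p.2 i j : r → q → ℝ) :=
    continuous_pi fun i => continuous_pi fun j => hX.R₁.matrix_elem i j
  have c₂ : Continuous fun p : ℝ × ℝ => (fun i j => X.R₂ p.1 p.2 i j : r → q → ℝ) :=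
    continuous_pi fun i => continuous_pi fun j => hX.R₂.matrix_elem i j
  obtain ⟨C₁, h₁⟩ := hK.exists_bound_of_continuousOn c₁.continuousOn
  obtain ⟨C₂, h₂⟩ := hK.exists_bound_of_continuousOn c₂.continuousOn
  refine ⟨max C₁ C₂, fun s hs θ hθ i j => ?_⟩
  rcases lt_or_ge θ s with h | h
  · rw [X.ker_of_lt h]
    exact (((norm_le_pi_norm _ j).trans (norm_le_pi_norm
      (fun i j => X.R₁ s θ i j : r → q → ℝ) i)).trans (h₁ (s, θ) ⟨hs, hθ⟩)).trans (le_max_left _ _)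
  · rw [X.ker_of_le h]
    exact (((norm_le_pi_norm _ j).trans (norm_le_pi_norm
      (fun i j => X.R₂ s θ i j : r → q → ℝ) i)).trans (h₂ (s, θ) ⟨hs, hθ⟩)).trans (le_max_right _ _)

lemma measurable_ker {X : PQRS m q n r} (hX : X.Cont) (i : r) (j : q) :
    Measurable fun p : ℝ × ℝ => X.ker p.1 p.2 i j := by
  have h : (fun p : ℝ × ℝ => X.ker p.1 p.2 i j)
      = fun p => if p.2 < p.1 then X.R₁ p.1 p.2 i j else X.R₂ p.1 p.2 i j := by
    ext p; simp only [ker]; split_ifs <;> rfl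
  rw [h]
  exact Measurable.ite (measurableSet_lt measurable_snd measurable_fst)
    (hX.R₁.matrix_elem i j).measurable (hX.R₂.matrix_elem i j).measurable

lemma essBdd_ker_prod [Fintype q] [Fintype r] {X : PQRS m q n r} (hX : X.Cont) (a b : ℝ) :
    EssBdd ((volume.restrict (Icc a b)).prod (volume.restrict (Icc a b)))
      fun p => X.ker p.1 p.2 := fun i j => by
  obtain ⟨C, hC⟩ := exists_ker_bound hX a b
  refine memLp_top_of_bound (measurable_ker hX i j).aestronglyMeasurable C ?_
  rw [Measure.prod_restrict, ae_restrict_iff' (measurableSet_Icc.prod measurableSet_Icc)]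
  exact Filter.Eventually.of_forall fun p hp => hC p.1 hp.1 p.2 hp.2 i j

lemma essBdd_ker_left [Fintype q] [Fintype r] {X : PQRS m q n r} (hX : X.Cont) {a b s : ℝ}
    (hs : s ∈ Icc a b) : EssBdd (volume.restrict (Icc a b)) (X.ker s) := fun i j => by
  obtain ⟨C, hC⟩ := exists_ker_bound hX a b
  refine memLp_top_of_bound ((measurable_ker hX i j).comp
    (measurable_prodMk_left (x := s))).aestronglyMeasurable C ?_
  rw [ae_restrict_iff' measurableSet_Icc]
  exact Filter.Eventually.of_forall fun θ hθ => hC s hs θ hθ i j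

lemma essBdd_ker_right [Fintype q] [Fintype r] {X : PQRS m q n r} (hX : X.Cont) {a b θ : ℝ}
    (hθ : θ ∈ Icc a b) : EssBdd (volume.restrict (Icc a b)) (fun s => X.ker s θ) := fun i j => by
  obtain ⟨C, hC⟩ := exists_ker_bound hX a b
  refine memLp_top_of_bound ((measurable_ker hX i j).comp
    (measurable_prodMk_right (y := θ))).aestronglyMeasurable C ?_
  rw [ae_restrict_iff' measurableSet_Icc]
  exact Filter.Eventually.of_forall fun s hs => hC s hs θ hθ i j

section CompKernel

variable [Fintype n] [Fintype r] {a b : ℝ} {X : PQRS n r k l} {Y : PQRS m q n r}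

lemma comp_Q₁ (hX : X.Cont) (hY : Y.Cont) {s : ℝ} (hs : s ∈ Icc a b) :
    (comp a b X Y).Q₁ s = X.P * Y.Q₁ s + X.Q₁ s * Y.S s
      + setMatInt (volume.restrict (Icc a b)) fun η => X.Q₁ η * Y.ker η s := by
  rw [setMatInt_Icc_eq_add hs.1 hs.2 (F₁ := fun η => X.Q₁ η * Y.R₂ η s)
    (F₂ := fun η => X.Q₁ η * Y.R₁ η s)
    (hX.Q₁.matrix_mul (hY.R₂_comp continuous_id continuous_const))
    (hX.Q₁.matrix_mul (hY.R₁_comp continuous_id continuous_const))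
    (fun η h => by rw [Y.ker_of_le h.le]) (fun η h => by rw [Y.ker_of_lt h])]
  simp only [comp]
  abel

lemma comp_Q₂ (hX : X.Cont) (hY : Y.Cont) {s : ℝ} (hs : s ∈ Icc a b) :
    (comp a b X Y).Q₂ s = X.Q₂ s * Y.P + X.S s * Y.Q₂ s
      + setMatInt (volume.restrict (Icc a b)) fun η => X.ker s η * Y.Q₂ η := by
  rw [setMatInt_Icc_eq_add hs.1 hs.2 (F₁ := fun η => X.R₁ s η * Y.Q₂ η)
    (F₂ := fun η => X.R₂ s η * Y.Q₂ η)
    ((hX.R₁_comp continuous_const continuous_id).matrix_mul hY.Q₂)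
    ((hX.R₂_comp continuous_const continuous_id).matrix_mul hY.Q₂)
    (fun η h => by rw [X.ker_of_lt h]) (fun η h => by rw [X.ker_of_le h.le])]
  simp only [comp]
  abel

/-- In terms of kernels, the six integrals in `R̂₁` and `R̂₂` are the single integral of
`X.ker s θ * Y.ker θ η` over `θ ∈ [a, b]`, split at the points `s` and `η`. -/
lemma comp_ker (hX : X.Cont) (hY : Y.Cont) {s η : ℝ} (hs : s ∈ Icc a b) (hη : η ∈ Icc a b) :
    (comp a b X Y).ker s η = X.Q₂ s * Y.Q₁ η + X.S s * Y.ker s η + X.ker s η * Y.S η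
      + setMatInt (volume.restrict (Icc a b)) fun θ => X.ker s θ * Y.ker θ η := by
  have x₁ : Continuous (X.R₁ s) := hX.R₁_comp continuous_const continuous_id
  have x₂ : Continuous (X.R₂ s) := hX.R₂_comp continuous_const continuous_id
  have y₁ : Continuous fun θ => Y.R₁ θ η := hY.R₁_comp continuous_id continuous_const
  have y₂ : Continuous fun θ => Y.R₂ θ η := hY.R₂_comp continuous_id continuous_const
  rcases lt_or_ge η s with h | h
  · rw [setMatInt_Icc_eq_add_add hη.1 h.le hs.2 (F₁ := fun θ => X.R₁ s θ * Y.R₂ θ η)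
      (F₂ := fun θ => X.R₁ s θ * Y.R₁ θ η) (F₃ := fun θ => X.R₂ s θ * Y.R₁ θ η)
      (x₁.matrix_mul y₂) (x₁.matrix_mul y₁) (x₂.matrix_mul y₁)
      (fun θ h' => by rw [X.ker_of_lt (h'.trans h), Y.ker_of_le h'.le])
      (fun θ h' h'' => by rw [X.ker_of_lt h'', Y.ker_of_lt h'])
      (fun θ h' => by rw [X.ker_of_le h'.le, Y.ker_of_lt (h.trans h')])]
    simp only [ker_of_lt _ h, comp]
    abel
  · rw [setMatInt_Icc_eq_add_add hs.1 h hη.2 (F₁ := fun θ => X.R₁ s θ * Y.R₂ θ η)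
      (F₂ := fun θ => X.R₂ s θ * Y.R₂ θ η) (F₃ := fun θ => X.R₂ s θ * Y.R₁ θ η)
      (x₁.matrix_mul y₂) (x₂.matrix_mul y₂) (x₂.matrix_mul y₁)
      (fun θ h' => by rw [X.ker_of_lt h', Y.ker_of_le (h'.le.trans h)])
      (fun θ h' h'' => by rw [X.ker_of_le h'.le, Y.ker_of_le h''.le])
      (fun θ h' => by rw [X.ker_of_le (h.trans h'.le), Y.ker_of_lt h'])]
    simp only [ker_of_le _ h, comp]
    abel

end CompKernel

end PQRS

/-! ### The operator of PQRS data -/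

section IntegralAdd

variable {α E : Type} [MeasurableSpace α] {μ : Measure α} [NormedAddCommGroup E]
  [NormedSpace ℝ E] {f g h k : α → E}

lemma integral_add₃ (hf : Integrable f μ) (hg : Integrable g μ) (hh : Integrable h μ) :
    ∫ s, f s + g s + h s ∂μ = (∫ s, f s ∂μ) + (∫ s, g s ∂μ) + ∫ s, h s ∂μ := by
  rw [← integral_add hf hg]
  exact integral_add (hf.add hg) hh

lemma integral_add₄ (hf : Integrable f μ) (hg : Integrable g μ) (hh : Integrable h μ)
    (hk : Integrable k μ) : ∫ s, f s + g s + h s + k s ∂μ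
      = (∫ s, f s ∂μ) + (∫ s, g s ∂μ) + (∫ s, h s ∂μ) + ∫ s, k s ∂μ := by
  rw [← integral_add₃ hf hg hh]
  exact integral_add ((hf.add hg).add hh) hk

end IntegralAdd

namespace PQRS

variable {m q n r k l : Type} [Fintype m] [Fintype q] [Fintype n] [Fintype r]
  [Fintype k] [Fintype l]

/-- The finite-dimensional component of the operator given by `X`, applied to `(x, z)`. -/
noncomputable def opV (a b : ℝ) (X : PQRS m q n r) (x : m → ℝ) (z : ℝ → q → ℝ) : n → ℝ :=
  X.P *ᵥ x + ∫ s in Icc a b, X.Q₁ s *ᵥ z s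

/-- The distributed component of the operator given by `X`, applied to `(x, z)`. -/
noncomputable def opF (a b : ℝ) (X : PQRS m q n r) (x : m → ℝ) (z : ℝ → q → ℝ) (s : ℝ) : r → ℝ :=
  X.Q₂ s *ᵥ x + X.S s *ᵥ z s + ∫ θ in Icc a b, X.ker s θ *ᵥ z θ

/-- The inner product of `ℝ^m × L₂^q[a,b]`. -/
noncomputable def pairing (a b : ℝ) (u : m → ℝ) (f : ℝ → q → ℝ) (x : m → ℝ) (z : ℝ → q → ℝ) : ℝ :=
  u ⬝ᵥ x + ∫ s in Icc a b, f s ⬝ᵥ z s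

/-- The bilinear form `⟨(u, f), X (x, z)⟩`. -/
noncomputable def form (a b : ℝ) (X : PQRS m q n r) (u : n → ℝ) (f : ℝ → r → ℝ) (x : m → ℝ)
    (z : ℝ → q → ℝ) : ℝ :=
  pairing a b u f (X.opV a b x z) (X.opF a b x z)

variable {a b : ℝ}

lemma integral_ker_mulVec_memLp {X : PQRS m q n r} (hX : X.Cont) {z : ℝ → q → ℝ}
    (hz : Integrable z (volume.restrict (Icc a b))) (p : ℝ≥0∞) :
    MemLp (fun s => ∫ θ in Icc a b, X.ker s θ *ᵥ z θ) p (volume.restrict (Icc a b)) := by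
  obtain ⟨C, hC⟩ := exists_ker_bound hX a b
  have hint : Integrable (fun p : ℝ × ℝ => X.ker p.1 p.2 *ᵥ z p.2)
      ((volume.restrict (Icc a b)).prod (volume.restrict (Icc a b))) :=
    (essBdd_ker_prod hX a b).integrable_mulVec (hz.comp_snd _)
  refine MemLp.of_bound hint.aestronglyMeasurable.integral_prod_right'
    (∫ θ in Icc a b, |C| * Fintype.card q * ‖z θ‖) ?_
  rw [ae_restrict_iff' measurableSet_Icc]
  refine Filter.Eventually.of_forall fun s hs => ?_
  refine norm_integral_le_of_norm_le (hz.norm.const_mul _) ?_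
  rw [ae_restrict_iff' measurableSet_Icc]
  refine Filter.Eventually.of_forall fun θ hθ => ?_
  refine (pi_norm_le_iff_of_nonneg (by positivity)).2 fun i => ?_
  calc ‖(X.ker s θ *ᵥ z θ) i‖ ≤ ∑ j, ‖X.ker s θ i j * z θ j‖ := norm_sum_le _ _
    _ ≤ ∑ _j : q, |C| * ‖z θ‖ := by
        refine Finset.sum_le_sum fun j _ => ?_
        rw [norm_mul]
        exact mul_le_mul ((hC s hs θ hθ i j).trans (le_abs_self C)) (norm_le_pi_norm _ j)
          (norm_nonneg _) (abs_nonneg _)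
    _ = |C| * Fintype.card q * ‖z θ‖ := by
        rw [Finset.sum_const, Finset.card_univ, nsmul_eq_mul]; ring

lemma opF_memLp {X : PQRS m q n r} (hX : X.Cont) (x : m → ℝ) {z : ℝ → q → ℝ}
    (hz : MemLp z 2 (volume.restrict (Icc a b))) :
    MemLp (X.opF a b x z) 2 (volume.restrict (Icc a b)) :=
  (((essBdd_of_continuous hX.Q₂ a b).memLp_mulVec_const 2 x).add
    ((essBdd_of_continuous hX.S a b).mulVec hz)).add
    (integral_ker_mulVec_memLp hX (hz.integrable one_le_two) 2)

/-! ### Sums, negatives and multiples -/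

section Linear

variable {X Y : PQRS m q n r} {x : m → ℝ} {z : ℝ → q → ℝ}

lemma ker_add (X Y : PQRS m q n r) (s θ : ℝ) : (X + Y).ker s θ = X.ker s θ + Y.ker s θ := by
  by_cases h : θ < s
  · simp only [ker_of_lt _ h]; rfl
  · simp only [ker_of_le _ (not_lt.1 h)]; rfl

lemma ker_smul (c : ℝ) (X : PQRS m q n r) (s θ : ℝ) : (c • X).ker s θ = c • X.ker s θ := by
  by_cases h : θ < s
  · simp only [ker_of_lt _ h]; rfl
  · simp only [ker_of_le _ (not_lt.1 h)]; rfl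

lemma opV_add (hX : X.Cont) (hY : Y.Cont) (hz : Integrable z (volume.restrict (Icc a b))) :
    (X + Y).opV a b x z = X.opV a b x z + Y.opV a b x z := by
  have h : ∀ s, (X + Y).Q₁ s *ᵥ z s = X.Q₁ s *ᵥ z s + Y.Q₁ s *ᵥ z s := fun s =>
    Matrix.add_mulVec _ _ _
  have hP : (X + Y).P *ᵥ x = X.P *ᵥ x + Y.P *ᵥ x := Matrix.add_mulVec _ _ _
  simp only [opV, h, hP]
  rw [integral_add ((essBdd_of_continuous hX.Q₁ a b).integrable_mulVec hz)
    ((essBdd_of_continuous hY.Q₁ a b).integrable_mulVec hz)]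
  abel

lemma opF_add (hX : X.Cont) (hY : Y.Cont) (hz : Integrable z (volume.restrict (Icc a b))) {s : ℝ}
    (hs : s ∈ Icc a b) : (X + Y).opF a b x z s = X.opF a b x z s + Y.opF a b x z s := by
  have h₂ : (X + Y).Q₂ s *ᵥ x = X.Q₂ s *ᵥ x + Y.Q₂ s *ᵥ x := Matrix.add_mulVec _ _ _
  have hS : (X + Y).S s *ᵥ z s = X.S s *ᵥ z s + Y.S s *ᵥ z s := Matrix.add_mulVec _ _ _
  simp only [opF, h₂, hS, ker_add, Matrix.add_mulVec]
  rw [integral_add ((essBdd_ker_left hX hs).integrable_mulVec hz)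
    ((essBdd_ker_left hY hs).integrable_mulVec hz)]
  abel

lemma opV_smul (c : ℝ) : (c • X).opV a b x z = c • X.opV a b x z := by
  have h : ∀ s, (c • X).Q₁ s *ᵥ z s = c • (X.Q₁ s *ᵥ z s) := fun s => Matrix.smul_mulVec c _ _
  have hP : (c • X).P *ᵥ x = c • (X.P *ᵥ x) := Matrix.smul_mulVec c _ _
  simp only [opV, h, hP, integral_smul, smul_add]

lemma opF_smul (c : ℝ) (s : ℝ) : (c • X).opF a b x z s = c • X.opF a b x z s := by
  have h₂ : (c • X).Q₂ s *ᵥ x = c • (X.Q₂ s *ᵥ x) := Matrix.smul_mulVec c _ _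
  have hS : (c • X).S s *ᵥ z s = c • (X.S s *ᵥ z s) := Matrix.smul_mulVec c _ _
  simp only [opF, h₂, hS, ker_smul, Matrix.smul_mulVec, integral_smul, smul_add]

lemma neg_eq_smul (X : PQRS m q n r) : -X = (-1 : ℝ) • X := by
  change PQRS.mk _ _ _ _ _ _ = PQRS.mk _ _ _ _ _ _
  simp

lemma sub_eq_add_neg (X Y : PQRS m q n r) : X - Y = X + -Y := by
  change PQRS.mk _ _ _ _ _ _ = PQRS.mk _ _ _ _ _ _
  congr 1

variable {u : n → ℝ} {f : ℝ → r → ℝ}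

lemma pairing_add_right {u x y : m → ℝ} {f z v : ℝ → q → ℝ}
    (hf : MemLp f 2 (volume.restrict (Icc a b))) (hz : MemLp z 2 (volume.restrict (Icc a b)))
    (hv : MemLp v 2 (volume.restrict (Icc a b))) :
    pairing a b u f (x + y) (fun s => z s + v s) = pairing a b u f x z + pairing a b u f y v := by
  simp only [pairing, dotProduct_add]
  rw [integral_add (hf.integrable_dotProduct hz) (hf.integrable_dotProduct hv)]
  ring

lemma pairing_congr_right {u x : m → ℝ} {f z v : ℝ → q → ℝ}
    (h : ∀ᵐ s ∂volume.restrict (Icc a b), z s = v s) :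
    pairing a b u f x z = pairing a b u f x v := by
  simp only [pairing]
  rw [integral_congr_ae (g := fun s => f s ⬝ᵥ v s) (h.mono fun s hs => by simp only [hs])]

lemma pairing_comm (u x : m → ℝ) (f z : ℝ → q → ℝ) :
    pairing a b u f x z = pairing a b x z u f := by
  simp only [pairing, dotProduct_comm u, dotProduct_comm (f _)]

lemma form_add (hX : X.Cont) (hY : Y.Cont) (hf : MemLp f 2 (volume.restrict (Icc a b)))
    (hz : MemLp z 2 (volume.restrict (Icc a b))) :
    (X + Y).form a b u f x z = X.form a b u f x z + Y.form a b u f x z := by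
  have hz1 := hz.integrable one_le_two
  rw [form, opV_add hX hY hz1, pairing_congr_right (v := fun s => X.opF a b x z s
    + Y.opF a b x z s), pairing_add_right hf (opF_memLp hX x hz) (opF_memLp hY x hz)]
  · rfl
  · rw [ae_restrict_iff' measurableSet_Icc]
    exact Filter.Eventually.of_forall fun s hs => opF_add hX hY hz1 hs

lemma form_smul (c : ℝ) : (c • X).form a b u f x z = c * X.form a b u f x z := by
  simp only [form, pairing, opV_smul, opF_smul, dotProduct_smul, smul_eq_mul, integral_const_mul,
    mul_add]

lemma form_congr_data (h : X.AgreeOn a b Y) :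
    X.form a b u f x z = Y.form a b u f x z := by
  obtain ⟨hP, h1, h2⟩ := h
  have hker : ∀ s ∈ Icc a b, ∀ θ ∈ Icc a b, X.ker s θ = Y.ker s θ := fun s hs θ hθ => by
    simp only [ker, (h2 s hs θ hθ).1, (h2 s hs θ hθ).2]
  have hV : X.opV a b x z = Y.opV a b x z := by
    simp only [opV, hP]
    rw [setIntegral_congr_fun (g := fun s => Y.Q₁ s *ᵥ z s) measurableSet_Icc
      fun s hs => by simp only [(h1 s hs).1]]
  have hF : ∀ s ∈ Icc a b, X.opF a b x z s = Y.opF a b x z s := fun s hs => by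
    simp only [opF, (h1 s hs).2.1, (h1 s hs).2.2]
    rw [setIntegral_congr_fun (g := fun θ => Y.ker s θ *ᵥ z θ) measurableSet_Icc
      fun θ hθ => by simp only [hker s hs θ hθ]]
  rw [form, hV, form, pairing_congr_right]
  rw [ae_restrict_iff' measurableSet_Icc]
  exact Filter.Eventually.of_forall hF

end Linear

/-! ### Composition and adjoint -/

/-- The finite-dimensional component of the composition of operators. -/
lemma opV_comp {X : PQRS n r k l} {Y : PQRS m q n r} (hX : X.Cont) (hY : Y.Cont) (hab : a ≤ b)
    (x : m → ℝ) {z : ℝ → q → ℝ} (hz : MemLp z 2 (volume.restrict (Icc a b))) :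
    (comp a b X Y).opV a b x z = X.opV a b (Y.opV a b x z) (Y.opF a b x z) := by
  have hz1 := hz.integrable one_le_two
  have bX := essBdd_of_continuous hX.Q₁ a b
  have iX : ∀ {v : ℝ → r → ℝ}, MemLp v 2 (volume.restrict (Icc a b)) →
      Integrable (fun s => X.Q₁ s *ᵥ v s) (volume.restrict (Icc a b)) :=
    fun hv => bX.integrable_mulVec (hv.integrable one_le_two)
  have m₁ := (essBdd_of_continuous hY.Q₂ a b).memLp_mulVec_const 2 x
  have m₂ := (essBdd_of_continuous hY.S a b).mulVec hz
  have m₃ := integral_ker_mulVec_memLp hY hz1 2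
  have hl : ∀ᵐ θ ∂volume.restrict (Icc a b), EssBdd (volume.restrict (Icc a b)) (Y.ker θ) := by
    rw [ae_restrict_iff' measurableSet_Icc]
    exact Filter.Eventually.of_forall fun θ hθ => essBdd_ker_left hY hθ
  have hr : ∀ᵐ η ∂volume.restrict (Icc a b),
      EssBdd (volume.restrict (Icc a b)) (fun θ => Y.ker θ η) := by
    rw [ae_restrict_iff' measurableSet_Icc]
    exact Filter.Eventually.of_forall fun θ hθ => essBdd_ker_right hY hθ
  have hfub := integral_mulVec_integral_mulVec bX (essBdd_ker_prod hY a b) hl hr hz1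
  have i₀ := (essBdd_of_continuous hY.Q₁ a b).integrable_mulVec hz1
  have i₁ : Integrable (fun s => X.P *ᵥ (Y.Q₁ s *ᵥ z s)) (volume.restrict (Icc a b)) :=
    (Matrix.mulVecLin X.P).toContinuousLinearMap.integrable_comp i₀
  have i₂ : Integrable (fun s => X.Q₁ s *ᵥ (Y.S s *ᵥ z s)) (volume.restrict (Icc a b)) := iX m₂
  have hcomp : Integrable (fun s => (comp a b X Y).Q₁ s *ᵥ z s) (volume.restrict (Icc a b)) :=
    (essBdd_of_continuous (hX.comp a b hY).Q₁ a b).integrable_mulVec hz1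
  have e : ∀ s ∈ Icc a b, (comp a b X Y).Q₁ s *ᵥ z s = X.P *ᵥ (Y.Q₁ s *ᵥ z s)
      + X.Q₁ s *ᵥ (Y.S s *ᵥ z s)
      + setMatInt (volume.restrict (Icc a b)) (fun η => X.Q₁ η * Y.ker η s) *ᵥ z s :=
    fun s hs => by rw [comp_Q₁ hX hY hs]; simp only [Matrix.add_mulVec, Matrix.mulVec_mulVec]
  -- the remaining term is integrable, being a difference of integrable terms
  have i₃ : Integrable (fun s => setMatInt (volume.restrict (Icc a b))
      (fun η => X.Q₁ η * Y.ker η s) *ᵥ z s) (volume.restrict (Icc a b)) := by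
    refine ((hcomp.sub i₁).sub i₂).congr ?_
    rw [Filter.EventuallyEq, ae_restrict_iff' measurableSet_Icc]
    refine Filter.Eventually.of_forall fun s hs => ?_
    simp only [Pi.sub_apply, e s hs]
    abel
  have hP : (comp a b X Y).P = X.P * Y.P
      + setMatInt (volume.restrict (Icc a b)) (fun s => X.Q₁ s * Y.Q₂ s) := by
    rw [setMatInt_Icc hab]; rfl
  have hL : (comp a b X Y).opV a b x z = X.P *ᵥ (Y.P *ᵥ x)
      + (∫ s in Icc a b, X.Q₁ s *ᵥ (Y.Q₂ s *ᵥ x))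
      + ((∫ s in Icc a b, X.P *ᵥ (Y.Q₁ s *ᵥ z s)) + (∫ s in Icc a b, X.Q₁ s *ᵥ (Y.S s *ᵥ z s))
        + ∫ s in Icc a b, setMatInt (volume.restrict (Icc a b))
          (fun η => X.Q₁ η * Y.ker η s) *ᵥ z s) := by
    rw [opV, hP, setIntegral_congr_fun measurableSet_Icc e, integral_add₃ i₁ i₂ i₃,
      Matrix.add_mulVec, setMatInt_mulVec
      fun i j => ((bX.mul (essBdd_of_continuous hY.Q₂ a b)) i j).integrable le_top]
    simp only [Matrix.mulVec_mulVec]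
  have hR : X.opV a b (Y.opV a b x z) (Y.opF a b x z) = X.P *ᵥ (Y.P *ᵥ x)
      + (∫ s in Icc a b, X.P *ᵥ (Y.Q₁ s *ᵥ z s)) + ((∫ s in Icc a b, X.Q₁ s *ᵥ (Y.Q₂ s *ᵥ x))
        + (∫ s in Icc a b, X.Q₁ s *ᵥ (Y.S s *ᵥ z s))
        + ∫ s in Icc a b, X.Q₁ s *ᵥ (∫ θ in Icc a b, Y.ker s θ *ᵥ z θ)) := by
    simp only [opV, opF, Matrix.mulVec_add]
    rw [integral_add₃ (iX m₁) (iX m₂) (iX m₃),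
      mulVec_integral X.P i₀]
  rw [hL, hR, hfub]
  abel

/-- The distributed component of the composition of operators. -/
lemma opF_comp {X : PQRS n r k l} {Y : PQRS m q n r} (hX : X.Cont) (hY : Y.Cont)
    (x : m → ℝ) {z : ℝ → q → ℝ} (hz : MemLp z 2 (volume.restrict (Icc a b))) {s : ℝ}
    (hs : s ∈ Icc a b) :
    (comp a b X Y).opF a b x z s = X.opF a b (Y.opV a b x z) (Y.opF a b x z) s := by
  have hz1 := hz.integrable one_le_two
  have bX := essBdd_ker_left hX hs
  have iX : ∀ {v : ℝ → r → ℝ}, MemLp v 2 (volume.restrict (Icc a b)) →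
      Integrable (fun θ => X.ker s θ *ᵥ v θ) (volume.restrict (Icc a b)) :=
    fun hv => bX.integrable_mulVec (hv.integrable one_le_two)
  have m₁ := (essBdd_of_continuous hY.Q₂ a b).memLp_mulVec_const 2 x
  have m₂ := (essBdd_of_continuous hY.S a b).mulVec hz
  have m₃ := integral_ker_mulVec_memLp hY hz1 2
  have hl : ∀ᵐ θ ∂volume.restrict (Icc a b), EssBdd (volume.restrict (Icc a b)) (Y.ker θ) := by
    rw [ae_restrict_iff' measurableSet_Icc]
    exact Filter.Eventually.of_forall fun θ hθ => essBdd_ker_left hY hθ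
  have hr : ∀ᵐ η ∂volume.restrict (Icc a b),
      EssBdd (volume.restrict (Icc a b)) (fun θ => Y.ker θ η) := by
    rw [ae_restrict_iff' measurableSet_Icc]
    exact Filter.Eventually.of_forall fun θ hθ => essBdd_ker_right hY hθ
  have hfub := integral_mulVec_integral_mulVec bX (essBdd_ker_prod hY a b) hl hr hz1
  have i₀ := (essBdd_of_continuous hY.Q₁ a b).integrable_mulVec hz1
  have k₀ := (essBdd_ker_left hY hs).integrable_mulVec hz1
  have i₁ : Integrable (fun θ => X.Q₂ s *ᵥ (Y.Q₁ θ *ᵥ z θ)) (volume.restrict (Icc a b)) :=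
    (Matrix.mulVecLin (X.Q₂ s)).toContinuousLinearMap.integrable_comp i₀
  have i₂ : Integrable (fun θ => X.S s *ᵥ (Y.ker s θ *ᵥ z θ)) (volume.restrict (Icc a b)) :=
    (Matrix.mulVecLin (X.S s)).toContinuousLinearMap.integrable_comp k₀
  have i₃ : Integrable (fun θ => X.ker s θ *ᵥ (Y.S θ *ᵥ z θ)) (volume.restrict (Icc a b)) := iX m₂
  have hcomp : Integrable (fun θ => (comp a b X Y).ker s θ *ᵥ z θ) (volume.restrict (Icc a b)) :=
    (essBdd_ker_left (hX.comp a b hY) hs).integrable_mulVec hz1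
  have e : ∀ η ∈ Icc a b, (comp a b X Y).ker s η *ᵥ z η = X.Q₂ s *ᵥ (Y.Q₁ η *ᵥ z η)
      + X.S s *ᵥ (Y.ker s η *ᵥ z η) + X.ker s η *ᵥ (Y.S η *ᵥ z η)
      + setMatInt (volume.restrict (Icc a b)) (fun θ => X.ker s θ * Y.ker θ η) *ᵥ z η :=
    fun η hη => by
      rw [comp_ker hX hY hs hη]; simp only [Matrix.add_mulVec, Matrix.mulVec_mulVec]
  -- the remaining term is integrable, being a difference of integrable terms
  have i₄ : Integrable (fun η => setMatInt (volume.restrict (Icc a b))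
      (fun θ => X.ker s θ * Y.ker θ η) *ᵥ z η) (volume.restrict (Icc a b)) := by
    refine (((hcomp.sub i₁).sub i₂).sub i₃).congr ?_
    rw [Filter.EventuallyEq, ae_restrict_iff' measurableSet_Icc]
    refine Filter.Eventually.of_forall fun η hη => ?_
    simp only [Pi.sub_apply, e η hη]
    abel
  have hL : (comp a b X Y).opF a b x z s = X.Q₂ s *ᵥ (Y.P *ᵥ x) + X.S s *ᵥ (Y.Q₂ s *ᵥ x)
      + (∫ θ in Icc a b, X.ker s θ *ᵥ (Y.Q₂ θ *ᵥ x)) + X.S s *ᵥ (Y.S s *ᵥ z s)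
      + ((∫ θ in Icc a b, X.Q₂ s *ᵥ (Y.Q₁ θ *ᵥ z θ))
        + (∫ θ in Icc a b, X.S s *ᵥ (Y.ker s θ *ᵥ z θ))
        + (∫ θ in Icc a b, X.ker s θ *ᵥ (Y.S θ *ᵥ z θ))
        + ∫ η in Icc a b, setMatInt (volume.restrict (Icc a b))
          (fun θ => X.ker s θ * Y.ker θ η) *ᵥ z η) := by
    rw [opF, comp_Q₂ hX hY hs, setIntegral_congr_fun measurableSet_Icc e,
      integral_add₄ i₁ i₂ i₃ i₄, Matrix.add_mulVec, setMatInt_mulVec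
      fun i j => ((bX.mul (essBdd_of_continuous hY.Q₂ a b)) i j).integrable le_top]
    simp only [Matrix.mulVec_mulVec, Matrix.add_mulVec, comp]
  have hR : X.opF a b (Y.opV a b x z) (Y.opF a b x z) s = X.Q₂ s *ᵥ (Y.P *ᵥ x)
      + (∫ θ in Icc a b, X.Q₂ s *ᵥ (Y.Q₁ θ *ᵥ z θ))
      + (X.S s *ᵥ (Y.Q₂ s *ᵥ x) + X.S s *ᵥ (Y.S s *ᵥ z s)
        + ∫ θ in Icc a b, X.S s *ᵥ (Y.ker s θ *ᵥ z θ))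
      + ((∫ θ in Icc a b, X.ker s θ *ᵥ (Y.Q₂ θ *ᵥ x))
        + (∫ θ in Icc a b, X.ker s θ *ᵥ (Y.S θ *ᵥ z θ))
        + ∫ θ in Icc a b, X.ker s θ *ᵥ (∫ η in Icc a b, Y.ker θ η *ᵥ z η)) := by
    simp only [opV, opF, Matrix.mulVec_add]
    rw [integral_add₃ (iX m₁) (iX m₂) (iX m₃),
      mulVec_integral (X.Q₂ s) i₀, mulVec_integral (X.S s) k₀]
  rw [hL, hR, hfub]
  abel

lemma form_comp {X : PQRS n r k l} {Y : PQRS m q n r} (hX : X.Cont) (hY : Y.Cont) (hab : a ≤ b)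
    (u : k → ℝ) (f : ℝ → l → ℝ) (x : m → ℝ) {z : ℝ → q → ℝ}
    (hz : MemLp z 2 (volume.restrict (Icc a b))) :
    (comp a b X Y).form a b u f x z = X.form a b u f (Y.opV a b x z) (Y.opF a b x z) := by
  rw [form, opV_comp hX hY hab x hz, form, pairing_congr_right]
  rw [ae_restrict_iff' measurableSet_Icc]
  exact Filter.Eventually.of_forall fun s hs => opF_comp hX hY x hz hs

/-- `⟨X* (u, f), (x, z)⟩ = ⟨(u, f), X (x, z)⟩`. -/
lemma form_adj {X : PQRS m q n r} (hX : X.Cont) {u : n → ℝ} {f : ℝ → r → ℝ} {x : m → ℝ}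
    {z : ℝ → q → ℝ} (hf : MemLp f 2 (volume.restrict (Icc a b)))
    (hz : MemLp z 2 (volume.restrict (Icc a b))) :
    X.adj.form a b x z u f = X.form a b u f x z := by
  have hz1 := hz.integrable one_le_two
  have hf1 := hf.integrable one_le_two
  have hl : ∀ᵐ θ ∂(volume.restrict (Icc a b)), EssBdd (volume.restrict (Icc a b)) (X.ker θ) := by
    rw [ae_restrict_iff' measurableSet_Icc]
    exact Filter.Eventually.of_forall fun θ hθ => essBdd_ker_left hX hθ
  have hr : ∀ᵐ η ∂(volume.restrict (Icc a b)),
      EssBdd (volume.restrict (Icc a b)) (fun θ => X.ker θ η) := by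
    rw [ae_restrict_iff' measurableSet_Icc]
    exact Filter.Eventually.of_forall fun θ hθ => essBdd_ker_right hX hθ
  have hfub := integral_dotProduct_integral_mulVec (essBdd_ker_prod hX a b) hl hr hf1 hz1
  -- the two kernels may differ on the diagonal, which is a null set
  have hker : ∀ s, (∫ θ in Icc a b, X.adj.ker s θ *ᵥ f θ)
      = ∫ θ in Icc a b, (X.ker θ s)ᵀ *ᵥ f θ := fun s => by
    refine integral_congr_ae ?_
    have h0 : ∀ᵐ θ ∂(volume : Measure ℝ), θ ≠ s := by simp [ae_iff]
    filter_upwards [ae_restrict_of_ae h0] with θ hθ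
    rcases lt_or_gt_of_ne hθ with h | h
    · rw [ker_of_lt _ h, ker_of_le _ h.le]; rfl
    · rw [ker_of_le _ h.le, ker_of_lt _ h]; rfl
  have t : ∀ {α β : Type} [Fintype α] [Fintype β] (M : Matrix α β ℝ) (v : α → ℝ) (w : β → ℝ),
      w ⬝ᵥ Mᵀ *ᵥ v = v ⬝ᵥ M *ᵥ w := fun M v w => by
    rw [Matrix.mulVec_transpose, dotProduct_comm, ← Matrix.dotProduct_mulVec]
  have hL : X.adj.form a b x z u f = u ⬝ᵥ X.P *ᵥ x + (∫ s in Icc a b, f s ⬝ᵥ X.Q₂ s *ᵥ x)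
      + ((∫ s in Icc a b, u ⬝ᵥ X.Q₁ s *ᵥ z s) + (∫ s in Icc a b, f s ⬝ᵥ X.S s *ᵥ z s)
        + ∫ s in Icc a b, (∫ θ in Icc a b, (X.ker θ s)ᵀ *ᵥ f θ) ⬝ᵥ z s) := by
    simp only [form, pairing, opV, opF, dotProduct_add, hker]
    rw [dotProduct_integral x ((essBdd_of_continuous hX.adj.Q₁ a b).integrable_mulVec hf1)]
    have j₁ := hz.integrable_dotProduct
      ((essBdd_of_continuous hX.adj.Q₂ a b).memLp_mulVec_const 2 u)
    have j₂ := hz.integrable_dotProduct ((essBdd_of_continuous hX.adj.S a b).mulVec hf)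
    have j₃ := hz.integrable_dotProduct (integral_ker_mulVec_memLp hX.adj hf1 2)
    simp only [hker] at j₃
    rw [integral_add₃ j₁ j₂ j₃]
    simp only [adj, t, dotProduct_comm (z _) (∫ θ in Icc a b, (X.ker θ _)ᵀ *ᵥ f θ)]
  have hR : X.form a b u f x z = u ⬝ᵥ X.P *ᵥ x + (∫ s in Icc a b, u ⬝ᵥ X.Q₁ s *ᵥ z s)
      + ((∫ s in Icc a b, f s ⬝ᵥ X.Q₂ s *ᵥ x) + (∫ s in Icc a b, f s ⬝ᵥ X.S s *ᵥ z s)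
        + ∫ s in Icc a b, f s ⬝ᵥ ∫ θ in Icc a b, X.ker s θ *ᵥ z θ) := by
    simp only [form, pairing, opV, opF, dotProduct_add]
    rw [dotProduct_integral u ((essBdd_of_continuous hX.Q₁ a b).integrable_mulVec hz1)]
    have j₁ := hf.integrable_dotProduct
      ((essBdd_of_continuous hX.Q₂ a b).memLp_mulVec_const 2 x)
    have j₂ := hf.integrable_dotProduct ((essBdd_of_continuous hX.S a b).mulVec hz)
    have j₃ := hf.integrable_dotProduct (integral_ker_mulVec_memLp hX hz1 2)
    rw [integral_add₃ j₁ j₂ j₃]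
  rw [hL, hR, hfub]
  ring

end PQRS

/-! ### Positivity of the cones `Φ_d` -/

section Gram

variable {m n k₁ k₂ : Type} [Fintype m] [Fintype n] [Fintype k₁] [Fintype k₂]
  [DecidableEq m] [DecidableEq k₁] [DecidableEq k₂]

/-- The matrix of the coordinate embedding `ℝ^β → ℝ^α` along `ι : β → α`. -/
def embMat {α β : Type} [DecidableEq α] (ι : β → α) : Matrix α β ℝ :=
  (1 : Matrix α α ℝ).submatrix id ι

lemma embMat_transpose_mul_mul {α β δ : Type} [Fintype α] [DecidableEq α]
    (T : Matrix α α ℝ) (ι : β → α) (κ : δ → α) :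
    (embMat ι)ᵀ * T * embMat κ = T.submatrix ι κ := by
  ext i j
  simp [embMat, Matrix.mul_apply, Matrix.one_apply]

lemma embMat_mul_transpose_mul {α β δ μ ν : Type} [Fintype α] [DecidableEq α] [Fintype β]
    [Fintype δ] (c : ℝ) (T : Matrix α α ℝ) (ι : β → α) (κ : δ → α) (A : Matrix β μ ℝ)
    (B : Matrix δ ν ℝ) : (embMat ι * A)ᵀ * ((c • T) * (embMat κ * B))
      = c • (Aᵀ * T.submatrix ι κ * B) := by
  rw [← embMat_transpose_mul_mul]
  simp only [Matrix.transpose_mul, Matrix.smul_mul, Matrix.mul_smul, Matrix.mul_assoc]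

/-- The data of the operator
`(x, z) ↦ v(s) = (x, Z₁(s) z(s), ∫ₐˢ Z₂(s,θ) z(θ) dθ, ∫ₛᵇ Z₂(s,θ) z(θ) dθ)`. The factor `1` in
`Q₂` gives all entries the same shape `embMat _ * _`. -/
def gramFactor (m : Type) [Fintype m] [DecidableEq m] (Z₁ : ℝ → Matrix k₁ n ℝ)
    (Z₂ : ℝ → ℝ → Matrix k₂ n ℝ) :
    PQRS m n (Fin 0) (m ⊕ k₁ ⊕ k₂ ⊕ k₂) where
  P := 0
  Q₁ := 0
  Q₂ _ := (embMat Sum.inl : Matrix (m ⊕ k₁ ⊕ k₂ ⊕ k₂) m ℝ) * (1 : Matrix m m ℝ)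
  S s := embMat (fun i => Sum.inr (Sum.inl i)) * Z₁ s
  R₁ s θ := embMat (fun i => Sum.inr (Sum.inr (Sum.inl i))) * Z₂ s θ
  R₂ s θ := embMat (fun i => Sum.inr (Sum.inr (Sum.inr i))) * Z₂ s θ

/-- The data of the multiplication operator by a matrix-valued function. -/
def mulData {κ : Type} (M : ℝ → Matrix κ κ ℝ) : PQRS (Fin 0) κ (Fin 0) κ := ⟨0, 0, 0, M, 0, 0⟩

lemma gramFactor_cont {Z₁ : ℝ → Matrix k₁ n ℝ} {Z₂ : ℝ → ℝ → Matrix k₂ n ℝ}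
    (h₁ : Continuous Z₁) (h₂ : Continuous fun p : ℝ × ℝ => Z₂ p.1 p.2) :
    (gramFactor m Z₁ Z₂).Cont :=
  ⟨continuous_const, continuous_const, continuous_const.matrix_mul h₁,
    continuous_const.matrix_mul h₂, continuous_const.matrix_mul h₂⟩

lemma mulData_cont {κ : Type} {M : ℝ → Matrix κ κ ℝ} (hM : Continuous M) : (mulData M).Cont :=
  ⟨continuous_const, continuous_const, hM, continuous_const, continuous_const⟩

lemma matInt_zero {r q : Type} (a b : ℝ) : matInt a b (fun _ => (0 : Matrix r q ℝ)) = 0 := by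
  ext i j; simp [matInt]

lemma matInt_transpose {r q : Type} (a b : ℝ) (F : ℝ → Matrix r q ℝ) :
    (matInt a b F)ᵀ = matInt a b fun s => (F s)ᵀ := rfl

lemma matInt_smul_const {r q : Type} (a b : ℝ) (g : ℝ → ℝ) (M : Matrix r q ℝ) :
    matInt a b (fun s => g s • M) = (∫ s in a..b, g s) • M := by
  ext i j
  simp [matInt]

/-- The Gram data factor as `L* (g T) L`, with `L` as in `gramFactor`. -/
lemma gramData_eq_comp (a b : ℝ) (g : ℝ → ℝ) (Z₁ : ℝ → Matrix k₁ n ℝ)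
    (Z₂ : ℝ → ℝ → Matrix k₂ n ℝ)
    {T : Matrix (m ⊕ k₁ ⊕ k₂ ⊕ k₂) (m ⊕ k₁ ⊕ k₂ ⊕ k₂) ℝ} (hT : T.IsSymm) :
    gramData a b g Z₁ Z₂ T = PQRS.comp a b (gramFactor m Z₁ Z₂).adj
      (PQRS.comp a b (mulData fun s => g s • T) (gramFactor m Z₁ Z₂)) := by
  have hsub : ∀ {β δ : Type} (ι : β → m ⊕ k₁ ⊕ k₂ ⊕ k₂) (κ : δ → m ⊕ k₁ ⊕ k₂ ⊕ k₂),
      (T.submatrix ι κ)ᵀ = T.submatrix κ ι := fun ι κ => by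
    rw [Matrix.transpose_submatrix, hT.eq]
  have hML : PQRS.comp a b (mulData fun s => g s • T) (gramFactor m Z₁ Z₂)
      = ⟨0, 0, fun s => (g s • T) * (gramFactor m Z₁ Z₂).Q₂ s,
        fun s => (g s • T) * (gramFactor m Z₁ Z₂).S s,
        fun s θ => (g s • T) * (gramFactor m Z₁ Z₂).R₁ s θ,
        fun s θ => (g s • T) * (gramFactor m Z₁ Z₂).R₂ s θ⟩ := by
    simp only [PQRS.comp, mulData, Pi.zero_apply, Matrix.zero_mul, matInt_zero, add_zero, zero_add]
    congr 1
  rw [hML]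
  have hQ : ∀ s, (gramFactor m Z₁ Z₂).Q₂ s
      = embMat (Sum.inl : m → m ⊕ k₁ ⊕ k₂ ⊕ k₂) * (1 : Matrix m m ℝ) := fun _ => rfl
  have hS : ∀ s, (gramFactor m Z₁ Z₂).S s
      = embMat (fun i => Sum.inr (Sum.inl i) : k₁ → m ⊕ k₁ ⊕ k₂ ⊕ k₂) * Z₁ s := fun _ => rfl
  have hR₁ : ∀ s θ, (gramFactor m Z₁ Z₂).R₁ s θ
      = embMat (fun i => Sum.inr (Sum.inr (Sum.inl i)) : k₂ → m ⊕ k₁ ⊕ k₂ ⊕ k₂) * Z₂ s θ :=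
    fun _ _ => rfl
  have hR₂ : ∀ s θ, (gramFactor m Z₁ Z₂).R₂ s θ
      = embMat (fun i => Sum.inr (Sum.inr (Sum.inr i)) : k₂ → m ⊕ k₁ ⊕ k₂ ⊕ k₂) * Z₂ s θ :=
    fun _ _ => rfl
  simp only [PQRS.comp, PQRS.adj, gramData, hQ, hS, hR₁, hR₂, embMat_mul_transpose_mul]
  have hP₀ : (gramFactor m Z₁ Z₂).P = 0 := rfl
  have hQ₀ : ∀ s, (gramFactor m Z₁ Z₂).Q₁ s = 0 := fun _ => rfl
  simp only [hP₀, hQ₀, Matrix.transpose_zero, Pi.zero_apply, Matrix.mul_zero,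
    zero_add, Matrix.transpose_one, Matrix.one_mul, Matrix.mul_one, matInt_smul_const,
    Matrix.transpose_add, Matrix.transpose_smul, Matrix.transpose_mul, matInt_transpose, hsub]
  congr 1
  · funext s
    abel
  · funext s η
    abel
  · funext s η
    abel

variable {a b : ℝ}

lemma gramData_cont {g : ℝ → ℝ} {Z₁ : ℝ → Matrix k₁ n ℝ} {Z₂ : ℝ → ℝ → Matrix k₂ n ℝ}
    {T : Matrix (m ⊕ k₁ ⊕ k₂ ⊕ k₂) (m ⊕ k₁ ⊕ k₂ ⊕ k₂) ℝ} (hg : Continuous g)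
    (h₁ : Continuous Z₁) (h₂ : Continuous fun p : ℝ × ℝ => Z₂ p.1 p.2) (hT : T.IsSymm) :
    (gramData a b g Z₁ Z₂ T).Cont := by
  rw [gramData_eq_comp a b g Z₁ Z₂ hT]
  exact (gramFactor_cont h₁ h₂).adj.comp a b
    ((mulData_cont (hg.smul continuous_const)).comp a b (gramFactor_cont h₁ h₂))

/-- The form of Gram data is `∫ₐᵇ g(s) v(s)ᵀ T v'(s) ds`. -/
lemma gramData_form (hab : a ≤ b) {g : ℝ → ℝ} {Z₁ : ℝ → Matrix k₁ n ℝ}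
    {Z₂ : ℝ → ℝ → Matrix k₂ n ℝ}
    {T : Matrix (m ⊕ k₁ ⊕ k₂ ⊕ k₂) (m ⊕ k₁ ⊕ k₂ ⊕ k₂) ℝ} (hg : Continuous g)
    (h₁ : Continuous Z₁) (h₂ : Continuous fun p : ℝ × ℝ => Z₂ p.1 p.2) (hT : T.IsSymm)
    (u x : m → ℝ) {f z : ℝ → n → ℝ} (hf : MemLp f 2 (volume.restrict (Icc a b)))
    (hz : MemLp z 2 (volume.restrict (Icc a b))) :
    (gramData a b g Z₁ Z₂ T).form a b u f x z
      = ∫ s in Icc a b, g s * ((gramFactor m Z₁ Z₂).opF a b u f s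
          ⬝ᵥ T *ᵥ (gramFactor m Z₁ Z₂).opF a b x z s) := by
  have hL : (gramFactor m Z₁ Z₂).Cont := gramFactor_cont h₁ h₂
  have hM : (mulData fun s => g s • T).Cont := mulData_cont (hg.smul continuous_const)
  have hML := hM.comp a b hL
  rw [gramData_eq_comp a b g Z₁ Z₂ hT, PQRS.form_comp hL.adj hML hab u f x hz,
    PQRS.form_adj hL (PQRS.opF_memLp hML x hz) hf, PQRS.form, PQRS.pairing]
  simp only [dotProduct, Finset.univ_eq_empty, Finset.sum_empty, zero_add]
  refine setIntegral_congr_fun measurableSet_Icc fun s hs => ?_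
  change _ ⬝ᵥ _ = g s * (_ ⬝ᵥ _)
  rw [PQRS.opF_comp hM hL x hz hs, dotProduct_comm, ← smul_eq_mul, ← dotProduct_smul,
    ← Matrix.smul_mulVec]
  congr 1
  have hker : ∀ s θ, (mulData fun s => g s • T).ker s θ = 0 := fun s θ => by
    simp [PQRS.ker, mulData]
  simp only [PQRS.opF, hker, Matrix.zero_mulVec, integral_zero, add_zero]
  simp [mulData]

end Gram

section Phi

variable {m n : Type} [Fintype m] [Fintype n] [DecidableEq m] [DecidableEq n] {a b : ℝ}

lemma continuous_monomials (n : Type) [DecidableEq n] (d : ℕ) : Continuous (monomials n d) := by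
  refine continuous_matrix fun p j => ?_
  simp only [monomials, Matrix.of_apply]
  split_ifs <;> fun_prop

/-- A Gram datum with weight nonnegative on `[a, b]` defines a symmetric and positive form. -/
lemma IsGram.form_symm_nonneg (hab : a ≤ b) {g : ℝ → ℝ} (hg : Continuous g)
    (hg0 : ∀ s ∈ Icc a b, 0 ≤ g s) {d : ℕ} {X : PQRS m n m n} (hX : IsGram a b g d X) :
    X.Cont ∧ ∀ (u x : m → ℝ) (f z : ℝ → n → ℝ), MemLp f 2 (volume.restrict (Icc a b)) →
      MemLp z 2 (volume.restrict (Icc a b)) →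
      X.form a b u f x z = X.form a b x z u f ∧ 0 ≤ X.form a b x z x z := by
  obtain ⟨e, Z₂, T, hT, rfl⟩ := hX
  have hTs : T.IsSymm := by
    simpa [Matrix.IsSymm] using hT.isHermitian.eq
  have h₁ := continuous_monomials n d
  have h₂ := continuous_ev₂ Z₂
  refine ⟨gramData_cont hg h₁ h₂ hTs, fun u x f z hf hz => ?_⟩
  rw [gramData_form hab hg h₁ h₂ hTs u x hf hz, gramData_form hab hg h₁ h₂ hTs x u hz hf,
    gramData_form hab hg h₁ h₂ hTs x x hz hz]
  refine ⟨integral_congr_ae (Filter.Eventually.of_forall fun s => ?_),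
    setIntegral_nonneg measurableSet_Icc fun s hs => mul_nonneg (hg0 s hs) ?_⟩
  · simp only
    congr 1
    rw [Matrix.dotProduct_mulVec, ← Matrix.mulVec_transpose, hTs.eq, dotProduct_comm]
  · simpa using hT.dotProduct_mulVec_nonneg ((gramFactor m (monomials n d) (ev₂ Z₂)).opF a b x z s)

/-- Data in the cone `Φ_d` define a symmetric and nonnegative form. -/
lemma Phi.form_symm_nonneg (hab : a ≤ b) {d : ℕ} {X : PQRS m n m n} (hX : X ∈ Phi a b d)
    (u x : m → ℝ) {f z : ℝ → n → ℝ} (hf : MemLp f 2 (volume.restrict (Icc a b)))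
    (hz : MemLp z 2 (volume.restrict (Icc a b))) :
    X.form a b u f x z = X.form a b x z u f ∧ 0 ≤ X.form a b x z x z := by
  obtain ⟨Y, Y', hY, hY', h⟩ := hX
  obtain ⟨cY, sY⟩ := hY.form_symm_nonneg hab continuous_const fun _ _ => zero_le_one
  obtain ⟨cY', sY'⟩ := hY'.form_symm_nonneg hab (by fun_prop) fun s hs =>
    mul_nonneg (sub_nonneg.2 hs.1) (sub_nonneg.2 hs.2)
  rw [PQRS.form_congr_data h, PQRS.form_congr_data h, PQRS.form_congr_data h,
    PQRS.form_add cY cY' hf hz, PQRS.form_add cY cY' hz hf, PQRS.form_add cY cY' hz hz]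
  exact ⟨by rw [(sY u x f z hf hz).1, (sY' u x f z hf hz).1],
    add_nonneg (sY u x f z hf hz).2 (sY' u x f z hf hz).2⟩

end Phi

/-! ### Block matrices -/

section Blocks

variable {T : Type} [TopologicalSpace T] {m₁ m₂ m₃ m₄ m₅ m₆ n n₁ n₂ n₃ : Type}

lemma continuous_fromRows {X : T → Matrix m₁ n ℝ} {Y : T → Matrix m₂ n ℝ} (hX : Continuous X)
    (hY : Continuous Y) : Continuous fun t => Matrix.fromRows (X t) (Y t) := by
  refine continuous_matrix fun i j => ?_
  rcases i with i | i
  · exact hX.matrix_elem i j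
  · exact hY.matrix_elem i j

lemma continuous_fromCols {X : T → Matrix n m₁ ℝ} {Y : T → Matrix n m₂ ℝ} (hX : Continuous X)
    (hY : Continuous Y) : Continuous fun t => Matrix.fromCols (X t) (Y t) := by
  refine continuous_matrix fun i j => ?_
  rcases j with j | j
  · exact hX.matrix_elem i j
  · exact hY.matrix_elem i j

lemma continuous_row₃ {X : T → Matrix n n₁ ℝ} {Y : T → Matrix n n₂ ℝ} {Z : T → Matrix n n₃ ℝ}
    (hX : Continuous X) (hY : Continuous Y) (hZ : Continuous Z) :
    Continuous fun t => row₃ (X t) (Y t) (Z t) :=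
  continuous_fromCols hX (continuous_fromCols hY hZ)

lemma continuous_col₃ {X : T → Matrix m₁ n ℝ} {Y : T → Matrix m₂ n ℝ} {Z : T → Matrix m₃ n ℝ}
    (hX : Continuous X) (hY : Continuous Y) (hZ : Continuous Z) :
    Continuous fun t => col₃ (X t) (Y t) (Z t) :=
  continuous_fromRows hX (continuous_fromRows hY hZ)

lemma row₃_mulVec [Fintype n₁] [Fintype n₂] [Fintype n₃] (X : Matrix n n₁ ℝ) (Y : Matrix n n₂ ℝ)
    (Z : Matrix n n₃ ℝ) (u : n₁ → ℝ) (v : n₂ → ℝ) (w : n₃ → ℝ) :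
    row₃ X Y Z *ᵥ Sum.elim u (Sum.elim v w) = X *ᵥ u + (Y *ᵥ v + Z *ᵥ w) := by
  simp [row₃]

lemma col₃_mulVec [Fintype n] (X : Matrix m₁ n ℝ) (Y : Matrix m₂ n ℝ) (Z : Matrix m₃ n ℝ)
    (v : n → ℝ) : col₃ X Y Z *ᵥ v = Sum.elim (X *ᵥ v) (Sum.elim (Y *ᵥ v) (Z *ᵥ v)) := by
  simp [col₃, Matrix.fromRows_mulVec]

lemma col₆_mulVec [Fintype n] (X₁ : Matrix m₁ n ℝ) (X₂ : Matrix m₂ n ℝ) (X₃ : Matrix m₃ n ℝ)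
    (X₄ : Matrix m₄ n ℝ) (X₅ : Matrix m₅ n ℝ) (X₆ : Matrix m₆ n ℝ) (v : n → ℝ) :
    col₆ X₁ X₂ X₃ X₄ X₅ X₆ *ᵥ v = Sum.elim (X₁ *ᵥ v) (Sum.elim (X₂ *ᵥ v) (Sum.elim (X₃ *ᵥ v)
      (Sum.elim (X₄ *ᵥ v) (Sum.elim (X₅ *ᵥ v) (X₆ *ᵥ v))))) := by
  simp [col₆, Matrix.fromRows_mulVec]

lemma sumElim_add {α β : Type} (f f' : α → ℝ) (g g' : β → ℝ) :
    Sum.elim f g + Sum.elim f' g' = Sum.elim (f + f') (g + g') := by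
  ext (i | i) <;> rfl

end Blocks

section SumIntegral

variable {α : Type} [MeasurableSpace α] {μ : Measure α} {p q : Type} [Fintype p] [Fintype q]

lemma _root_.MeasureTheory.MemLp.sumElim {r : ENNReal} {f : α → p → ℝ} {g : α → q → ℝ}
    (hf : MemLp f r μ) (hg : MemLp g r μ) : MemLp (fun s => Sum.elim (f s) (g s)) r μ := by
  refine memLp_pi_iff.2 fun i => ?_
  rcases i with i | i
  · exact memLp_pi_iff.1 hf i
  · exact memLp_pi_iff.1 hg i

lemma _root_.MeasureTheory.Integrable.sumElim {f : α → p → ℝ} {g : α → q → ℝ}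
    (hf : Integrable f μ) (hg : Integrable g μ) :
    Integrable (fun s => Sum.elim (f s) (g s)) μ :=
  memLp_one_iff_integrable.1
    ((memLp_one_iff_integrable.2 hf).sumElim (memLp_one_iff_integrable.2 hg))

lemma integral_sumElim {f : α → p → ℝ} {g : α → q → ℝ} (hf : Integrable f μ)
    (hg : Integrable g μ) :
    ∫ s, Sum.elim (f s) (g s) ∂μ = Sum.elim (∫ s, f s ∂μ) (∫ s, g s ∂μ) := by
  ext i
  rw [eval_integral (integrable_pi_iff.1 (hf.sumElim hg))]
  rcases i with i | i
  · simp only [Sum.elim_inl, eval_integral (integrable_pi_iff.1 hf)]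
  · simp only [Sum.elim_inr, eval_integral (integrable_pi_iff.1 hg)]

end SumIntegral

/-! ### Primitives -/

section Primitive

variable {a b : ℝ} {q : Type} [Fintype q]

lemma integral_Icc_ite_lt {E : Type} [NormedAddCommGroup E] [NormedSpace ℝ E] {s : ℝ}
    (hs : s ∈ Icc a b) (f : ℝ → E) :
    (∫ θ in Icc a b, if θ < s then f θ else 0) = ∫ θ in a..s, f θ := by
  have h : (fun θ => if θ < s then f θ else 0) = (Iio s).indicator f := by
    ext θ; simp [indicator_apply]
  have h' : Icc a b ∩ Iio s = Ico a s := by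
    ext θ
    simp only [mem_inter_iff, mem_Icc, mem_Iio, mem_Ico]
    exact ⟨fun h => ⟨h.1.1, h.2⟩, fun h => ⟨⟨h.1, h.2.le.trans hs.2⟩, h.2⟩⟩
  rw [h, setIntegral_indicator measurableSet_Iio, h',
    integral_Ico_eq_integral_Ioc (μ := volume), intervalIntegral.integral_of_le hs.1]

/-- Cauchy's formula for a twofold primitive; the primitive is the operator given by
`R₁ = I`, whose composition with itself is given by `R₁(s,η) = (s - η) I`. -/
lemma integral_integral_eq_integral_sub_smul [DecidableEq q] {z : ℝ → q → ℝ}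
    (hz : MemLp z 2 (volume.restrict (Icc a b))) {s : ℝ} (hs : s ∈ Icc a b) :
    ∫ τ in a..s, ∫ θ in a..τ, z θ = ∫ θ in a..s, (s - θ) • z θ := by
  set X : PQRS (Fin 0) q (Fin 0) q := ⟨0, 0, 0, 0, fun _ _ => 1, 0⟩ with hX
  have cX : X.Cont := ⟨continuous_const, continuous_const, continuous_const, continuous_const,
    continuous_const⟩
  have hker : ∀ s θ (v : q → ℝ), X.ker s θ *ᵥ v = if θ < s then v else 0 := fun s θ v => by
    by_cases h : θ < s
    · simp [PQRS.ker, hX, h]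
    · simp [PQRS.ker, hX, h]
  have hop : ∀ (v : ℝ → q → ℝ) (x : Fin 0 → ℝ), ∀ τ ∈ Icc a b,
      X.opF a b x v τ = ∫ θ in a..τ, v θ := fun v x τ hτ => by
    simp only [PQRS.opF, hker, integral_Icc_ite_lt hτ]
    simp [hX]
  have hS : ∀ s, (PQRS.comp a b X X).S s = 0 := fun s => by simp [PQRS.comp, hX]
  have hQ : ∀ s, (PQRS.comp a b X X).Q₂ s = 0 := fun s => by
    simp [PQRS.comp, hX, matInt_zero]
  have hk : ∀ s η (v : q → ℝ), (PQRS.comp a b X X).ker s η *ᵥ v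
      = if η < s then (s - η) • v else 0 := fun s η v => by
    have h1 : matInt η s (fun _ => (1 : Matrix q q ℝ)) = (s - η) • 1 := by
      ext i j
      simp [matInt]
    by_cases h : η < s
    · simp [PQRS.ker_of_lt _ h, h, PQRS.comp, hX, matInt_zero, h1, Matrix.smul_mulVec]
    · simp [PQRS.ker_of_le _ (not_lt.1 h), h, PQRS.comp, hX, matInt_zero]
  have h := PQRS.opF_comp cX cX 0 hz hs
  rw [hop _ _ s hs] at h
  rw [intervalIntegral.integral_congr (g := X.opF a b 0 z), ← h]
  · simp only [PQRS.opF, hk, hS, hQ, integral_Icc_ite_lt hs]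
    simp
  · intro τ hτ
    rw [uIcc_of_le hs.1] at hτ
    exact (hop z 0 τ ⟨hτ.1, hτ.2.trans hs.2⟩).symm

end Primitive

/-! ### The fundamental state -/

namespace SobolevState

variable {a b : ℝ} {n₁ n₂ n₃ : ℕ} (ζ : SobolevState a b n₁ n₂ n₃)

/-- The fundamental state `z_f = col(z₁, z₂ₛ, z₃ₛₛ)`. -/
def zf (s : ℝ) : IxZ n₁ n₂ n₃ → ℝ := Sum.elim (ζ.z₁ s) (Sum.elim (ζ.z₂s s) (ζ.z₃ss s))

/-- The boundary values `col(z₂(a), z₃(a), z₃ₛ(a))`. -/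
def zc : IxC n₂ n₃ → ℝ := Sum.elim (ζ.z₂ a) (Sum.elim (ζ.z₃ a) (ζ.z₃s a))

lemma memLp_zf : MemLp ζ.zf 2 (volume.restrict (Icc a b)) :=
  ζ.memLp_z₁.sumElim (ζ.memLp_z₂s.sumElim ζ.memLp_z₃ss)

/-- Taylor's formula with integral remainder. -/
lemma z₃_eq_add {s : ℝ} (hs : s ∈ Icc a b) :
    ζ.z₃ s = ζ.z₃ a + (s - a) • ζ.z₃s a + ∫ θ in a..s, (s - θ) • ζ.z₃ss θ := by
  have hi : IntervalIntegrable (fun τ => ∫ θ in a..τ, ζ.z₃ss θ) volume a s := by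
    refine ContinuousOn.intervalIntegrable ?_
    refine intervalIntegral.continuousOn_primitive_interval ?_
    rw [uIcc_of_le hs.1]
    exact (show IntegrableOn ζ.z₃ss (Icc a b) volume from
      ζ.memLp_z₃ss.integrable one_le_two).mono_set (Icc_subset_Icc_right hs.2)
  rw [ζ.z₃_eq s hs, ← integral_integral_eq_integral_sub_smul ζ.memLp_z₃ss hs,
    intervalIntegral.integral_congr (g := fun τ => ζ.z₃s a + ∫ θ in a..τ, ζ.z₃ss θ),
    intervalIntegral.integral_add intervalIntegrable_const hi, intervalIntegral.integral_const,
    add_assoc]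
  intro τ hτ
  rw [uIcc_of_le hs.1] at hτ
  exact ζ.z₃s_eq τ ⟨hτ.1, hτ.2.trans hs.2⟩

lemma integrable_sub_smul (c : ℝ) :
    Integrable (fun θ => (c - θ) • ζ.z₃ss θ) (volume.restrict (Icc a b)) := by
  have h : EssBdd (volume.restrict (Icc a b)) fun θ : ℝ =>
      ((c - θ) • (1 : Matrix (Fin n₃) (Fin n₃) ℝ)) :=
    essBdd_of_continuous (by fun_prop) a b
  simpa [Matrix.smul_mulVec] using h.integrable_mulVec (ζ.memLp_z₃ss.integrable one_le_two)

/-- The boundary values in terms of those at `a` and of the fundamental state. -/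
lemma zb_eq (hab : a ≤ b) : ζ.zb = System.matT a b n₂ n₃ *ᵥ ζ.zc
    + ∫ θ in Icc a b, System.matQ b n₁ n₂ n₃ θ *ᵥ ζ.zf θ := by
  have i₂ := ζ.memLp_z₂s.integrable one_le_two
  have i₃ := ζ.memLp_z₃ss.integrable one_le_two
  have i₃' := ζ.integrable_sub_smul b
  have i₀ : ∀ k : ℕ, Integrable (fun _ : ℝ => (0 : Fin k → ℝ)) (volume.restrict (Icc a b)) :=
    fun k => integrable_zero _ _ _
  have hQ : ∀ θ, System.matQ b n₁ n₂ n₃ θ *ᵥ ζ.zf θ = Sum.elim (0 : Fin n₂ → ℝ) (Sum.elim (ζ.z₂s θ)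
      (Sum.elim (0 : Fin n₃ → ℝ) (Sum.elim ((b - θ) • ζ.z₃ss θ)
      (Sum.elim (0 : Fin n₃ → ℝ) (ζ.z₃ss θ))))) := fun θ => by
    simp [System.matQ, zf, col₆_mulVec, row₃_mulVec, Matrix.smul_mulVec]
  have hT : System.matT a b n₂ n₃ *ᵥ ζ.zc = Sum.elim (ζ.z₂ a) (Sum.elim (ζ.z₂ a)
      (Sum.elim (ζ.z₃ a) (Sum.elim (ζ.z₃ a + (b - a) • ζ.z₃s a)
        (Sum.elim (ζ.z₃s a) (ζ.z₃s a))))) := by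
    simp [System.matT, zc, col₆_mulVec, row₃_mulVec, Matrix.smul_mulVec]
  have e : ∀ {k : ℕ} (f : ℝ → Fin k → ℝ), ∫ θ in Icc a b, f θ = ∫ θ in a..b, f θ := fun f => by
    rw [integral_Icc_eq_integral_Ioc, intervalIntegral.integral_of_le hab]
  have hb : b ∈ Icc a b := right_mem_Icc.2 hab
  simp only [hQ]
  rw [integral_sumElim (i₀ _) (i₂.sumElim ((i₀ _).sumElim (i₃'.sumElim ((i₀ _).sumElim i₃)))),
    integral_sumElim i₂ ((i₀ _).sumElim (i₃'.sumElim ((i₀ _).sumElim i₃))),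
    integral_sumElim (i₀ _) (i₃'.sumElim ((i₀ _).sumElim i₃)),
    integral_sumElim i₃' ((i₀ _).sumElim i₃), integral_sumElim (i₀ _) i₃, hT]
  simp only [sumElim_add, e, zb, ζ.z₂_eq b hb, ζ.z₃_eq_add hb, ζ.z₃s_eq b hb]
  simp

end SobolevState

namespace System

variable {nx nw ny n₁ n₂ n₃ : ℕ} (sys : System nx nw ny n₁ n₂ n₃) {a b : ℝ}

lemma continuous_matQ : Continuous (matQ b n₁ n₂ n₃) := by
  refine continuous_fromRows ?_ (continuous_fromRows ?_ (continuous_fromRows ?_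
    (continuous_fromRows ?_ (continuous_fromRows ?_ ?_)))) <;>
    exact continuous_row₃ (by fun_prop) (by fun_prop) (by fun_prop)

lemma continuous_matK : Continuous (matK a n₁ n₂ n₃) :=
  continuous_col₃ continuous_const continuous_const
    (continuous_row₃ continuous_const continuous_const (by fun_prop))

lemma continuous_bcQ : Continuous (sys.bcQ a b) :=
  continuous_const.matrix_mul continuous_matQ

lemma continuous_H₀ : Continuous (sys.H₀ a b) := continuous_matK.matrix_mul continuous_const

lemma continuous_G₂ : Continuous fun p : ℝ × ℝ => sys.G₂ a b p.1 p.2 :=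
  ((continuous_matK.comp continuous_fst).matrix_mul (sys.continuous_bcQ.comp continuous_snd)).neg

lemma continuous_G₁ : Continuous fun p : ℝ × ℝ => sys.G₁ a b p.1 p.2 :=
  (continuous_col₃ continuous_const continuous_const
    (continuous_row₃ continuous_const continuous_const (by fun_prop))).add sys.continuous_G₂

lemma continuous_G₅ : Continuous fun p : ℝ × ℝ => sys.G₅ a b p.1 p.2 :=
  (continuous_const.matrix_mul (sys.continuous_bcQ.comp continuous_snd)).neg

lemma stateData_cont : (sys.stateData a b).Cont :=
  ⟨continuous_const, sys.continuous_H₀, continuous_const, sys.continuous_G₁, sys.continuous_G₂⟩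

lemma derivData_cont : (sys.derivData a b).Cont :=
  ⟨continuous_const, continuous_const, continuous_const,
    continuous_const.add sys.continuous_G₅, sys.continuous_G₅⟩

lemma boundaryData_cont : (sys.boundaryData a b).Cont :=
  ⟨continuous_matQ.sub (continuous_const.matrix_mul sys.continuous_bcQ), continuous_const,
    continuous_const, continuous_const, continuous_const⟩

lemma data0_cont : (sys.data0 a b).Cont :=
  ⟨continuous_const, sys.continuous_H₀, continuous_const, sys.continuous_G₁, sys.continuous_G₂⟩

variable {x : Fin nx → ℝ} {w : Fin nw → ℝ} {ζ : SobolevState a b n₁ n₂ n₃}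

lemma integrable_matQ_mulVec (ζ : SobolevState a b n₁ n₂ n₃) :
    Integrable (fun θ => matQ b n₁ n₂ n₃ θ *ᵥ ζ.zf θ) (volume.restrict (Icc a b)) :=
  (essBdd_of_continuous continuous_matQ a b).integrable_mulVec
    (ζ.memLp_zf.integrable one_le_two)

lemma integrable_bcQ_mulVec (ζ : SobolevState a b n₁ n₂ n₃) :
    Integrable (fun θ => sys.bcQ a b θ *ᵥ ζ.zf θ) (volume.restrict (Icc a b)) :=
  (essBdd_of_continuous sys.continuous_bcQ a b).integrable_mulVec
    (ζ.memLp_zf.integrable one_le_two)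

/-- The boundary condition determines the boundary values at `a` from `(w, x)` and `z_f`. -/
lemma zc_eq (hab : a ≤ b) (hBT : IsUnit (sys.B * matT a b n₂ n₃).det)
    (hbc : sys.B *ᵥ ζ.zb = sys.B₁ *ᵥ x + sys.B₂ *ᵥ w) :
    ζ.zc = sys.bcW a b *ᵥ Sum.elim w x - ∫ θ in Icc a b, sys.bcQ a b θ *ᵥ ζ.zf θ := by
  have h₁ : ∫ θ in Icc a b, sys.bcQ a b θ *ᵥ ζ.zf θ = (sys.B * matT a b n₂ n₃)⁻¹
      *ᵥ (sys.B *ᵥ ∫ θ in Icc a b, matQ b n₁ n₂ n₃ θ *ᵥ ζ.zf θ) := by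
    rw [Matrix.mulVec_mulVec, mulVec_integral _ (integrable_matQ_mulVec ζ)]
    simp only [Matrix.mulVec_mulVec, bcQ]
  have h₂ : sys.bcW a b *ᵥ Sum.elim w x = (sys.B * matT a b n₂ n₃)⁻¹ *ᵥ (sys.B *ᵥ ζ.zb) := by
    rw [hbc, bcW, ← Matrix.mulVec_mulVec, Matrix.fromCols_mulVec_sumElim, add_comm]
  rw [h₁, h₂, ← Matrix.mulVec_sub, ← Matrix.mulVec_sub, ζ.zb_eq hab, add_sub_cancel_right,
    Matrix.mulVec_mulVec, Matrix.mulVec_mulVec, Matrix.mul_assoc, Matrix.nonsing_inv_mul _ hBT,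
    Matrix.one_mulVec]

/-- On the domain, `z_p` is recovered from `ω = (w, x)` and `z_f`: the boundary values at `a` are
eliminated by `zc_eq`. -/
lemma stateData_opF (hab : a ≤ b) (hBT : IsUnit (sys.B * matT a b n₂ n₃).det)
    (hbc : sys.B *ᵥ ζ.zb = sys.B₁ *ᵥ x + sys.B₂ *ᵥ w) {s : ℝ} (hs : s ∈ Icc a b) :
    (sys.stateData a b).opF a b (Sum.elim w x) ζ.zf s = ζ.zp s := by
  have iQ := sys.integrable_bcQ_mulVec ζ
  have iK : Integrable (fun θ => matK a n₁ n₂ n₃ s *ᵥ (sys.bcQ a b θ *ᵥ ζ.zf θ))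
      (volume.restrict (Icc a b)) :=
    (Matrix.mulVecLin (matK a n₁ n₂ n₃ s)).toContinuousLinearMap.integrable_comp iQ
  have hker : ∀ θ, (sys.stateData a b).ker s θ *ᵥ ζ.zf θ
      = (if θ < s then Sum.elim (0 : Fin n₁ → ℝ) (Sum.elim (ζ.z₂s θ) ((s - θ) • ζ.z₃ss θ)) else 0)
        - matK a n₁ n₂ n₃ s *ᵥ (sys.bcQ a b θ *ᵥ ζ.zf θ) := fun θ => by
    by_cases h : θ < s
    · rw [PQRS.ker_of_lt _ h, if_pos h]
      simp [stateData, G₁, G₂, Matrix.add_mulVec, Matrix.neg_mulVec, SobolevState.zf, col₃_mulVec,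
        row₃_mulVec, Matrix.smul_mulVec, sub_eq_add_neg]
    · rw [PQRS.ker_of_le _ (not_lt.1 h), if_neg h]
      simp [stateData, G₂, Matrix.neg_mulVec]
  have i₂ := ζ.memLp_z₂s.integrable one_le_two
  have i₃ := ζ.integrable_sub_smul s
  have i₀ : Integrable (fun _ : ℝ => (0 : Fin n₁ → ℝ)) (volume.restrict (Icc a b)) :=
    integrable_zero _ _ _
  have hint : ∫ θ in Icc a b, (sys.stateData a b).ker s θ *ᵥ ζ.zf θ
      = Sum.elim (0 : Fin n₁ → ℝ) (Sum.elim (∫ θ in a..s, ζ.z₂s θ)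
          (∫ θ in a..s, (s - θ) • ζ.z₃ss θ))
        - matK a n₁ n₂ n₃ s *ᵥ ∫ θ in Icc a b, sys.bcQ a b θ *ᵥ ζ.zf θ := by
    simp only [hker]
    have m : volume.restrict (Ioc a s) ≤ volume.restrict (Icc a b) :=
      Measure.restrict_mono ((Ioc_subset_Icc_self).trans (Icc_subset_Icc_right hs.2)) le_rfl
    rw [integral_sub _ iK, integral_Icc_ite_lt hs, intervalIntegral.integral_of_le hs.1,
      integral_sumElim (i₀.mono_measure m) ((i₂.mono_measure m).sumElim (i₃.mono_measure m)),
      integral_sumElim (i₂.mono_measure m) (i₃.mono_measure m), mulVec_integral _ iQ,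
      intervalIntegral.integral_of_le hs.1, intervalIntegral.integral_of_le hs.1]
    · simp
    · exact ((i₀.sumElim (i₂.sumElim i₃)).indicator (measurableSet_Iio (a := s))).congr
        (Filter.Eventually.of_forall fun θ => by simp [indicator_apply])
  have hc := sys.zc_eq hab hBT hbc
  rw [PQRS.opF, hint]
  have hH : (sys.stateData a b).Q₂ s *ᵥ Sum.elim w x
      = matK a n₁ n₂ n₃ s *ᵥ ζ.zc + matK a n₁ n₂ n₃ s
        *ᵥ ∫ θ in Icc a b, sys.bcQ a b θ *ᵥ ζ.zf θ := by
    rw [hc, ← Matrix.mulVec_add, sub_add_cancel, Matrix.mulVec_mulVec]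
    rfl
  have hS : (sys.stateData a b).S s *ᵥ ζ.zf s
      = Sum.elim (ζ.z₁ s) (Sum.elim (0 : Fin n₂ → ℝ) (0 : Fin n₃ → ℝ)) := by
    simp [stateData, G₀, SobolevState.zf, col₃_mulVec, row₃_mulVec]
  have hKc : matK a n₁ n₂ n₃ s *ᵥ ζ.zc
      = Sum.elim (0 : Fin n₁ → ℝ) (Sum.elim (ζ.z₂ a) (ζ.z₃ a + (s - a) • ζ.z₃s a)) := by
    simp [matK, SobolevState.zc, col₃_mulVec, row₃_mulVec, Matrix.smul_mulVec]
  rw [hH, hS, hKc, SobolevState.zp, ζ.z₂_eq s hs, ζ.z₃_eq_add hs]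
  have : ∀ (p q r t : IxZ n₁ n₂ n₃ → ℝ), p + t + q + (r - t) = p + q + r := fun p q r t => by abel
  rw [this]
  simp [sumElim_add]

/-- On the domain, `col(z₂ₛ, z₃ₛ)` is recovered from `ω = (w, x)` and `z_f`. -/
lemma derivData_opF (hab : a ≤ b) (hBT : IsUnit (sys.B * matT a b n₂ n₃).det)
    (hbc : sys.B *ᵥ ζ.zb = sys.B₁ *ᵥ x + sys.B₂ *ᵥ w) {s : ℝ} (hs : s ∈ Icc a b) :
    (sys.derivData a b).opF a b (Sum.elim w x) ζ.zf s = ζ.zd s := by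
  have iQ := sys.integrable_bcQ_mulVec ζ
  have iK : Integrable (fun θ => matV n₂ n₃ *ᵥ (sys.bcQ a b θ *ᵥ ζ.zf θ))
      (volume.restrict (Icc a b)) :=
    (Matrix.mulVecLin (matV n₂ n₃)).toContinuousLinearMap.integrable_comp iQ
  have hker : ∀ θ, (sys.derivData a b).ker s θ *ᵥ ζ.zf θ
      = (if θ < s then Sum.elim (0 : Fin n₂ → ℝ) (ζ.z₃ss θ) else 0)
        - matV n₂ n₃ *ᵥ (sys.bcQ a b θ *ᵥ ζ.zf θ) := fun θ => by
    by_cases h : θ < s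
    · rw [PQRS.ker_of_lt _ h, if_pos h]
      simp [derivData, G₄, G₅, Matrix.add_mulVec, Matrix.neg_mulVec, SobolevState.zf,
        Matrix.fromRows_mulVec, row₃_mulVec, sub_eq_add_neg]
    · rw [PQRS.ker_of_le _ (not_lt.1 h), if_neg h]
      simp [derivData, G₅, Matrix.neg_mulVec]
  have i₃ := ζ.memLp_z₃ss.integrable one_le_two
  have i₀ : Integrable (fun _ : ℝ => (0 : Fin n₂ → ℝ)) (volume.restrict (Icc a b)) :=
    integrable_zero _ _ _
  have hint : ∫ θ in Icc a b, (sys.derivData a b).ker s θ *ᵥ ζ.zf θ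
      = Sum.elim (0 : Fin n₂ → ℝ) (∫ θ in a..s, ζ.z₃ss θ)
        - matV n₂ n₃ *ᵥ ∫ θ in Icc a b, sys.bcQ a b θ *ᵥ ζ.zf θ := by
    simp only [hker]
    have m : volume.restrict (Ioc a s) ≤ volume.restrict (Icc a b) :=
      Measure.restrict_mono ((Ioc_subset_Icc_self).trans (Icc_subset_Icc_right hs.2)) le_rfl
    rw [integral_sub _ iK, integral_Icc_ite_lt hs, intervalIntegral.integral_of_le hs.1,
      integral_sumElim (i₀.mono_measure m) (i₃.mono_measure m), mulVec_integral _ iQ,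
      intervalIntegral.integral_of_le hs.1]
    · simp
    · exact ((i₀.sumElim i₃).indicator (measurableSet_Iio (a := s))).congr
        (Filter.Eventually.of_forall fun θ => by simp [indicator_apply])
  have hc := sys.zc_eq hab hBT hbc
  rw [PQRS.opF, hint]
  have hH : (sys.derivData a b).Q₂ s *ᵥ Sum.elim w x = matV n₂ n₃ *ᵥ ζ.zc + matV n₂ n₃
        *ᵥ ∫ θ in Icc a b, sys.bcQ a b θ *ᵥ ζ.zf θ := by
    rw [hc, ← Matrix.mulVec_add, sub_add_cancel, Matrix.mulVec_mulVec]
    rfl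
  have hS : (sys.derivData a b).S s *ᵥ ζ.zf s = Sum.elim (ζ.z₂s s) 0 := by
    simp [derivData, G₃, SobolevState.zf, Matrix.fromRows_mulVec, row₃_mulVec]
  have hKc : matV n₂ n₃ *ᵥ ζ.zc = Sum.elim (0 : Fin n₂ → ℝ) (ζ.z₃s a) := by
    simp [matV, SobolevState.zc, Matrix.fromRows_mulVec, row₃_mulVec]
  rw [hH, hS, hKc, SobolevState.zd, ζ.z₃s_eq s hs]
  have : ∀ (p q r t : IxD n₂ n₃ → ℝ), p + t + q + (r - t) = p + q + r := fun p q r t => by abel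
  rw [this]
  simp [sumElim_add]

/-- On the domain, `z_b` is recovered from `ω = (w, x)` and `z_f`. -/
lemma boundaryData_opV (hab : a ≤ b) (hBT : IsUnit (sys.B * matT a b n₂ n₃).det)
    (hbc : sys.B *ᵥ ζ.zb = sys.B₁ *ᵥ x + sys.B₂ *ᵥ w) :
    (sys.boundaryData a b).opV a b (Sum.elim w x) ζ.zf = ζ.zb := by
  have iQ := sys.integrable_bcQ_mulVec ζ
  have iT : Integrable (fun θ => matT a b n₂ n₃ *ᵥ (sys.bcQ a b θ *ᵥ ζ.zf θ))
      (volume.restrict (Icc a b)) :=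
    (Matrix.mulVecLin (matT a b n₂ n₃)).toContinuousLinearMap.integrable_comp iQ
  have e : ∀ θ, (sys.boundaryData a b).Q₁ θ *ᵥ ζ.zf θ = matQ b n₁ n₂ n₃ θ *ᵥ ζ.zf θ
      - matT a b n₂ n₃ *ᵥ (sys.bcQ a b θ *ᵥ ζ.zf θ) := fun θ => by
    simp [boundaryData, Matrix.sub_mulVec]
  have hP : (sys.boundaryData a b).P = matT a b n₂ n₃ * sys.bcW a b := rfl
  simp only [PQRS.opV, e, hP]
  rw [integral_sub (integrable_matQ_mulVec ζ) iT, ← mulVec_integral _ iQ, ζ.zb_eq hab,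
    sys.zc_eq hab hBT hbc, Matrix.mulVec_sub, Matrix.mulVec_mulVec]
  abel

end System

/-! ### The system operators in terms of the fundamental state -/

namespace PQRS

variable {m q n r : Type} [Fintype m] [Fintype q] [Fintype n] [Fintype r] {a b : ℝ}

lemma opF_of_ker_eq_zero (P : Matrix n m ℝ) (Q₁ : ℝ → Matrix n q ℝ) (Q₂ : ℝ → Matrix r m ℝ)
    (S : ℝ → Matrix r q ℝ) (x : m → ℝ) (z : ℝ → q → ℝ) (s : ℝ) :
    opF a b ⟨P, Q₁, Q₂, S, 0, 0⟩ x z s = Q₂ s *ᵥ x + S s *ᵥ z s := by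
  simp [opF, ker]

lemma form_congr {X : PQRS m q n r} {u : n → ℝ} {f g : ℝ → r → ℝ} {x : m → ℝ}
    {z v : ℝ → q → ℝ} (hf : ∀ᵐ s ∂volume.restrict (Icc a b), f s = g s)
    (hz : ∀ᵐ s ∂volume.restrict (Icc a b), z s = v s) :
    X.form a b u f x z = X.form a b u g x v := by
  have hV : X.opV a b x z = X.opV a b x v := by
    simp only [opV]
    rw [integral_congr_ae (g := fun s => X.Q₁ s *ᵥ v s) (hz.mono fun s hs => by
      simp only [hs])]
  have hF : ∀ᵐ s ∂volume.restrict (Icc a b), X.opF a b x z s = X.opF a b x v s := by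
    filter_upwards [hz] with s hs
    simp only [opF, hs]
    rw [integral_congr_ae (g := fun θ => X.ker s θ *ᵥ v θ) (hz.mono fun θ hθ => by
      simp only [hθ])]
  rw [form, form, hV, pairing_congr_right hF, pairing_comm, pairing_congr_right hf, pairing_comm]

/-- The form of `-X - X*` is `-2` times the form of `X` on the diagonal. -/
lemma form_neg_sub_adj {X : PQRS m q m q} (hX : X.Cont) {x : m → ℝ} {z : ℝ → q → ℝ}
    (hz : MemLp z 2 (volume.restrict (Icc a b))) :
    (-X - X.adj).form a b x z x z = -2 * X.form a b x z x z := by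
  rw [sub_eq_add_neg, neg_eq_smul X, neg_eq_smul X.adj,
    form_add (hX.smul _) (hX.adj.smul _) hz hz, form_smul, form_smul, form_adj hX hz hz]
  ring

/-- Shifting the diagonal of the data by `ε` adds `ε` times the inner product to the form. -/
lemma form_eq_form_sub_add [DecidableEq m] [DecidableEq q] {X : PQRS m q m q} (hX : X.Cont)
    (ε : ℝ) {u x : m → ℝ} {f z : ℝ → q → ℝ} (hf : MemLp f 2 (volume.restrict (Icc a b)))
    (hz : MemLp z 2 (volume.restrict (Icc a b))) :
    X.form a b u f x z
      = form a b ⟨X.P - ε • 1, X.Q₁, X.Q₂, fun s => X.S s - ε • 1, X.R₁, X.R₂⟩ u f x z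
        + ε * pairing a b u f x z := by
  have hI : (⟨1, 0, 0, fun _ => 1, 0, 0⟩ : PQRS m q m q).Cont :=
    ⟨continuous_const, continuous_const, continuous_const, continuous_const, continuous_const⟩
  have hY : (⟨X.P - ε • 1, X.Q₁, X.Q₂, fun s => X.S s - ε • 1, X.R₁, X.R₂⟩ :
      PQRS m q m q).Cont := ⟨hX.Q₁, hX.Q₂, hX.S.sub continuous_const, hX.R₁, hX.R₂⟩
  have e : X = ⟨X.P - ε • 1, X.Q₁, X.Q₂, fun s => X.S s - ε • 1, X.R₁, X.R₂⟩
      + ε • (⟨1, 0, 0, fun _ => 1, 0, 0⟩ : PQRS m q m q) := by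
    change X = PQRS.mk (_ + ε • _) (_ + ε • _) (_ + ε • _) (_ + ε • _) (_ + ε • _) (_ + ε • _)
    cases X
    simp only [sub_add_cancel, smul_zero, add_zero, mk.injEq, true_and, and_true]
    funext s
    simp
  have hid : (⟨1, 0, 0, fun _ => 1, 0, 0⟩ : PQRS m q m q).form a b u f x z
      = pairing a b u f x z := by
    have : opF a b (⟨1, 0, 0, fun _ => 1, 0, 0⟩ : PQRS m q m q) x z = z := by
      funext s
      rw [opF_of_ker_eq_zero]
      simp
    rw [form, this]
    simp [opV]
  conv_lhs => rw [e]
  rw [form_add hY (hI.smul ε) hf hz, form_smul, hid]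

/-- If `X - ε I` lies in the cone `Φ_d` for some `ε ≥ 0`, then the form of `X` is symmetric and
nonnegative. -/
lemma form_symm_nonneg_of_sub_mem [DecidableEq m] [DecidableEq q] (hab : a ≤ b)
    {X : PQRS m q m q} (hX : X.Cont) {ε : ℝ} (hε : 0 ≤ ε) {d : ℕ}
    (h : (⟨X.P - ε • 1, X.Q₁, X.Q₂, fun s => X.S s - ε • 1, X.R₁, X.R₂⟩ : PQRS m q m q)
      ∈ Phi a b d) (u x : m → ℝ) {f z : ℝ → q → ℝ}
    (hf : MemLp f 2 (volume.restrict (Icc a b))) (hz : MemLp z 2 (volume.restrict (Icc a b))) :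
    X.form a b u f x z = X.form a b x z u f ∧ 0 ≤ X.form a b x z x z := by
  obtain ⟨h₁, h₂⟩ := Phi.form_symm_nonneg hab h u x hf hz
  refine ⟨?_, ?_⟩
  · rw [form_eq_form_sub_add hX ε hf hz, form_eq_form_sub_add hX ε hz hf, h₁, pairing_comm u]
  · rw [form_eq_form_sub_add hX ε hz hz]
    refine add_nonneg h₂ (mul_nonneg hε (add_nonneg ?_ ?_))
    · exact Finset.sum_nonneg fun i _ => mul_self_nonneg (x i)
    · exact integral_nonneg fun s => Finset.sum_nonneg fun i _ => mul_self_nonneg (z s i)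

end PQRS

namespace System

variable {nx nw ny n₁ n₂ n₃ : ℕ} (sys : System nx nw ny n₁ n₂ n₃) {a b : ℝ}

lemma _root_.CoupledODEPDE.PQRS.cont_of_ker_eq_zero {m q n r : Type} {P : Matrix n m ℝ}
    {Q₁ : ℝ → Matrix n q ℝ} {Q₂ : ℝ → Matrix r m ℝ} {S : ℝ → Matrix r q ℝ} (h₁ : Continuous Q₁)
    (h₂ : Continuous Q₂) (h₃ : Continuous S) : (⟨P, Q₁, Q₂, S, 0, 0⟩ : PQRS m q n r).Cont :=
  ⟨h₁, h₂, h₃, continuous_const, continuous_const⟩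

lemma dataB_cont : sys.dataB.Cont :=
  PQRS.cont_of_ker_eq_zero continuous_const
    (continuous_fromCols (continuous_ev _) continuous_const) continuous_const

lemma dataD_cont : sys.dataD.Cont :=
  PQRS.cont_of_ker_eq_zero continuous_const continuous_const continuous_const

section Cont

lemma comp_stateData_cont {k l : Type} {F : Matrix k (IxZ n₁ n₂ n₃) ℝ[X]}
    {S : ℝ → Matrix l (IxZ n₁ n₂ n₃) ℝ} (hS : Continuous S) :
    (PQRS.comp a b ⟨0, ev F, 0, S, 0, 0⟩ (sys.stateData a b)).Cont :=
  (PQRS.cont_of_ker_eq_zero (continuous_ev _) continuous_const hS).comp a b sys.stateData_cont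

lemma comp_derivData_cont {k l : Type} {F : Matrix k (IxD n₂ n₃) ℝ[X]}
    {S : ℝ → Matrix l (IxD n₂ n₃) ℝ} (hS : Continuous S) :
    (PQRS.comp a b ⟨0, ev F, 0, S, 0, 0⟩ (sys.derivData a b)).Cont :=
  (PQRS.cont_of_ker_eq_zero (continuous_ev _) continuous_const hS).comp a b sys.derivData_cont

lemma comp_boundaryData_cont {k l : Type} {F : Matrix k (IxB n₂ n₃) ℝ} :
    (PQRS.comp a b (⟨F, 0, 0, 0, 0, 0⟩ : PQRS _ _ k l) (sys.boundaryData a b)).Cont :=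
  (PQRS.cont_of_ker_eq_zero continuous_const continuous_const continuous_const).comp a b
    sys.boundaryData_cont

lemma dataA_cont : (sys.dataA a b).Cont :=
  (((sys.comp_stateData_cont (continuous_ev _)).add
    (sys.comp_derivData_cont (continuous_ev _))).add sys.comp_boundaryData_cont).add
    (PQRS.cont_of_ker_eq_zero continuous_const
      (continuous_fromCols continuous_const (continuous_ev _))
      (continuous_row₃ continuous_const continuous_const (continuous_ev _)))

lemma dataC_cont : (sys.dataC a b).Cont :=
  (((sys.comp_stateData_cont continuous_const).add
    (sys.comp_derivData_cont continuous_const)).add sys.comp_boundaryData_cont).add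
    (PQRS.cont_of_ker_eq_zero continuous_const continuous_const continuous_const)

lemma dataJ_cont (γ : ℝ) {X : PQRS (Fin nx) (IxZ n₁ n₂ n₃) (Fin nx) (IxZ n₁ n₂ n₃)}
    (hX : X.Cont) : (sys.dataJ a b γ X).Cont :=
  ((((sys.data0_cont.adj.comp a b hX).comp a b (sys.dataA_cont.add sys.dataB_cont)).add
    (((sys.dataC_cont.adj.comp a b sys.dataC_cont).add
      (PQRS.cont_of_ker_eq_zero continuous_const continuous_const continuous_const)).smul _)).add
    (sys.dataC_cont.adj.comp a b sys.dataD_cont))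

end Cont

variable {x : Fin nx → ℝ} {w : Fin nw → ℝ} {ζ : SobolevState a b n₁ n₂ n₃}

section Ops

variable (hab : a ≤ b) (hBT : IsUnit (sys.B * matT a b n₂ n₃).det)
  (hbc : sys.B *ᵥ ζ.zb = sys.B₁ *ᵥ x + sys.B₂ *ᵥ w)

include hab hBT hbc

lemma integrable_mulVec_zp {k : Type} [Fintype k] (F : Matrix k (IxZ n₁ n₂ n₃) ℝ[X]) :
    Integrable (fun s => ev F s *ᵥ ζ.zp s) (volume.restrict (Icc a b)) := by
  have h := (PQRS.opF_memLp (sys.stateData_cont (a := a) (b := b)) (Sum.elim w x)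
    ζ.memLp_zf).integrable one_le_two
  refine ((essBdd_of_continuous (continuous_ev F) a b).integrable_mulVec h).congr ?_
  rw [Filter.EventuallyEq, ae_restrict_iff' measurableSet_Icc]
  exact Filter.Eventually.of_forall fun s hs => by rw [sys.stateData_opF hab hBT hbc hs]

lemma integrable_mulVec_zd {k : Type} [Fintype k] (F : Matrix k (IxD n₂ n₃) ℝ[X]) :
    Integrable (fun s => ev F s *ᵥ ζ.zd s) (volume.restrict (Icc a b)) := by
  have h := (PQRS.opF_memLp (sys.derivData_cont (a := a) (b := b)) (Sum.elim w x)
    ζ.memLp_zf).integrable one_le_two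
  refine ((essBdd_of_continuous (continuous_ev F) a b).integrable_mulVec h).congr ?_
  rw [Filter.EventuallyEq, ae_restrict_iff' measurableSet_Icc]
  exact Filter.Eventually.of_forall fun s hs => by rw [sys.derivData_opF hab hBT hbc hs]

lemma integral_mulVec_zp_add_zd {k : Type} [Fintype k] (F : Matrix k (IxZ n₁ n₂ n₃) ℝ[X])
    (G : Matrix k (IxD n₂ n₃) ℝ[X]) :
    ∫ s in a..b, (ev F s *ᵥ ζ.zp s + ev G s *ᵥ ζ.zd s)
      = (∫ s in Icc a b, ev F s *ᵥ ζ.zp s) + ∫ s in Icc a b, ev G s *ᵥ ζ.zd s := by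
  rw [← integral_add (sys.integrable_mulVec_zp hab hBT hbc F)
    (sys.integrable_mulVec_zd hab hBT hbc G), intervalIntegral.integral_of_le hab,
    integral_Icc_eq_integral_Ioc]

lemma comp_stateData_opV {k l : Type} [Fintype k] [Fintype l] (F : Matrix k (IxZ n₁ n₂ n₃) ℝ[X])
    {S : ℝ → Matrix l (IxZ n₁ n₂ n₃) ℝ} (hS : Continuous S) :
    (PQRS.comp a b ⟨0, ev F, 0, S, 0, 0⟩ (sys.stateData a b)).opV a b (Sum.elim w x) ζ.zf
      = ∫ s in Icc a b, ev F s *ᵥ ζ.zp s := by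
  rw [PQRS.opV_comp (X := ⟨0, ev F, 0, S, 0, 0⟩)
    (PQRS.cont_of_ker_eq_zero (continuous_ev _) continuous_const hS)
    sys.stateData_cont hab _ ζ.memLp_zf]
  simp only [PQRS.opV, Matrix.zero_mulVec, zero_add]
  exact setIntegral_congr_fun measurableSet_Icc fun s hs => by
    simp only [sys.stateData_opF hab hBT hbc hs]

lemma comp_derivData_opV {k l : Type} [Fintype k] [Fintype l] (F : Matrix k (IxD n₂ n₃) ℝ[X])
    {S : ℝ → Matrix l (IxD n₂ n₃) ℝ} (hS : Continuous S) :
    (PQRS.comp a b ⟨0, ev F, 0, S, 0, 0⟩ (sys.derivData a b)).opV a b (Sum.elim w x) ζ.zf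
      = ∫ s in Icc a b, ev F s *ᵥ ζ.zd s := by
  rw [PQRS.opV_comp (X := ⟨0, ev F, 0, S, 0, 0⟩)
    (PQRS.cont_of_ker_eq_zero (continuous_ev _) continuous_const hS)
    sys.derivData_cont hab _ ζ.memLp_zf]
  simp only [PQRS.opV, Matrix.zero_mulVec, zero_add]
  exact setIntegral_congr_fun measurableSet_Icc fun s hs => by
    simp only [sys.derivData_opF hab hBT hbc hs]

lemma comp_boundaryData_opV {k l : Type} [Fintype k] [Fintype l]
    (F : Matrix k (IxB n₂ n₃) ℝ) :
    (PQRS.comp a b (⟨F, 0, 0, 0, 0, 0⟩ : PQRS _ _ k l) (sys.boundaryData a b)).opV a b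
      (Sum.elim w x) ζ.zf = F *ᵥ ζ.zb := by
  rw [PQRS.opV_comp (X := ⟨F, 0, 0, 0, 0, 0⟩) (PQRS.cont_of_ker_eq_zero continuous_const
    continuous_const continuous_const) sys.boundaryData_cont hab _ ζ.memLp_zf, PQRS.opV,
    sys.boundaryData_opV hab hBT hbc]
  simp

lemma dataC_opV : (sys.dataC a b).opV a b (Sum.elim w x) ζ.zf = sys.opC x ζ := by
  have hz := ζ.memLp_zf.integrable one_le_two
  have c₁ := sys.comp_stateData_cont (a := a) (b := b) (F := sys.Ca) (S := 0)
    (l := Fin 0) continuous_const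
  have c₂ := sys.comp_derivData_cont (a := a) (b := b) (F := sys.Cb) (S := 0)
    (l := Fin 0) continuous_const
  have c₃ := sys.comp_boundaryData_cont (a := a) (b := b) (F := sys.C₁) (l := Fin 0)
  have c₄ : (⟨Matrix.fromCols 0 sys.C, 0, 0, 0, 0, 0⟩ :
      PQRS (IxW nw nx) (IxZ n₁ n₂ n₃) (Fin ny) (Fin 0)).Cont :=
    PQRS.cont_of_ker_eq_zero continuous_const continuous_const continuous_const
  rw [dataC, PQRS.opV_add ((c₁.add c₂).add c₃) c₄ hz, PQRS.opV_add (c₁.add c₂) c₃ hz,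
    PQRS.opV_add c₁ c₂ hz, sys.comp_stateData_opV hab hBT hbc (S := 0) _ continuous_const,
    sys.comp_derivData_opV hab hBT hbc (S := 0) _ continuous_const,
    sys.comp_boundaryData_opV hab hBT hbc, opC, sys.integral_mulVec_zp_add_zd hab hBT hbc]
  simp only [PQRS.opV, Matrix.fromCols_mulVec_sumElim, Pi.zero_apply, Matrix.zero_mulVec,
    integral_zero, zero_add, add_zero]
  abel

lemma dataA_add_dataB_opV : (sys.dataA a b + sys.dataB).opV a b (Sum.elim w x) ζ.zf
    = sys.opA₁ x ζ + sys.Bwo *ᵥ w := by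
  have hz := ζ.memLp_zf.integrable one_le_two
  have c₁ := sys.comp_stateData_cont (a := a) (b := b) (F := sys.Ea) (continuous_ev sys.A₀)
  have c₂ := sys.comp_derivData_cont (a := a) (b := b) (F := sys.Eb) (continuous_ev sys.A₁)
  have c₃ := sys.comp_boundaryData_cont (a := a) (b := b) (F := sys.E₁) (l := IxZ n₁ n₂ n₃)
  have c₄ : (⟨Matrix.fromCols 0 sys.A, 0, fun s => Matrix.fromCols 0 (ev sys.E s),
      fun s => row₃ 0 0 (ev sys.A₂ s), 0, 0⟩ :
      PQRS (IxW nw nx) (IxZ n₁ n₂ n₃) (Fin nx) (IxZ n₁ n₂ n₃)).Cont :=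
    PQRS.cont_of_ker_eq_zero continuous_const
      (continuous_fromCols continuous_const (continuous_ev _))
      (continuous_row₃ continuous_const continuous_const (continuous_ev _))
  rw [PQRS.opV_add sys.dataA_cont sys.dataB_cont hz, dataA, PQRS.opV_add ((c₁.add c₂).add c₃) c₄ hz,
    PQRS.opV_add (c₁.add c₂) c₃ hz,
    PQRS.opV_add c₁ c₂ hz, sys.comp_stateData_opV hab hBT hbc _ (continuous_ev _),
    sys.comp_derivData_opV hab hBT hbc _ (continuous_ev _),
    sys.comp_boundaryData_opV hab hBT hbc, opA₁, sys.integral_mulVec_zp_add_zd hab hBT hbc]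
  simp only [PQRS.opV, dataB, Matrix.fromCols_mulVec_sumElim, Pi.zero_apply, Matrix.zero_mulVec,
    integral_zero, zero_add, add_zero]
  abel

lemma dataA_add_dataB_opF {s : ℝ} (hs : s ∈ Icc a b) :
    (sys.dataA a b + sys.dataB).opF a b (Sum.elim w x) ζ.zf s
      = sys.opA₂ x ζ s + ev sys.Bwp s *ᵥ w := by
  have hz := ζ.memLp_zf.integrable one_le_two
  have c₁ := sys.comp_stateData_cont (a := a) (b := b) (F := sys.Ea) (continuous_ev sys.A₀)
  have c₂ := sys.comp_derivData_cont (a := a) (b := b) (F := sys.Eb) (continuous_ev sys.A₁)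
  have c₃ := sys.comp_boundaryData_cont (a := a) (b := b) (F := sys.E₁) (l := IxZ n₁ n₂ n₃)
  have c₄ : (⟨Matrix.fromCols 0 sys.A, 0, fun s => Matrix.fromCols 0 (ev sys.E s),
      fun s => row₃ 0 0 (ev sys.A₂ s), 0, 0⟩ :
      PQRS (IxW nw nx) (IxZ n₁ n₂ n₃) (Fin nx) (IxZ n₁ n₂ n₃)).Cont :=
    PQRS.cont_of_ker_eq_zero continuous_const
      (continuous_fromCols continuous_const (continuous_ev _))
      (continuous_row₃ continuous_const continuous_const (continuous_ev _))
  rw [PQRS.opF_add sys.dataA_cont sys.dataB_cont hz hs, dataA,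
    PQRS.opF_add ((c₁.add c₂).add c₃) c₄ hz hs,
    PQRS.opF_add (c₁.add c₂) c₃ hz hs, PQRS.opF_add c₁ c₂ hz hs,
    PQRS.opF_comp (X := ⟨0, ev sys.Ea, 0, ev sys.A₀, 0, 0⟩)
      (PQRS.cont_of_ker_eq_zero (continuous_ev _) continuous_const (continuous_ev _))
      sys.stateData_cont _ ζ.memLp_zf hs,
    PQRS.opF_comp (X := ⟨0, ev sys.Eb, 0, ev sys.A₁, 0, 0⟩)
      (PQRS.cont_of_ker_eq_zero (continuous_ev _) continuous_const (continuous_ev _))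
      sys.derivData_cont _ ζ.memLp_zf hs,
    PQRS.opF_comp (X := ⟨sys.E₁, 0, 0, 0, 0, 0⟩)
      (PQRS.cont_of_ker_eq_zero continuous_const continuous_const continuous_const)
      sys.boundaryData_cont _ ζ.memLp_zf hs, dataB]
  simp only [PQRS.opF_of_ker_eq_zero, sys.stateData_opF hab hBT hbc hs,
    sys.derivData_opF hab hBT hbc hs, Matrix.fromCols_mulVec_sumElim, Pi.zero_apply,
    Matrix.zero_mulVec, zero_add, add_zero, SobolevState.zf, row₃_mulVec, opA₂]
  abel

lemma data0_opF {s : ℝ} (hs : s ∈ Icc a b) :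
    (sys.data0 a b).opF a b (Sum.elim w x) ζ.zf s = ζ.zp s :=
  sys.stateData_opF hab hBT hbc hs

/-- The form of `J` is half of `d/dt ⟨v, X v⟩ + |y|² - γ² |w|²` along a solution. -/
lemma dataJ_form (γ : ℝ) {X : PQRS (Fin nx) (IxZ n₁ n₂ n₃) (Fin nx) (IxZ n₁ n₂ n₃)}
    (hX : X.Cont) {y : Fin ny → ℝ} (hy : y = sys.opC x ζ + sys.Dw *ᵥ w) :
    (sys.dataJ a b γ X).form a b (Sum.elim w x) ζ.zf (Sum.elim w x) ζ.zf
      = X.form a b x ζ.zp (sys.opA₁ x ζ + sys.Bwo *ᵥ w)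
          (fun s => sys.opA₂ x ζ s + ev sys.Bwp s *ᵥ w)
        + 1 / 2 * (y ⬝ᵥ y - γ ^ 2 * (w ⬝ᵥ w)) := by
  have hz := ζ.memLp_zf
  have cAB := sys.dataA_cont (a := a) (b := b) |>.add sys.dataB_cont
  have cC := sys.dataC_cont (a := a) (b := b)
  have cD := sys.dataD_cont
  have c0 := sys.data0_cont (a := a) (b := b)
  have cM : (⟨sys.D₀ᵀ * sys.D₀ - γ ^ 2 • ((I₀ nw nx)ᵀ * I₀ nw nx), 0, 0, 0, 0, 0⟩ :
      PQRS (IxW nw nx) (IxZ n₁ n₂ n₃) (IxW nw nx) (IxZ n₁ n₂ n₃)).Cont :=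
    PQRS.cont_of_ker_eq_zero continuous_const continuous_const continuous_const
  have cCC := cC.adj.comp a b cC
  have cK := c0.adj.comp a b hX
  have hABF := PQRS.opF_memLp cAB (Sum.elim w x) hz
  have h0V : (sys.data0 a b).opV a b (Sum.elim w x) ζ.zf = x := by
    simp [PQRS.opV, data0, I₁]
  have hDV : sys.dataD.opV a b (Sum.elim w x) ζ.zf = sys.Dw *ᵥ w := by
    simp [PQRS.opV, dataD, D₀]
  have t₁ : (PQRS.comp a b (PQRS.comp a b (sys.data0 a b).adj X) (sys.dataA a b + sys.dataB)).form
      a b (Sum.elim w x) ζ.zf (Sum.elim w x) ζ.zf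
      = X.form a b x ζ.zp (sys.opA₁ x ζ + sys.Bwo *ᵥ w)
          (fun s => sys.opA₂ x ζ s + ev sys.Bwp s *ᵥ w) := by
    have hF : ∀ᵐ s ∂volume.restrict (Icc a b),
        (sys.dataA a b + sys.dataB).opF a b (Sum.elim w x) ζ.zf s
          = sys.opA₂ x ζ s + ev sys.Bwp s *ᵥ w := by
      rw [ae_restrict_iff' measurableSet_Icc]
      exact Filter.Eventually.of_forall fun s hs => sys.dataA_add_dataB_opF hab hBT hbc hs
    have hF2 : MemLp (fun s => sys.opA₂ x ζ s + ev sys.Bwp s *ᵥ w) 2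
        (volume.restrict (Icc a b)) := hABF.ae_eq hF
    have h0F : ∀ᵐ s ∂volume.restrict (Icc a b),
        (sys.data0 a b).opF a b (Sum.elim w x) ζ.zf s = ζ.zp s := by
      rw [ae_restrict_iff' measurableSet_Icc]
      exact Filter.Eventually.of_forall fun s hs => sys.data0_opF hab hBT hbc hs
    rw [PQRS.form_comp cK cAB hab _ _ _ hz, PQRS.form_comp c0.adj hX hab _ _ _ hABF,
      PQRS.form_adj c0 (PQRS.opF_memLp hX _ hABF) hz, PQRS.form, h0V, PQRS.pairing_comm,
      ← PQRS.form, sys.dataA_add_dataB_opV hab hBT hbc]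
    exact PQRS.form_congr h0F hF
  have hC := sys.dataC_opV hab hBT hbc
  have t₂ : (PQRS.comp a b (sys.dataC a b).adj (sys.dataC a b)).form
      a b (Sum.elim w x) ζ.zf (Sum.elim w x) ζ.zf = sys.opC x ζ ⬝ᵥ sys.opC x ζ := by
    rw [PQRS.form_comp cC.adj cC hab _ _ _ hz, PQRS.form_adj cC (PQRS.opF_memLp cC _ hz) hz,
      PQRS.form, hC]
    simp [PQRS.pairing]
  have t₃ : PQRS.form a b (⟨sys.D₀ᵀ * sys.D₀ - γ ^ 2 • ((I₀ nw nx)ᵀ * I₀ nw nx), 0, 0, 0, 0, 0⟩ :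
      PQRS (IxW nw nx) (IxZ n₁ n₂ n₃) (IxW nw nx) (IxZ n₁ n₂ n₃)) (Sum.elim w x) ζ.zf
      (Sum.elim w x) ζ.zf = (sys.Dw *ᵥ w) ⬝ᵥ (sys.Dw *ᵥ w) - γ ^ 2 * (w ⬝ᵥ w) := by
    have hD : sys.D₀ *ᵥ Sum.elim w x = sys.Dw *ᵥ w := by simp [D₀]
    have hI : I₀ nw nx *ᵥ Sum.elim w x = w := by simp [I₀]
    simp only [PQRS.form, PQRS.pairing, PQRS.opF_of_ker_eq_zero, PQRS.opV, Pi.zero_apply,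
      Matrix.zero_mulVec, integral_zero, add_zero, dotProduct_zero, Matrix.sub_mulVec,
      Matrix.smul_mulVec, dotProduct_sub, dotProduct_smul, smul_eq_mul, ← Matrix.mulVec_mulVec,
      hD, hI]
    rw [Matrix.dotProduct_mulVec _ sys.D₀ᵀ, Matrix.dotProduct_mulVec _ (I₀ nw nx)ᵀ,
      Matrix.vecMul_transpose,
      Matrix.vecMul_transpose, hD, hI]
  have t₄ : (PQRS.comp a b (sys.dataC a b).adj sys.dataD).form
      a b (Sum.elim w x) ζ.zf (Sum.elim w x) ζ.zf = (sys.Dw *ᵥ w) ⬝ᵥ sys.opC x ζ := by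
    rw [PQRS.form_comp cC.adj cD hab _ _ _ hz, PQRS.form_adj cC (PQRS.opF_memLp cD _ hz) hz,
      PQRS.form, hC, hDV]
    simp [PQRS.pairing]
  rw [dataJ, PQRS.form_add ((cK.comp a b cAB).add ((cCC.add cM).smul _)) (cC.adj.comp a b cD) hz hz,
    PQRS.form_add (cK.comp a b cAB) ((cCC.add cM).smul _) hz hz, PQRS.form_smul,
    PQRS.form_add cCC cM hz hz, t₁, t₂, t₃, t₄, hy, add_dotProduct, dotProduct_add, dotProduct_add,
    dotProduct_comm (sys.opC x ζ) (sys.Dw *ᵥ w)]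
  ring

/-- The dissipation inequality `d/dt ⟨v, X v⟩ + |y|² - γ² |w|² ≤ 0` along a solution. -/
lemma dissipation {γ : ℝ} {d : ℕ}
    {X : PQRS (Fin nx) (IxZ n₁ n₂ n₃) (Fin nx) (IxZ n₁ n₂ n₃)} (hX : X.Cont)
    (hJ : -(sys.dataJ a b γ X) - (sys.dataJ a b γ X).adj ∈ Phi a b d)
    {y : Fin ny → ℝ} (hy : y = sys.opC x ζ + sys.Dw *ᵥ w) :
    2 * X.form a b x ζ.zp (sys.opA₁ x ζ + sys.Bwo *ᵥ w)
        (fun s => sys.opA₂ x ζ s + ev sys.Bwp s *ᵥ w)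
      ≤ γ ^ 2 * (w ⬝ᵥ w) - y ⬝ᵥ y := by
  have h := (Phi.form_symm_nonneg hab hJ (Sum.elim w x) (Sum.elim w x) ζ.memLp_zf ζ.memLp_zf).2
  rw [PQRS.form_neg_sub_adj (sys.dataJ_cont γ hX) ζ.memLp_zf,
    sys.dataJ_form hab hBT hbc γ hX hy] at h
  linarith

end Ops

end System

/-! ### Quadratic forms along absolutely continuous curves -/

section Curve

variable {H : Type} [NormedAddCommGroup H] [InnerProductSpace ℝ H] [CompleteSpace H]

/-- The fundamental theorem of calculus for `t ↦ ⟪v t, A (v t)⟫`, where `v` is the primitive of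
`v'` and `A` is symmetric: the integral of `⟪v' s, A (v' t)⟫` over the square `[0, τ]²` is twice
the integral over the triangle `s < t`. -/
lemma inner_primitive_eq_integral {A : H →L[ℝ] H} (hA : (A : H →ₗ[ℝ] H).IsSymmetric) {v v' : ℝ → H}
    {τ : ℝ} (hτ : 0 ≤ τ) (hv' : IntegrableOn v' (Icc 0 τ))
    (hv : ∀ t ∈ Icc 0 τ, v t = ∫ s in (0 : ℝ)..t, v' s) :
    IntegrableOn (fun t => inner ℝ (v t) (A (v' t))) (Icc 0 τ) ∧
      inner ℝ (v τ) (A (v τ)) = 2 * ∫ t in Icc 0 τ, inner ℝ (v t) (A (v' t)) := by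
  have hi : Integrable v' (volume.restrict (Icc 0 τ)) := hv'
  have hAi : Integrable (fun t => A (v' t)) (volume.restrict (Icc 0 τ)) := A.integrable_comp hi
  set g : ℝ → ℝ → ℝ := fun s t => inner ℝ (v' s) (A (v' t)) with hg
  have hsymm : ∀ s t, g s t = g t s := fun s t => by
    rw [hg]
    exact ((real_inner_comm _ _).trans (hA (v' t) (v' s)))
  have hgi : Integrable (fun p : ℝ × ℝ => g p.1 p.2)
      ((volume.restrict (Icc 0 τ)).prod (volume.restrict (Icc 0 τ))) :=
    hi.op_fst_snd (op := fun x y : H => inner ℝ x y) (by fun_prop)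
      ⟨1, fun x y => by simpa using abs_real_inner_le_norm x y⟩ hAi
  have hmeas : MeasurableSet {p : ℝ × ℝ | p.1 < p.2} :=
    measurableSet_lt measurable_fst measurable_snd
  have hki : Integrable (fun p : ℝ × ℝ => if p.1 < p.2 then g p.1 p.2 else 0)
      ((volume.restrict (Icc 0 τ)).prod (volume.restrict (Icc 0 τ))) := hgi.indicator hmeas
  have hki' : Integrable (fun p : ℝ × ℝ => if p.1 < p.2 then 0 else g p.1 p.2)
      ((volume.restrict (Icc 0 τ)).prod (volume.restrict (Icc 0 τ))) := by
    refine (hgi.indicator hmeas.compl).congr (Filter.Eventually.of_forall fun p => ?_)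
    by_cases h : p.1 < p.2 <;> simp [h, indicator]
  have hk : ∀ t ∈ Icc 0 τ, (∫ s in Icc 0 τ, if s < t then g s t else 0)
      = inner ℝ (v t) (A (v' t)) := fun t ht => by
    have hit : IntegrableOn v' (Ioc 0 t) :=
      hv'.mono_set (Ioc_subset_Icc_self.trans (Icc_subset_Icc_right ht.2))
    rw [integral_Icc_ite_lt ht fun s => g s t, hv t ht, real_inner_comm,
      intervalIntegral.integral_of_le ht.1, intervalIntegral.integral_of_le ht.1,
      ← integral_inner hit]
    simp only [hg, real_inner_comm]
  have hk' : ∀ s ∈ Icc 0 τ, (∫ t in Icc 0 τ, if s < t then 0 else g s t)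
      = inner ℝ (v s) (A (v' s)) := fun s hs => by
    rw [← hk s hs]
    refine integral_congr_ae ?_
    filter_upwards [ae_restrict_of_ae (Measure.ae_ne volume s)] with t ht
    rcases lt_or_gt_of_ne ht with h | h
    · simp only [h, h.not_gt, if_true, if_false, hsymm s t]
    · simp only [h, h.not_gt, if_true, if_false]
  have hgk : ∫ p, g p.1 p.2 ∂((volume.restrict (Icc 0 τ)).prod (volume.restrict (Icc 0 τ)))
      = inner ℝ (v τ) (A (v τ)) := by
    have hV : ∫ t in Icc 0 τ, v' t = v τ := by
      rw [hv τ ⟨hτ, le_rfl⟩, intervalIntegral.integral_of_le hτ, integral_Icc_eq_integral_Ioc]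
    rw [integral_prod _ hgi]
    simp only [hg, integral_inner hAi, A.integral_comp_comm hi, hV]
    simp only [real_inner_comm (A (v τ)), integral_inner hi, hV]
  refine ⟨?_, ?_⟩
  · refine Integrable.congr hki.integral_prod_right ?_
    rw [Filter.EventuallyEq, ae_restrict_iff' measurableSet_Icc]
    exact Filter.Eventually.of_forall hk
  · have hsum : ∀ p : ℝ × ℝ, g p.1 p.2 = (if p.1 < p.2 then g p.1 p.2 else 0)
        + if p.1 < p.2 then 0 else g p.1 p.2 := fun p => by split_ifs <;> simp
    rw [← hgk, integral_congr_ae (Filter.Eventually.of_forall hsum), integral_add hki hki',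
      integral_prod_symm _ hki, integral_prod _ hki', setIntegral_congr_fun measurableSet_Icc hk,
      setIntegral_congr_fun measurableSet_Icc hk', two_mul]

end Curve

/-! ### The self-adjoint operator of a symmetric form -/

section Operator

variable {m q : Type} [Fintype m] [Fintype q] {a b : ℝ}

/-- The Hilbert space `ℝ^m × L₂^q[a, b]`. -/
abbrev HilbertState (a b : ℝ) (m q : Type) [Fintype m] [Fintype q] : Type :=
  WithLp 2 (EuclideanSpace ℝ m × Lp (EuclideanSpace ℝ q) 2 (volume.restrict (Icc a b)))

namespace HilbertState

/-- The finite-dimensional component. -/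
def fst (v : HilbertState a b m q) : m → ℝ := v.ofLp.1.ofLp

/-- A representative of the distributed component. -/
noncomputable def snd (v : HilbertState a b m q) (s : ℝ) : q → ℝ := (v.ofLp.2 s).ofLp

lemma memLp_snd (v : HilbertState a b m q) : MemLp v.snd 2 (volume.restrict (Icc a b)) :=
  memLp_pi_iff.2 (memLp_piLp_iff.1 (Lp.memLp v.ofLp.2))

lemma inner_eq_pairing (u v : HilbertState a b m q) :
    inner ℝ u v = PQRS.pairing a b u.fst u.snd v.fst v.snd := by
  rw [WithLp.prod_inner_apply, L2.inner_def, EuclideanSpace.inner_eq_star_dotProduct,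
    PQRS.pairing, dotProduct_comm]
  simp only [EuclideanSpace.inner_eq_star_dotProduct, star_trivial, snd, fst]
  simp only [dotProduct_comm]

end HilbertState

namespace PQRS

variable {X : PQRS m q m q}

/-- The operator given by continuous data `X`, as a map of `ℝ^m × L₂^q[a, b]`. -/
noncomputable def hilbertOp (hX : X.Cont) (v : HilbertState a b m q) : HilbertState a b m q :=
  WithLp.toLp 2 (WithLp.toLp 2 (X.opV a b v.fst v.snd),
    MemLp.toLp (fun s => WithLp.toLp 2 (X.opF a b v.fst v.snd s))
      (memLp_piLp_iff.2 (memLp_pi_iff.1 (opF_memLp hX v.fst v.memLp_snd))))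

lemma inner_hilbertOp (hX : X.Cont) (u v : HilbertState a b m q) :
    inner ℝ u (hilbertOp hX v) = X.form a b u.fst u.snd v.fst v.snd := by
  rw [HilbertState.inner_eq_pairing, form]
  refine pairing_congr_right ?_
  filter_upwards [MemLp.coeFn_toLp (memLp_piLp_iff.2
    (memLp_pi_iff.1 (opF_memLp hX v.fst v.memLp_snd)) : MemLp (fun s =>
      WithLp.toLp 2 (X.opF a b v.fst v.snd s)) 2 (volume.restrict (Icc a b)))] with s hs
  simp only [HilbertState.snd, hilbertOp, hs]

/-- A symmetric form is represented by a bounded operator: a map satisfying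
`⟪A u, v⟫ = ⟪u, A v⟫` is automatically linear, and continuous by Hellinger–Toeplitz. -/
lemma exists_continuousLinearMap (hX : X.Cont)
    (hs : ∀ (u x : m → ℝ) (f z : ℝ → q → ℝ), MemLp f 2 (volume.restrict (Icc a b)) →
      MemLp z 2 (volume.restrict (Icc a b)) → X.form a b u f x z = X.form a b x z u f) :
    ∃ A : HilbertState a b m q →L[ℝ] HilbertState a b m q,
      (A : HilbertState a b m q →ₗ[ℝ] HilbertState a b m q).IsSymmetric ∧
      ∀ u v, inner ℝ u (A v) = X.form a b u.fst u.snd v.fst v.snd := by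
  have hsymm : ∀ u v : HilbertState a b m q,
      inner ℝ (hilbertOp hX u) v = inner ℝ u (hilbertOp hX v) := fun u v => by
    rw [real_inner_comm, inner_hilbertOp, inner_hilbertOp, hs _ _ _ _ v.memLp_snd u.memLp_snd]
  let A₀ : HilbertState a b m q →ₗ[ℝ] HilbertState a b m q :=
    { toFun := hilbertOp hX
      map_add' := fun v v' => ext_inner_left ℝ fun u => by
        rw [inner_add_right, ← hsymm, ← hsymm, ← hsymm, inner_add_right]
      map_smul' := fun c v => ext_inner_left ℝ fun u => by
        rw [RingHom.id_apply, inner_smul_right, ← hsymm, ← hsymm, inner_smul_right] }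
  have hA₀ : A₀.IsSymmetric := hsymm
  exact ⟨⟨A₀, hA₀.continuous⟩, hA₀, fun u v => inner_hilbertOp hX u v⟩

end PQRS

end Operator

/-! ### The `L₂`-gain estimate -/

/-- Domination of the truncated energies bounds the `L₂` norm on `[0, ∞)`. -/
lemma eLpNorm_le_of_forall_integral_le {F G : Type} [NormedAddCommGroup F] [NormedAddCommGroup G]
    {y : ℝ → F} {w : ℝ → G} {γ : ℝ} (hγ : 0 ≤ γ) (hw : MemLp w 2 (volume.restrict (Ici (0 : ℝ))))
    (hy : MemLp y 2 (volume.restrict (Ici (0 : ℝ))))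
    (h : ∀ τ : ℝ, 0 ≤ τ → ∫ t in Icc 0 τ, ‖y t‖ ^ 2 ≤ γ ^ 2 * ∫ t in Icc 0 τ, ‖w t‖ ^ 2) :
    eLpNorm y 2 (volume.restrict (Ici (0 : ℝ)))
      ≤ ENNReal.ofReal γ * eLpNorm w 2 (volume.restrict (Ici (0 : ℝ))) := by
  have iy : IntegrableOn (fun t => ‖y t‖ ^ 2) (Ioi 0) :=
    (show IntegrableOn (fun t => ‖y t‖ ^ 2) (Ici 0) volume from
      hy.integrable_norm_pow two_ne_zero).mono_set Ioi_subset_Ici_self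
  have iw : IntegrableOn (fun t => ‖w t‖ ^ 2) (Ioi 0) :=
    (show IntegrableOn (fun t => ‖w t‖ ^ 2) (Ici 0) volume from
      hw.integrable_norm_pow two_ne_zero).mono_set Ioi_subset_Ici_self
  have hlim : ∫ t in Ici (0 : ℝ), ‖y t‖ ^ 2 ≤ γ ^ 2 * ∫ t in Ici (0 : ℝ), ‖w t‖ ^ 2 := by
    rw [integral_Ici_eq_integral_Ioi, integral_Ici_eq_integral_Ioi]
    refine le_of_tendsto_of_tendsto
      (intervalIntegral_tendsto_integral_Ioi 0 iy Filter.tendsto_id)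
      ((intervalIntegral_tendsto_integral_Ioi 0 iw Filter.tendsto_id).const_mul (γ ^ 2)) ?_
    filter_upwards [Filter.eventually_ge_atTop (0 : ℝ)] with τ hτ
    simpa only [id, intervalIntegral.integral_of_le hτ, integral_Icc_eq_integral_Ioc] using h τ hτ
  rw [hy.eLpNorm_eq_integral_rpow_norm two_ne_zero ENNReal.ofNat_ne_top,
    hw.eLpNorm_eq_integral_rpow_norm two_ne_zero ENNReal.ofNat_ne_top, ← ENNReal.ofReal_mul hγ]
  refine ENNReal.ofReal_le_ofReal ?_
  simp only [ENNReal.toReal_ofNat, Real.rpow_ofNat]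
  rw [← one_div, ← Real.sqrt_eq_rpow, ← Real.sqrt_eq_rpow]
  refine (Real.sqrt_le_sqrt hlim).trans_eq ?_
  rw [Real.sqrt_mul (sq_nonneg γ), Real.sqrt_sq hγ]

variable {nx nw ny n₁ n₂ n₃ : ℕ}

/-- The storage function `⟨v, X v⟩` along a trajectory: it vanishes at time `0`, is nonnegative at
time `τ`, and grows no faster than `γ² |w|² - |y|²`. -/
lemma System.IsTrajectory.integral_norm_sq_le {sys : System nx nw ny n₁ n₂ n₃} {a b : ℝ}
    (hab : a ≤ b) (hBT : IsUnit (sys.B * System.matT a b n₂ n₃).det) {γ : ℝ} {d : ℕ}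
    {X : PQRS (Fin nx) (IxZ n₁ n₂ n₃) (Fin nx) (IxZ n₁ n₂ n₃)} (hX : X.Cont)
    (hs : ∀ (u x : Fin nx → ℝ) (f z : ℝ → IxZ n₁ n₂ n₃ → ℝ),
      MemLp f 2 (volume.restrict (Icc a b)) → MemLp z 2 (volume.restrict (Icc a b)) →
      X.form a b u f x z = X.form a b x z u f ∧ 0 ≤ X.form a b x z x z)
    (hJ : -(sys.dataJ a b γ X) - (sys.dataJ a b γ X).adj ∈ Phi a b d)
    {w : ℝ → EuclideanSpace ℝ (Fin nw)} {y : ℝ → EuclideanSpace ℝ (Fin ny)}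
    (hw : MemLp w 2 (volume.restrict (Ici (0 : ℝ))))
    (hy : MemLp y 2 (volume.restrict (Ici (0 : ℝ))))
    {x : ℝ → EuclideanSpace ℝ (Fin nx)} {z : ℝ → L2Z a b n₁ n₂ n₃}
    (htraj : sys.IsTrajectory a b w y x z) {τ : ℝ} (hτ : 0 ≤ τ) :
    ∫ t in Icc 0 τ, ‖y t‖ ^ 2 ≤ γ ^ 2 * ∫ t in Icc 0 τ, ‖w t‖ ^ 2 := by
  obtain ⟨x', z', hprim, hode⟩ := htraj
  obtain ⟨A, hA, hAX⟩ := PQRS.exists_continuousLinearMap hX fun u x f z hf hz =>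
    (hs u x f z hf hz).1
  let e := (WithLp.prodContinuousLinearEquiv 2 ℝ (EuclideanSpace ℝ (Fin nx))
    (L2Z a b n₁ n₂ n₃)).symm
  let v : ℝ → HilbertState a b (Fin nx) (IxZ n₁ n₂ n₃) := fun t => e (x t, z t)
  let v' : ℝ → HilbertState a b (Fin nx) (IxZ n₁ n₂ n₃) := fun t => e (x' t, z' t)
  have hv' : IntegrableOn v' (Icc 0 τ) :=
    e.toContinuousLinearMap.integrable_comp ((hprim τ hτ).1.prodMk (hprim τ hτ).2.1)
  have hv : ∀ t ∈ Icc 0 τ, v t = ∫ s in (0 : ℝ)..t, v' s := fun t ht => by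
    obtain ⟨ix, iz, hx, hz⟩ := hprim t ht.1
    simp only [v, v', hx, hz, intervalIntegral.integral_of_le ht.1]
    rw [e.integral_comp_comm, integral_pair (ix.mono_set Ioc_subset_Icc_self)
      (iz.mono_set Ioc_subset_Icc_self)]
  obtain ⟨hint, hFTC⟩ := inner_primitive_eq_integral hA hτ hv' hv
  have hV : 0 ≤ inner ℝ (v τ) (A (v τ)) := by
    rw [hAX]
    exact (hs 0 _ _ _ (v τ).memLp_snd (v τ).memLp_snd).2
  have hsub : Icc 0 τ ⊆ Ici (0 : ℝ) := fun t ht => ht.1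
  have iy : IntegrableOn (fun t => ‖y t‖ ^ 2) (Icc 0 τ) :=
    (show IntegrableOn (fun t => ‖y t‖ ^ 2) (Ici 0) volume from
      hy.integrable_norm_pow two_ne_zero).mono_set hsub
  have iw : IntegrableOn (fun t => ‖w t‖ ^ 2) (Icc 0 τ) :=
    (show IntegrableOn (fun t => ‖w t‖ ^ 2) (Ici 0) volume from
      hw.integrable_norm_pow two_ne_zero).mono_set hsub
  have hdiss : ∀ᵐ t ∂volume.restrict (Icc 0 τ),
      2 * inner ℝ (v t) (A (v' t)) ≤ γ ^ 2 * ‖w t‖ ^ 2 - ‖y t‖ ^ 2 := by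
    filter_upwards [ae_restrict_of_ae_restrict_of_subset hsub hode] with t ht
    obtain ⟨ζ, hz, hbc, hx', hz', hyt⟩ := ht
    have hform : inner ℝ (v t) (A (v' t)) = X.form a b (x t).ofLp ζ.zp
        (sys.opA₁ (x t).ofLp ζ + sys.Bwo *ᵥ (w t).ofLp)
        (fun s => sys.opA₂ (x t).ofLp ζ s + ev sys.Bwp s *ᵥ (w t).ofLp) := by
      rw [hAX, ← hx']
      exact PQRS.form_congr hz hz'
    rw [hform, EuclideanSpace.real_norm_sq_eq, EuclideanSpace.real_norm_sq_eq]
    simpa only [dotProduct, ← sq] using sys.dissipation hab hBT hbc hX hJ hyt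
  have hmono := integral_mono_ae (hint.const_mul 2) ((iw.const_mul (γ ^ 2)).sub iy) hdiss
  have hsubi : ∫ t in Icc 0 τ, (γ ^ 2 * ‖w t‖ ^ 2 - ‖y t‖ ^ 2)
      = γ ^ 2 * (∫ t in Icc 0 τ, ‖w t‖ ^ 2) - ∫ t in Icc 0 τ, ‖y t‖ ^ 2 := by
    rw [integral_sub (iw.const_mul (γ ^ 2)) iy, integral_const_mul]
  rw [integral_const_mul, ← hFTC] at hmono
  have := hmono.trans_eq hsubi
  linarith

end CoupledODEPDE

theorem mainTheorem1 {nx nw ny n₁ n₂ n₃ : ℕ} (sys : System nx nw ny n₁ n₂ n₃)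
    (a b : ℝ) (hab : a < b)
    (hBT : IsUnit (sys.B * System.matT a b n₂ n₃).det)
    (ε γ : ℝ) (hε : 0 < ε) (hγ : 0 < γ) (d₁ d₂ : ℕ)
    (P : Matrix (Fin nx) (Fin nx) ℝ) (hP : P.IsSymm)
    (Q : Matrix (Fin nx) (IxZ n₁ n₂ n₃) (Polynomial ℝ))
    (S : Matrix (IxZ n₁ n₂ n₃) (IxZ n₁ n₂ n₃) (Polynomial ℝ)) (hS : S.IsSymm)
    (R₁ R₂ : Matrix (IxZ n₁ n₂ n₃) (IxZ n₁ n₂ n₃) (MvPolynomial (Fin 2) ℝ))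
    (hPos : (⟨P - ε • 1, ev Q, fun s => (ev Q s)ᵀ, fun s => ev S s - ε • 1, ev₂ R₁, ev₂ R₂⟩ :
      PQRS (Fin nx) (IxZ n₁ n₂ n₃) (Fin nx) (IxZ n₁ n₂ n₃)) ∈ Phi a b d₁)
    (hNeg : -(sys.dataJ a b γ ⟨P, ev Q, fun s => (ev Q s)ᵀ, ev S, ev₂ R₁, ev₂ R₂⟩)
        - (sys.dataJ a b γ ⟨P, ev Q, fun s => (ev Q s)ᵀ, ev S, ev₂ R₁, ev₂ R₂⟩).adj
      ∈ Phi a b d₂)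
    (w : ℝ → EuclideanSpace ℝ (Fin nw)) (y : ℝ → EuclideanSpace ℝ (Fin ny))
    (hw : MemLp w 2 (volume.restrict (Ici (0 : ℝ))))
    (hy : MemLp y 2 (volume.restrict (Ici (0 : ℝ))))
    (x : ℝ → EuclideanSpace ℝ (Fin nx)) (z : ℝ → L2Z a b n₁ n₂ n₃)
    (htraj : sys.IsTrajectory a b w y x z) :
    eLpNorm y 2 (volume.restrict (Ici (0 : ℝ)))
      ≤ ENNReal.ofReal γ * eLpNorm w 2 (volume.restrict (Ici (0 : ℝ))) := by
  have hX : (⟨P, ev Q, fun s => (ev Q s)ᵀ, ev S, ev₂ R₁, ev₂ R₂⟩ :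
      PQRS (Fin nx) (IxZ n₁ n₂ n₃) (Fin nx) (IxZ n₁ n₂ n₃)).Cont :=
    ⟨continuous_ev Q, (continuous_ev Q).matrix_transpose, continuous_ev S, continuous_ev₂ R₁,
      continuous_ev₂ R₂⟩
  exact eLpNorm_le_of_forall_integral_le hγ.le hw hy fun τ hτ =>
    htraj.integral_norm_sq_le hab.le hBT hX
      (fun u x f z hf hz => PQRS.form_symm_nonneg_of_sub_mem hab.le hX hε.le hPos u x hf hz)
      hNeg hw hy hτ
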